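/- **Setting.** Let $\xi_0,\xi_1,\dots$ be i.i.d. complex random variables that are not almost surely constant and satisfy $\mathbb E\log(1+|\xi_0|)<\infty$. Let $a_{k;n}$ ($0\le k\le n$) be complex numbers and let $g:[0,1]\to\mathbb R$ be continuous and concave with finite left derivative at $1$, such that $$\lim_{n\to\infty}\sup_{0\le k\le n}\Big|\tfrac1n\log|a_{k;n}|-g\big(\tfrac kn\big)\Big|=0 .$$ Assume further that $g$ is infinitely differentiable on $(0,1)$ with $g''<0$ there and, if $g'(0+)=+\infty$, that $\lim_{\alpha\downarrow0}\alpha e^{g'(\alpha)}=0$. Put $P_n(z)=\sum_{k=0}^n\xi_k a_{k;n}z^k$. For $t\in\mathbb C$ let $\nu_t$ be the (deterministic) probability measure on $\mathbb C$ that is the weak limit in probability, as $n\to\infty$, of the empirical distribution of the zeros (with multiplicity) of $\exp\{-\frac{t}{2n}\partial_z^2\}P_n$. For $z\neq0$ let $\alpha_0(z)$ be the unique maximizer of $\alpha\mapsto g(\alpha)+\alpha\log|z|$ on $[0,1]$. For $t\in\mathbb C$ let $$T_t(w)=w+t\,\frac{\alpha_0(w)}{w}\quad(w\ne0),\qquad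 T_t(0)=0,$$ and let $$t_{\mathrm{sing}}=\inf_{\alpha\in(0,1)}\left|\frac{g''(\alpha)e^{-2g'(\alpha)}}{1+\alpha g''(\alpha)}\right|\in[0,\infty],$$ where the quotient is $+\infty$ if its denominator vanishes. Let $W_2$ be the Wasserstein distance on $\mathbb C$ for the cost $|z-w|^2$. A map $T$ is an optimal transport map from $\mu$ to $\nu$ if $(\mathrm{Id},T)_\#\mu$ is a coupling of $\mu$ and $\nu$ that minimizes $\int|z-w|^2\,dq$ over all couplings $q$ of $\mu$ and $\nu$. A curve $(\mu_s)_{s\in[0,1]}$ is a constant speed Wasserstein geodesic if $W_2(\mu_0,\mu_1)<\infty$ and $W_2(\mu_s,\mu_u)=|u-s|\,W_2(\mu_0,\mu_1)$ for all $s,u\in[0,1]$. **Theorem.** (a) For every $t\in\mathbb C$ with $0<|t|<t_{\mathrm{sing}}$, the map $T_t$ is an optimal transport map from $\nu_0$ to $\nu_t$ if and only if $\nu_0$ is the uniform probability measure on a disk $\{|z|\le r\}$ for some $r>0$. (b) If $\nu_0$ is the uniform probability measure on $\{|z|\le r\}$, $r>0$, then for every $\tau\in\mathbb C$ with $|\tau|\le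 r^2$ the curve $(\nu_{s\tau})_{s\in[0,1]}$ is a constant speed Wasserstein geodesic. In particular, if $\nu_0$ is the uniform measure on the unit disk, then $(\nu_t)_{t\in[0,1]}$ is a constant speed Wasserstein geodesic. -/

import Mathlib

open MeasureTheory ProbabilityTheory Filter Topology Polynomial
open scoped ENNReal BoundedContinuousFunction

noncomputable section

namespace HeatFlowZeros

/-! ### The random polynomials and the heat flow -/

/-- Condition on the random variables: `ξ 0, ξ 1, …` are i.i.d. complex random variables, not
almost surely constant, with finite logarithmic moment. -/
structure IsCoefficientNoise {Ω : Type*} [MeasurableSpace Ω] (P : Measure Ω)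
    (ξ : ℕ → Ω → ℂ) : Prop where
  measurable : ∀ k, Measurable (ξ k)
  indep : iIndepFun ξ P
  identDistrib : ∀ k, IdentDistrib (ξ k) (ξ 0) P P
  nondegenerate : ¬ ∃ c : ℂ, ∀ᵐ ω ∂P, ξ 0 ω = c
  log_moment : Integrable (fun ω => Real.log (1 + ‖ξ 0 ω‖)) P

/-- Condition on the deterministic coefficients: `|a n k| = exp (n g (k / n) + o(n))` uniformly in
`0 ≤ k ≤ n`, where the exponential profile `g` is continuous and concave on `[0,1]` and its left
derivative at `1` is finite.  The values of `g` outside `[0,1]` are irrelevant. The clause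
`a n k ≠ 0` is there because `log 0 = -∞` in the mathematical condition but `Real.log 0 = 0`. -/
structure IsExponentialProfile (a : ℕ → ℕ → ℂ) (g : ℝ → ℝ) : Prop where
  continuousOn : ContinuousOn g (Set.Icc 0 1)
  concaveOn : ConcaveOn ℝ (Set.Icc 0 1) g
  left_deriv_one : DifferentiableWithinAt ℝ g (Set.Icc 0 1) 1
  growth : ∀ ε : ℝ, 0 < ε → ∀ᶠ n : ℕ in atTop, ∀ k : ℕ, k ≤ n →
    a n k ≠ 0 ∧ |(1 / (n : ℝ)) * Real.log ‖a n k‖ - g ((k : ℝ) / (n : ℝ))| ≤ ε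

/-- Regularity of the profile: `g` is smooth with `g'' < 0` on `(0,1)`, and if `g'(0+) = +∞` then
`α exp (g' α) → 0` as `α ↓ 0`. -/
structure IsRegularProfile (g : ℝ → ℝ) : Prop where
  smooth : ContDiffOn ℝ ((⊤ : ℕ∞) : WithTop ℕ∞) g (Set.Ioo 0 1)
  deriv2_neg : ∀ α ∈ Set.Ioo (0 : ℝ) 1, deriv (deriv g) α < 0
  vanishing : Tendsto (deriv g) (𝓝[>] 0) atTop →
    Tendsto (fun α : ℝ => α * Real.exp (deriv g α)) (𝓝[>] 0) (𝓝 0)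

/-- `P_n(z) = ∑_{k=0}^n ξ_k a_{k;n} z^k`, for a realisation `x` of the sequence `ξ`. -/
def randomPoly (a : ℕ → ℕ → ℂ) (x : ℕ → ℂ) (n : ℕ) : ℂ[X] :=
  ∑ k ∈ Finset.range (n + 1), C (x k * a n k) * X ^ k

/-- The heat-flow operator `exp (-(s/2) ∂²) p = ∑_j (1/j!) (-s/2)^j ∂^{2j} p`. The series is
truncated where its terms vanish. -/
def heatFlow (s : ℂ) (p : ℂ[X]) : ℂ[X] :=
  ∑ j ∈ Finset.range (p.natDegree + 1),
    C ((1 / (j.factorial : ℂ)) * (-(s / 2)) ^ j) * derivative^[2 * j] p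

/-- The empirical distribution of zeros, with multiplicity; it is `0` for constant polynomials. -/
def zeroMeasure (p : ℂ[X]) : Measure ℂ :=
  (p.natDegree : ℝ≥0∞)⁻¹ • (p.roots.map (fun z => Measure.dirac z)).sum

/-- The measure `ν` is the limit of the zeros of the polynomials `P_n` evolved by the heat flow up
to (complex) time `t`, that is, the random measures `⟦exp (-(t/(2n)) ∂²) P_n⟧` converge weakly in
probability to the deterministic measure `ν`. -/
def IsZeroLimit {Ω : Type*} [MeasurableSpace Ω] (P : Measure Ω) (ξ : ℕ → Ω → ℂ)
    (a : ℕ → ℕ → ℂ) (t : ℂ) (ν : Measure ℂ) : Prop :=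
  ∀ f : ℂ →ᵇ ℝ, TendstoInMeasure P
    (fun (n : ℕ) (ω : Ω) =>
      ∫ z, f z ∂(zeroMeasure (heatFlow (t / (n : ℂ)) (randomPoly a (fun k => ξ k ω) n))))
    atTop (fun _ => ∫ z, f z ∂ν)

/-! ### The transport map -/

/-- `α₀(z)`, `z ≠ 0`: the maximiser of `α ↦ g(α) + α log |z|` on `[0,1]`. It is unique when `g` is
continuous on `[0,1]` and strictly concave, and the supremum below is over a singleton. -/
def alphaZero (g : ℝ → ℝ) (z : ℂ) : ℝ :=
  sSup {α : ℝ | α ∈ Set.Icc (0 : ℝ) 1 ∧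
    IsMaxOn (fun β : ℝ => g β + β * Real.log ‖z‖) (Set.Icc 0 1) α}

/-- The transport map `T_t(w) = w + t α₀(w) / w`, with `T_t(0) = 0`. -/
def transportMap (g : ℝ → ℝ) (t : ℂ) (w : ℂ) : ℂ :=
  w + t * ((alphaZero g w : ℂ) / w)

/-- `t_sing = inf_{0<α<1} |g''(α) exp (-2 g'(α)) / (1 + α g''(α))| ∈ [0,∞]`, where the quotient is
`+∞` if the denominator vanishes. -/
def tSing (g : ℝ → ℝ) : ℝ≥0∞ :=
  ⨅ α ∈ Set.Ioo (0 : ℝ) 1,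
    ENNReal.ofReal |deriv (deriv g) α * Real.exp (-2 * deriv g α)| /
      ENNReal.ofReal |1 + α * deriv (deriv g) α|

/-- The uniform probability measure on the disk `{|z| ≤ r}`. -/
def uniformDisk (r : ℝ) : Measure ℂ :=
  ProbabilityTheory.cond volume (Metric.closedBall (0 : ℂ) r)

/-! ### Optimal transport on the plane, for the quadratic cost -/

/-- The couplings (transport plans) of `μ` and `ν`. -/
def couplings (μ ν : Measure ℂ) : Set (Measure (ℂ × ℂ)) :=
  {q | q.map Prod.fst = μ ∧ q.map Prod.snd = ν}

/-- The transport cost `∫ |z - w|² q(dz, dw)`. -/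
def transportCost (q : Measure (ℂ × ℂ)) : ℝ≥0∞ :=
  ∫⁻ p, ‖p.1 - p.2‖ₑ ^ 2 ∂q

/-- The Wasserstein distance `W₂`. -/
def wasserstein (μ ν : Measure ℂ) : ℝ≥0∞ :=
  (⨅ q ∈ couplings μ ν, transportCost q) ^ (1 / 2 : ℝ)

/-- `T` is an optimal transport map from `μ` to `ν`: the measure `(Id, T)_# μ` is a coupling of `μ`
and `ν` and attains the minimal cost among all couplings. -/
def IsOptimalMap (T : ℂ → ℂ) (μ ν : Measure ℂ) : Prop :=
  AEMeasurable T μ ∧ μ.map (fun z => (z, T z)) ∈ couplings μ ν ∧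
    ∀ q ∈ couplings μ ν, transportCost (μ.map (fun z => (z, T z))) ≤ transportCost q

/-- `(μ_s)_{s ∈ [0,1]}` is a constant speed geodesic for `W₂`. -/
def IsWassersteinGeodesic (μ : ℝ → Measure ℂ) : Prop :=
  wasserstein (μ 0) (μ 1) ≠ ∞ ∧
    ∀ s ∈ Set.Icc (0 : ℝ) 1, ∀ u ∈ Set.Icc (0 : ℝ) 1,
      wasserstein (μ s) (μ u) = ENNReal.ofReal |u - s| * wasserstein (μ 0) (μ 1)

end HeatFlowZeros

end

/-! The limits `ν t` enter only through weak convergence, so they are identified through logarithmic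
potentials. For a polynomial of degree `n`, the mean over the zeros of `truncLog δ (z - w)` is
bounded below by the value at `z` and above by the maximum on the circle of radius `δ` around `z`
(Jensen's inequality). With positive probability the random sum has the exponential size of its
largest term. Hence, wherever upper and lower exponential rates of the deterministic terms `a n k *
heatMonomial (t / n) k z` agree, they give the potential of `ν t` up to a constant
(`le_integral_truncLogDiff`, `logPot_sub_eq`). Circle means of the potential then recover the
measure (`measure_eq_of_bumps`, `measure_eq_of_logPot`). At time zero the rate is the Legendre
transform of `g`, and `ν 0` is the law of `exp (-g' α + i θ)` with `α` and `θ` uniform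
(`zeroLimit_zero_eq`).

Necessity in (a). In the coordinates `(α, θ)` an optimal plan cannot be improved by rotating the
targets of a small disk. To second order in the radius this says that the derivative of the
transport map is symmetric, and its antisymmetric part is `Im (t exp (-2 i θ)) * (1 / 2 + α g'' α)`
up to normalisation. So `α g'' α = -1 / 2` (`deriv2_of_isOptimalMap`), which integrates to the
profile of a uniform disk.

Sufficiency and (b). For a disk profile the coefficients are essentially those of Weyl polynomials,
and the evolved monomials have the generating function `exp (z x - s x ^ 2 / 2)`. Cauchy's estimate
bounds the rates above by a quadratic form (`IsDiskProfile.coeffUpperAt`); summing the generating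
series at a saddle point bounds them below inside an ellipse (`IsDiskProfile.coeffLower`). So `ν t`
is the image of the disk law under `w ↦ w + (t / r ^ 2) w̄` when `‖t‖ < r ^ 2`.

When `‖t‖ = r ^ 2` the ellipse collapses to a segment and there is no interior to argue in. The
upper bounds with radii `R > r` still hold, and averaging them over the Joukowski curves `w + t /
w`, `|w| = R`, forces equality. They therefore determine the measure (`measure_eq_of_potentialLe`),
and the degenerate ellipse law satisfies them by passage to the limit.

Finally, the maps `w ↦ w + s κ w̄` with `0 ≤ s ≤ 1`, `‖κ‖ ≤ 1` are simultaneously diagonal with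
nonnegative entries. Cauchy–Schwarz in each coordinate shows that the linear coupling is optimal
(`transportCost_ge`), which gives both optimality and the geodesic property. -/

namespace HeatFlowZeros

/-! ### The truncated logarithm and polynomials -/

/-- The truncated logarithmic kernel `log (max δ |z|)`. -/
noncomputable def truncLog (δ : ℝ) (z : ℂ) : ℝ := Real.log (max δ ‖z‖)

theorem norm_eval_eq_prod_roots (p : ℂ[X]) (z : ℂ) :
    ‖p.eval z‖ = ‖p.leadingCoeff‖ * (p.roots.map fun w => ‖z - w‖).prod := by
  have h := (IsAlgClosed.splits p).eval_eq_prod_roots z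
  rw [h, norm_mul]
  congr 1
  induction p.roots using Multiset.induction_on with
  | empty => simp
  | cons a s ih => simp [ih]

theorem norm_eval_le_prod_max (p : ℂ[X]) (δ : ℝ) (z : ℂ) :
    ‖p.eval z‖ ≤ ‖p.leadingCoeff‖ * (p.roots.map fun w => max δ ‖z - w‖).prod := by
  rw [norm_eval_eq_prod_roots]
  gcongr
  induction p.roots using Multiset.induction_on with
  | empty => simp
  | cons a s ih =>
    simp only [Multiset.map_cons, Multiset.prod_cons]
    gcongr
    · exact Multiset.prod_nonneg fun x hx => by
        obtain ⟨w, -, rfl⟩ := Multiset.mem_map.1 hx; positivity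
    · exact le_max_right _ _

/-- The factor `ζ - w` of a polynomial, reflected at the circle of radius `δ` around `z` if `w`
lies inside. -/
noncomputable def blaschke (δ : ℝ) (z w ζ : ℂ) : ℂ :=
  if δ ≤ ‖z - w‖ then ζ - w
  else ((δ : ℂ) ^ 2 - (starRingEnd ℂ) (w - z) * (ζ - z)) / δ

theorem blaschke_differentiable (δ : ℝ) (z w : ℂ) : Differentiable ℂ (blaschke δ z w) := by
  unfold blaschke
  split_ifs <;> fun_prop

theorem norm_blaschke_center {δ : ℝ} (hδ : 0 < δ) (z w : ℂ) :
    ‖blaschke δ z w z‖ = max δ ‖z - w‖ := by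
  unfold blaschke
  split_ifs with h
  · rw [max_eq_right h]
  · rw [max_eq_left (not_le.1 h).le]
    have : (δ : ℂ) ≠ 0 := by exact_mod_cast hδ.ne'
    simp only [sub_self, mul_zero, sub_zero, norm_div, norm_pow, Complex.norm_real,
      Real.norm_eq_abs, abs_of_pos hδ]
    field_simp

theorem norm_blaschke_sphere {δ : ℝ} (hδ : 0 < δ) (z w ζ : ℂ) (hζ : ‖ζ - z‖ = δ) :
    ‖blaschke δ z w ζ‖ = ‖ζ - w‖ := by
  unfold blaschke
  split_ifs with h
  · rfl
  · have h1 : (δ : ℂ) ^ 2 = (starRingEnd ℂ) (ζ - z) * (ζ - z) := by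
      rw [← Complex.normSq_eq_conj_mul_self, Complex.normSq_eq_norm_sq, hζ]; push_cast; rfl
    have h2 : (δ : ℂ) ^ 2 - (starRingEnd ℂ) (w - z) * (ζ - z)
        = (starRingEnd ℂ) (ζ - w) * (ζ - z) := by
      rw [h1, ← sub_mul, ← map_sub]; ring_nf
    rw [h2, norm_div, norm_mul, Complex.norm_conj, hζ, Complex.norm_real, Real.norm_eq_abs,
      abs_of_pos hδ, mul_div_cancel_right₀ _ hδ.ne']

/-- Reflecting the roots inside the disk by `blaschke` changes no modulus on the circle and yields
an entire function whose modulus at the centre is the product on the left. The maximum principle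
does the rest. -/
theorem prod_max_le_of_sphere (p : ℂ[X]) {δ M : ℝ} (hδ : 0 < δ) (z : ℂ)
    (hM : ∀ ζ : ℂ, ‖ζ - z‖ = δ → ‖p.eval ζ‖ ≤ M) :
    ‖p.leadingCoeff‖ * (p.roots.map fun w => max δ ‖z - w‖).prod ≤ M := by
  set q : ℂ → ℂ := fun ζ => p.leadingCoeff * (p.roots.map fun w => blaschke δ z w ζ).prod with hq
  have hnorm : ∀ ζ, ‖q ζ‖ = ‖p.leadingCoeff‖ * (p.roots.map fun w => ‖blaschke δ z w ζ‖).prod := by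
    intro ζ
    rw [hq, norm_mul]
    congr 1
    induction p.roots using Multiset.induction_on with
    | empty => simp
    | cons a s ih => simp [ih]
  have hdiff : Differentiable ℂ q := by
    apply Differentiable.const_mul
    induction p.roots using Multiset.induction_on with
    | empty => simp
    | cons a s ih =>
      simp only [Multiset.map_cons, Multiset.prod_cons]
      exact (blaschke_differentiable δ z a).mul ih
  have h1 : ‖q z‖ ≤ M := by
    refine Complex.norm_le_of_forall_mem_frontier_norm_le (U := Metric.ball z δ)
      Metric.isBounded_ball hdiff.diffContOnCl (fun ζ hζ => ?_)
      (subset_closure (Metric.mem_ball_self hδ))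
    rw [frontier_ball z hδ.ne', mem_sphere_iff_norm] at hζ
    rw [hnorm]
    simp_rw [norm_blaschke_sphere hδ z _ ζ hζ]
    rw [← norm_eval_eq_prod_roots]
    exact hM ζ hζ
  rw [hnorm] at h1
  simpa only [norm_blaschke_center hδ] using h1

theorem log_prod_max (s : Multiset ℂ) {δ : ℝ} (hδ : 0 < δ) (z : ℂ) :
    Real.log (s.map fun w => max δ ‖z - w‖).prod = (s.map fun w => truncLog δ (z - w)).sum := by
  induction s using Multiset.induction_on with
  | empty => simp
  | cons a s ih =>
    have h1 : (s.map fun w => max δ ‖z - w‖).prod ≠ 0 := by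
      rw [ne_eq, Multiset.prod_eq_zero_iff, Multiset.mem_map]
      rintro ⟨w, -, hw⟩
      exact (lt_of_lt_of_le hδ (le_max_left _ _)).ne' hw
    simp only [Multiset.map_cons, Multiset.prod_cons, Multiset.sum_cons]
    rw [Real.log_mul (lt_of_lt_of_le hδ (le_max_left _ _)).ne' h1, ih]
    rfl

/-- One half of a sandwich for the smoothed potential of the zeros: a lower bound at a single point
suffices here, whereas `le_log_of_sphere` needs an upper bound on a whole circle. The leading
coefficient appears identically in both. -/
theorem log_norm_eval_le (p : ℂ[X]) (hp : p ≠ 0) {δ : ℝ} (hδ : 0 < δ) (z : ℂ) {m : ℝ} (hm : 0 < m)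
    (h : m ≤ ‖p.eval z‖) :
    Real.log m ≤ Real.log ‖p.leadingCoeff‖ + (p.roots.map fun w => truncLog δ (z - w)).sum := by
  have h0 : 0 < ‖p.leadingCoeff‖ := by simpa using hp
  have h1 := h.trans (norm_eval_le_prod_max p δ z)
  have h2 : 0 < (p.roots.map fun w => max δ ‖z - w‖).prod := by
    by_contra h3
    nlinarith
  rw [← log_prod_max _ hδ, ← Real.log_mul h0.ne' h2.ne']
  exact Real.log_le_log hm h1

theorem le_log_of_sphere (p : ℂ[X]) (hp : p ≠ 0) {δ M : ℝ} (hδ : 0 < δ) (z : ℂ)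
    (hM : ∀ ζ : ℂ, ‖ζ - z‖ = δ → ‖p.eval ζ‖ ≤ M) :
    Real.log ‖p.leadingCoeff‖ + (p.roots.map fun w => truncLog δ (z - w)).sum ≤ Real.log M := by
  have h0 : 0 < ‖p.leadingCoeff‖ := by simpa using hp
  have h2 : 0 < (p.roots.map fun w => max δ ‖z - w‖).prod := by
    apply Multiset.prod_pos
    intro x hx
    obtain ⟨w, -, rfl⟩ := Multiset.mem_map.1 hx
    exact lt_of_lt_of_le hδ (le_max_left _ _)
  rw [← log_prod_max _ hδ, ← Real.log_mul h0.ne' h2.ne']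
  exact Real.log_le_log (by positivity) (prod_max_le_of_sphere p hδ z hM)

theorem integral_sum_dirac (s : Multiset ℂ) (f : ℂ → ℝ) :
    Integrable f (s.map fun z => Measure.dirac z).sum ∧
      ∫ z, f z ∂(s.map fun z => Measure.dirac z).sum = (s.map f).sum := by
  induction s using Multiset.induction_on with
  | empty => simp
  | cons a s ih =>
    have h1 : Integrable f (Measure.dirac a) := integrable_dirac (by simp)
    simp only [Multiset.map_cons, Multiset.sum_cons]
    exact ⟨h1.add_measure ih.1, by rw [integral_add_measure h1 ih.1, ih.2, integral_dirac]⟩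

theorem integral_zeroMeasure (p : ℂ[X]) (f : ℂ → ℝ) :
    ∫ z, f z ∂(zeroMeasure p) = (p.natDegree : ℝ)⁻¹ * (p.roots.map f).sum := by
  rw [zeroMeasure, integral_smul_measure, (integral_sum_dirac p.roots f).2]
  simp

/-! ### The heat flow -/

/-- Any cut-off above the degree gives the same sum. A common cut-off for all monomials makes the
linearity of the heat flow a matter of exchanging finite sums. -/
theorem heatFlow_eq_sum (s : ℂ) (p : ℂ[X]) {N : ℕ} (hN : p.natDegree < N) :
    heatFlow s p = ∑ j ∈ Finset.range N,
      C ((1 / (j.factorial : ℂ)) * (-(s / 2)) ^ j) * derivative^[2 * j] p := by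
  unfold heatFlow
  apply Finset.sum_subset
  · intro j; simp only [Finset.mem_range]; omega
  · intro j _ hj
    simp only [Finset.mem_range] at hj
    rw [Polynomial.iterate_derivative_eq_zero (by omega), mul_zero]

/-- The value at `z` of the heat evolution of `X ^ k`. -/
noncomputable def heatMonomial (s : ℂ) (k : ℕ) (z : ℂ) : ℂ := (heatFlow s (X ^ k)).eval z

theorem natDegree_randomPoly_le (a : ℕ → ℕ → ℂ) (x : ℕ → ℂ) (n : ℕ) :
    (randomPoly a x n).natDegree ≤ n := by
  unfold randomPoly
  apply Polynomial.natDegree_sum_le_of_forall_le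
  intro k hk
  refine (Polynomial.natDegree_C_mul_X_pow_le _ _).trans ?_
  have := Finset.mem_range.1 hk; omega

theorem coeff_randomPoly_self (a : ℕ → ℕ → ℂ) (x : ℕ → ℂ) (n : ℕ) :
    (randomPoly a x n).coeff n = x n * a n n := by
  unfold randomPoly
  rw [Polynomial.finsetSum_coeff, Finset.sum_eq_single n]
  · rw [Polynomial.coeff_C_mul, Polynomial.coeff_X_pow_self, mul_one]
  · intro k _ hk
    rw [Polynomial.coeff_C_mul, Polynomial.coeff_X_pow, if_neg (Ne.symm hk), mul_zero]
  · simp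

theorem eval_heatFlow_randomPoly (a : ℕ → ℕ → ℂ) (x : ℕ → ℂ) (n : ℕ) (s z : ℂ) :
    (heatFlow s (randomPoly a x n)).eval z =
      ∑ k ∈ Finset.range (n + 1), x k * a n k * heatMonomial s k z := by
  rw [heatFlow_eq_sum s _ (Nat.lt_succ_of_le (natDegree_randomPoly_le a x n))]
  have h1 : ∀ k ∈ Finset.range (n + 1), x k * a n k * heatMonomial s k z =
      ∑ j ∈ Finset.range (n + 1), x k * a n k *
        (C ((1 / (j.factorial : ℂ)) * (-(s / 2)) ^ j) * derivative^[2 * j] (X ^ k)).eval z := by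
    intro k hk
    rw [heatMonomial, heatFlow_eq_sum s (X ^ k) (N := n + 1)
      (by rw [Polynomial.natDegree_X_pow]; exact Finset.mem_range.1 hk),
      Polynomial.eval_finsetSum, Finset.mul_sum]
  rw [Finset.sum_congr rfl h1, Finset.sum_comm, Polynomial.eval_finsetSum]
  refine Finset.sum_congr rfl fun j _ => ?_
  simp only [randomPoly, Polynomial.iterate_derivative_sum, Polynomial.iterate_derivative_C_mul,
    Polynomial.eval_mul, Polynomial.eval_C, Polynomial.eval_finsetSum, Finset.mul_sum]
  refine Finset.sum_congr rfl fun k _ => ?_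
  ring

theorem coeff_heatFlow_of_natDegree_le (s : ℂ) (p : ℂ[X]) {n : ℕ} (hn : p.natDegree ≤ n) :
    (heatFlow s p).coeff n = p.coeff n := by
  unfold heatFlow
  rw [Polynomial.finsetSum_coeff, Finset.sum_eq_single 0]
  · simp
  · intro j _ hj
    rw [Polynomial.coeff_C_mul, Polynomial.coeff_iterate_derivative,
      Polynomial.coeff_eq_zero_of_natDegree_lt (by omega)]
    simp
  · simp

theorem natDegree_heatFlow_le (s : ℂ) (p : ℂ[X]) : (heatFlow s p).natDegree ≤ p.natDegree := by
  unfold heatFlow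
  apply Polynomial.natDegree_sum_le_of_forall_le
  intro j _
  refine (Polynomial.natDegree_C_mul_le _ _).trans ?_
  exact (Polynomial.natDegree_iterate_derivative _ _).trans (Nat.sub_le _ _)

/-- Derivatives only lower the degree, so the top coefficient is untouched. This is the reason for
keeping `ξ n` away from zero in the probabilistic estimates. -/
theorem natDegree_heatFlow_randomPoly (a : ℕ → ℕ → ℂ) (x : ℕ → ℂ) (n : ℕ) (s : ℂ)
    (h : x n * a n n ≠ 0) :
    (heatFlow s (randomPoly a x n)).natDegree = n ∧
      (heatFlow s (randomPoly a x n)).leadingCoeff = x n * a n n := by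
  have h1 : (heatFlow s (randomPoly a x n)).coeff n = x n * a n n := by
    rw [coeff_heatFlow_of_natDegree_le s _ (natDegree_randomPoly_le a x n), coeff_randomPoly_self]
  have h2 : (heatFlow s (randomPoly a x n)).natDegree = n :=
    le_antisymm ((natDegree_heatFlow_le _ _).trans (natDegree_randomPoly_le a x n))
      (Polynomial.le_natDegree_of_ne_zero (by rw [h1]; exact h))
  exact ⟨h2, by rw [Polynomial.leadingCoeff, h2, h1]⟩

theorem heatMonomial_zero_time (k : ℕ) (z : ℂ) : heatMonomial 0 k z = z ^ k := by
  unfold heatMonomial heatFlow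
  rw [Finset.sum_eq_single 0]
  · simp
  · intro j _ hj; simp [hj]
  · simp

/-- Explicit form of the heat evolution of `X ^ k`. -/
theorem heatMonomial_eq (s : ℂ) (k : ℕ) (z : ℂ) :
    heatMonomial s k z = ∑ j ∈ Finset.range (k + 1),
      (1 / (j.factorial : ℂ)) * (-(s / 2)) ^ j * ((k.descFactorial (2 * j) : ℂ) * z ^ (k - 2 * j))
    := by
  rw [heatMonomial, heatFlow_eq_sum s (X ^ k) (N := k + 1) (by simp), Polynomial.eval_finsetSum]
  refine Finset.sum_congr rfl fun j _ => ?_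
  rw [Polynomial.iterate_derivative_X_pow_eq_natCast_mul]
  simp

/-! ### Truncated logarithms as test functions -/

theorem truncLog_continuous {δ : ℝ} (hδ : 0 < δ) : Continuous (truncLog δ) := by
  unfold truncLog
  refine Continuous.log (by fun_prop) fun z => (lt_of_lt_of_le hδ (le_max_left _ _)).ne'

theorem log_le_truncLog (δ : ℝ) (z : ℂ) (h : z ≠ 0) : Real.log ‖z‖ ≤ truncLog δ z :=
  Real.log_le_log (norm_pos_iff.2 h) (le_max_right _ _)

theorem log_radius_le_truncLog {δ : ℝ} (hδ : 0 < δ) (z : ℂ) : Real.log δ ≤ truncLog δ z :=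
  Real.log_le_log hδ (le_max_left _ _)

/-- The truncated kernel is unbounded at infinity, but its differences are bounded, and so they are
admissible test functions for weak convergence. -/
theorem truncLog_sub_le {δ δ' : ℝ} (hδ : 0 < δ) (hδ' : 0 < δ') (z z' w : ℂ) :
    truncLog δ (z - w) - truncLog δ' (z' - w) ≤ Real.log (1 + (‖z - z'‖ + δ) / δ') := by
  have h0 : 0 < max δ ‖z - w‖ := lt_of_lt_of_le hδ (le_max_left _ _)
  have h0' : 0 < max δ' ‖z' - w‖ := lt_of_lt_of_le hδ' (le_max_left _ _)
  have hC : 0 ≤ (‖z - z'‖ + δ) / δ' := by positivity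
  unfold truncLog
  rw [sub_le_iff_le_add, ← Real.log_mul (by positivity) h0'.ne']
  refine Real.log_le_log h0 ?_
  have h1 : ‖z - w‖ ≤ ‖z - z'‖ + ‖z' - w‖ := by simpa using norm_add_le (z - z') (z' - w)
  have h2 : ‖z - z'‖ + δ ≤ (‖z - z'‖ + δ) / δ' * max δ' ‖z' - w‖ := by
    rw [div_mul_eq_mul_div, le_div_iff₀ hδ']
    exact mul_le_mul_of_nonneg_left (le_max_left _ _) (by positivity)
  have h3 := le_max_right δ' ‖z' - w‖
  rw [one_add_mul]
  have := norm_nonneg (z - z')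
  apply max_le <;> linarith [norm_nonneg (z' - w)]

/-- The difference of two truncated logarithms as a bounded continuous function. -/
noncomputable def truncLogDiff {δ δ' : ℝ} (hδ : 0 < δ) (hδ' : 0 < δ') (z z' : ℂ) : ℂ →ᵇ ℝ :=
  BoundedContinuousFunction.ofNormedAddCommGroup
    (fun w => truncLog δ (z - w) - truncLog δ' (z' - w))
    (((truncLog_continuous hδ).comp (by fun_prop)).sub
      ((truncLog_continuous hδ').comp (by fun_prop)))
    (Real.log (1 + (‖z - z'‖ + δ) / δ') + Real.log (1 + (‖z' - z‖ + δ') / δ)) (by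
      intro w
      have h1 := truncLog_sub_le hδ hδ' z z' w
      have h2 := truncLog_sub_le hδ' hδ z' z w
      have h3 : 0 ≤ Real.log (1 + (‖z - z'‖ + δ) / δ') :=
        Real.log_nonneg (le_add_of_nonneg_right (by positivity))
      have h4 : 0 ≤ Real.log (1 + (‖z' - z‖ + δ') / δ) :=
        Real.log_nonneg (le_add_of_nonneg_right (by positivity))
      rw [Real.norm_eq_abs, abs_le]
      constructor <;> linarith)

/-- The truncated logarithm, cut off above at height `K`, as a bounded continuous function. -/
noncomputable def truncLogMin {δ : ℝ} (hδ : 0 < δ) (z : ℂ) (K : ℝ) : ℂ →ᵇ ℝ :=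
  BoundedContinuousFunction.ofNormedAddCommGroup (fun w => min (truncLog δ (z - w)) K)
    (((truncLog_continuous hδ).comp (by fun_prop)).min continuous_const)
    (max |Real.log δ| |K|) (by
      intro w
      have h1 := log_radius_le_truncLog hδ (z - w)
      rw [Real.norm_eq_abs, abs_le]
      constructor
      · rw [neg_le_iff_add_nonneg]
        rcases min_cases (truncLog δ (z - w)) K with ⟨h, -⟩ | ⟨h, -⟩ <;> rw [h]
        · have := neg_abs_le (Real.log δ)
          linarith [le_max_left |Real.log δ| |K|]
        · have := neg_abs_le K
          linarith [le_max_right |Real.log δ| |K|]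
      · exact (min_le_right _ _).trans ((le_abs_self K).trans (le_max_right _ _)))

/-! ### Estimates for the noise -/

section Noise

variable {Ω : Type*} [MeasurableSpace Ω] {P : Measure Ω} [IsProbabilityMeasure P]
  {ξ : ℕ → Ω → ℂ}

/-- A law that is not a point mass has two distinct points in its support; a quarter of their
distance serves as radius. -/
theorem IsCoefficientNoise.exists_two_balls (hξ : IsCoefficientNoise P ξ) :
    ∃ (ρ : ℝ) (κ : ℝ≥0∞) (x y : ℂ), 0 < ρ ∧ 0 < κ ∧ 4 * ρ ≤ ‖x - y‖ ∧
      ∀ k, κ ≤ P (ξ k ⁻¹' Metric.ball x ρ) ∧ κ ≤ P (ξ k ⁻¹' Metric.ball y ρ) := by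
  set μ : Measure ℂ := P.map (ξ 0) with hμ
  have hprob : IsProbabilityMeasure μ := Measure.isProbabilityMeasure_map (hξ.measurable 0).aemeasurable
  obtain ⟨x, hx⟩ := Measure.nonempty_support (IsProbabilityMeasure.ne_zero μ)
  have : ∃ y ∈ μ.support, y ≠ x := by
    by_contra! hcon
    apply hξ.nondegenerate
    refine ⟨x, ?_⟩
    have h1 : ∀ᵐ y ∂μ, y = x := by
      filter_upwards [Measure.support_mem_ae (μ := μ)] with y hy using hcon y hy
    exact ae_of_ae_map (hξ.measurable 0).aemeasurable h1
  obtain ⟨y, hy, hyx⟩ := this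
  have hpos : 0 < ‖x - y‖ := norm_pos_iff.2 (sub_ne_zero.2 (Ne.symm hyx))
  have hρ : 0 < ‖x - y‖ / 4 := by positivity
  rw [Measure.mem_support_iff_forall] at hx hy
  refine ⟨‖x - y‖ / 4, min (μ (Metric.ball x (‖x - y‖ / 4))) (μ (Metric.ball y (‖x - y‖ / 4))),
    x, y, hρ, lt_min (hx _ (Metric.ball_mem_nhds _ hρ)) (hy _ (Metric.ball_mem_nhds _ hρ)),
    by linarith, fun k => ?_⟩
  rw [(hξ.identDistrib k).measure_mem_eq Metric.isOpen_ball.measurableSet,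
    (hξ.identDistrib k).measure_mem_eq Metric.isOpen_ball.measurableSet,
    hμ, Measure.map_apply (hξ.measurable 0) Metric.isOpen_ball.measurableSet,
    Measure.map_apply (hξ.measurable 0) Metric.isOpen_ball.measurableSet]
  exact ⟨min_le_left _ _, min_le_right _ _⟩

/-- Anti-concentration: a random sum is not much smaller than a given summand, and the last noise
variable is not small, with probability bounded below. -/
theorem IsCoefficientNoise.exists_anticoncentration (hξ : IsCoefficientNoise P ξ) :
    ∃ (ρ : ℝ) (κ : ℝ≥0∞), 0 < ρ ∧ 0 < κ ∧ ∀ (n k : ℕ) (c : ℕ → ℂ), k < n → c k ≠ 0 →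
      κ ≤ P {ω | ρ ≤ ‖ξ n ω‖ ∧ ρ * ‖c k‖ ≤ ‖∑ j ∈ Finset.range (n + 1), ξ j ω * c j‖} := by
  obtain ⟨ρ, κ, x, y, hρ, hκ, hxy, hball⟩ := hξ.exists_two_balls
  refine ⟨ρ, κ * κ / 2, hρ, ENNReal.div_pos (mul_ne_zero hκ.ne' hκ.ne') (by simp), ?_⟩
  intro n k c hkn hck
  set S : Finset ℕ := {k} with hS
  set T : Finset ℕ := (Finset.range (n + 1)).erase k with hT
  have hdisj : Disjoint T S := by
    rw [hS, Finset.disjoint_singleton_right, hT]; simp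
  have hind := hξ.indep.indepFun_finset T S hdisj hξ.measurable
  have hnT : n ∈ T := by simp only [hT, Finset.mem_erase, Finset.mem_range]; omega
  have hkS : k ∈ S := by simp [hS]
  -- `Z` is the rest of the sum divided by `c k`, so the whole sum is `c k * (ξ k + Z)`, with `Z`
  -- independent of `ξ k`. As `k < n`, the variable `ξ n` is among those that `Z` depends on.
  set Z : (T → ℂ) → ℂ := fun v => (∑ j : T, v j * c j) / c k with hZ
  have hZm : Measurable Z := by
    apply Measurable.div_const
    apply Finset.measurable_fun_sum
    intro j _
    exact (measurable_pi_apply j).mul_const _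
  set B : ℂ → Set (T → ℂ) := fun x => {v | ρ ≤ ‖v ⟨n, hnT⟩‖ ∧ 2 * ρ ≤ ‖x + Z v‖} with hB
  have hBm : ∀ x, MeasurableSet (B x) := by
    intro x
    apply MeasurableSet.inter
    · exact measurableSet_le measurable_const (measurable_pi_apply _).norm
    · exact measurableSet_le measurable_const (measurable_const.add hZm).norm
  set X : Ω → (T → ℂ) := fun ω i => ξ i ω with hX
  set E := {ω | ρ ≤ ‖ξ n ω‖ ∧ ρ * ‖c k‖ ≤ ‖∑ j ∈ Finset.range (n + 1), ξ j ω * c j‖} with hE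
  have hsum : ∀ ω, ∑ j ∈ Finset.range (n + 1), ξ j ω * c j = c k * (ξ k ω + Z (X ω)) := by
    intro ω
    rw [← Finset.add_sum_erase _ _ (Finset.mem_range.2 (by omega : k < n + 1)), hZ, hX]
    simp only
    rw [← Finset.sum_coe_sort T (fun j => ξ j ω * c j)]
    field_simp
  have key : ∀ x, (∀ k, κ ≤ P (ξ k ⁻¹' Metric.ball x ρ)) → P (X ⁻¹' B x) * κ ≤ P E := by
    intro x hx
    have h1 := hind.measure_inter_preimage_eq_mul (B x)
      ((fun v : S → ℂ => v ⟨k, hkS⟩) ⁻¹' Metric.ball x ρ) (hBm x)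
      (measurable_pi_apply _ Metric.isOpen_ball.measurableSet)
    calc P (X ⁻¹' B x) * κ ≤ P (X ⁻¹' B x) * P (ξ k ⁻¹' Metric.ball x ρ) := by gcongr; exact hx k
      _ = _ := h1.symm
      _ ≤ P E := by
        refine measure_mono ?_
        rintro ω ⟨hω1, hω2⟩
        have hω2' : ‖ξ k ω - x‖ < ρ := by simpa [dist_eq_norm] using hω2
        refine ⟨hω1.1, ?_⟩
        have h2 : 2 * ρ ≤ ‖x + Z (X ω)‖ := hω1.2
        have h3 : ‖x + Z (X ω)‖ ≤ ‖ξ k ω + Z (X ω)‖ + ‖ξ k ω - x‖ := by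
          have := norm_sub_le (ξ k ω + Z (X ω)) (ξ k ω - x)
          simpa [add_sub_sub_cancel, add_comm] using this
        rw [hsum, norm_mul, mul_comm]
        exact mul_le_mul_of_nonneg_left (by linarith) (norm_nonneg _)
  -- The points `x` and `y` are at distance at least `4 * ρ`, so for each value of `Z` at least one
  -- of `x + Z`, `y + Z` has modulus at least `2 * ρ`. Likewise one of `x`, `y` has modulus at least
  -- `2 * ρ`, which keeps `ξ n` away from zero.
  have hκB : κ ≤ P (X ⁻¹' B x) + P (X ⁻¹' B y) := by
    have hn : κ ≤ P {ω | ρ ≤ ‖ξ n ω‖} := by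
      have : 2 * ρ ≤ ‖x‖ ∨ 2 * ρ ≤ ‖y‖ := by
        by_contra! h
        linarith [norm_sub_le x y]
      rcases this with h | h
      · refine (hball n).1.trans (measure_mono fun ω hω => ?_)
        have : ‖ξ n ω - x‖ < ρ := by simpa [dist_eq_norm] using hω
        show ρ ≤ ‖ξ n ω‖
        have h3 := norm_sub_le (ξ n ω) (ξ n ω - x)
        rw [sub_sub_cancel] at h3
        linarith
      · refine (hball n).2.trans (measure_mono fun ω hω => ?_)
        have : ‖ξ n ω - y‖ < ρ := by simpa [dist_eq_norm] using hω
        show ρ ≤ ‖ξ n ω‖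
        have h3 := norm_sub_le (ξ n ω) (ξ n ω - y)
        rw [sub_sub_cancel] at h3
        linarith
    refine hn.trans ((measure_mono ?_).trans (measure_union_le _ _))
    intro ω hω
    have : 2 * ρ ≤ ‖x + Z (X ω)‖ ∨ 2 * ρ ≤ ‖y + Z (X ω)‖ := by
      by_contra! h
      have h3 := norm_sub_le (x + Z (X ω)) (y + Z (X ω))
      rw [add_sub_add_right_eq_sub] at h3
      linarith
    exact this.imp (fun h => ⟨hω, h⟩) (fun h => ⟨hω, h⟩)
  have h2 : κ * κ ≤ P E * 2 := by
    calc κ * κ ≤ (P (X ⁻¹' B x) + P (X ⁻¹' B y)) * κ := by gcongr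
      _ = P (X ⁻¹' B x) * κ + P (X ⁻¹' B y) * κ := add_mul _ _ _
      _ ≤ P E + P E := add_le_add (key x fun k => (hball k).1) (key y fun k => (hball k).2)
      _ = P E * 2 := (mul_two _).symm
  exact ENNReal.div_le_of_le_mul h2

/-- The first `n` noise variables are at most `exp (ε n)`, with probability tending to `1`. -/
theorem IsCoefficientNoise.tendsto_max (hξ : IsCoefficientNoise P ξ) {ε : ℝ} (hε : 0 < ε) :
    Tendsto (fun n : ℕ => P {ω | ∃ k ≤ n, Real.exp (ε * n) < ‖ξ k ω‖}) atTop (𝓝 0) := by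
  set X : Ω → ℝ := fun ω => Real.log (1 + ‖ξ 0 ω‖) with hX
  have hXm : Measurable X := (measurable_const.add (hξ.measurable 0).norm).log
  set F : Ω → ℝ≥0∞ := fun ω => ENNReal.ofReal (X ω) with hF
  have hFm : Measurable F := hXm.ennreal_ofReal
  have hFint : ∫⁻ ω, F ω ∂P ≠ ∞ := by
    have := hξ.log_moment.2
    rw [hasFiniteIntegral_iff_ofReal] at this
    · exact this.ne
    · exact ae_of_all _ fun ω => Real.log_nonneg (by linarith [norm_nonneg (ξ 0 ω)])
  set s : ℕ → Set Ω := fun n => {ω | ENNReal.ofReal (ε * n) ≤ F ω} with hs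
  -- Markov's inequality is kept localised to `s n`: the integral over `s n` tends to zero, and this
  -- makes `n * P (s n)` tend to zero, enough for a union bound over `n + 1` variables.
  have hmul : ∀ n : ℕ, ENNReal.ofReal (ε * n) * P (s n) ≤ ∫⁻ ω in s n, F ω ∂P := by
    intro n
    have := setLIntegral_mono (μ := P) (s := s n) (f := fun _ => ENNReal.ofReal (ε * n)) (g := F)
      hFm (fun ω hω => hω)
    simpa using this
  have hs0 : Tendsto (P ∘ s) atTop (𝓝 0) := by
    have h1 : Tendsto (fun n : ℕ => (∫⁻ ω, F ω ∂P) / ENNReal.ofReal (ε * n)) atTop (𝓝 0) := by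
      have h2 : Tendsto (fun n : ℕ => ENNReal.ofReal (ε * n)) atTop (𝓝 ∞) :=
        ENNReal.tendsto_ofReal_atTop.comp
          (tendsto_natCast_atTop_atTop.const_mul_atTop hε)
      have := ENNReal.Tendsto.div (tendsto_const_nhds (x := ∫⁻ ω, F ω ∂P)) (Or.inr (by simp)) h2
        (Or.inr hFint)
      simpa using this
    refine tendsto_of_tendsto_of_tendsto_of_le_of_le' tendsto_const_nhds h1
      (Eventually.of_forall fun _ => zero_le) ?_
    filter_upwards [eventually_gt_atTop 0] with n hn
    have hpos : 0 < ε * (n : ℝ) := by positivity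
    rw [Function.comp, ENNReal.le_div_iff_mul_le (Or.inl (by simpa using hpos))
      (Or.inl ENNReal.ofReal_ne_top), mul_comm]
    exact mul_meas_ge_le_lintegral hFm _
  have hint0 := tendsto_setLIntegral_zero hFint hs0
  have hlim : Tendsto (fun n : ℕ => ENNReal.ofReal (2 / ε) * ∫⁻ ω in s n, F ω ∂P) atTop (𝓝 0) := by
    have := ENNReal.Tendsto.const_mul hint0 (a := ENNReal.ofReal (2 / ε))
      (Or.inr ENNReal.ofReal_ne_top)
    simpa using this
  refine tendsto_of_tendsto_of_tendsto_of_le_of_le' tendsto_const_nhds hlim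
    (Eventually.of_forall fun _ => zero_le) ?_
  filter_upwards [eventually_gt_atTop 0] with n hn
  have h1 : {ω | ∃ k ≤ n, Real.exp (ε * n) < ‖ξ k ω‖} ⊆
      ⋃ k ∈ Finset.range (n + 1), ξ k ⁻¹' {z | Real.exp (ε * n) < ‖z‖} := by
    rintro ω ⟨k, hk, hω⟩
    simp only [Set.mem_iUnion, Finset.mem_range]
    exact ⟨k, by omega, hω⟩
  have hms : MeasurableSet {z : ℂ | Real.exp (ε * n) < ‖z‖} :=
    measurableSet_lt measurable_const measurable_norm
  have h2 : ∀ k, P (ξ k ⁻¹' {z | Real.exp (ε * n) < ‖z‖}) ≤ P (s n) := by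
    intro k
    rw [(hξ.identDistrib k).measure_mem_eq hms]
    refine measure_mono fun ω hω => ?_
    have hω' : Real.exp (ε * n) < ‖ξ 0 ω‖ := hω
    refine ENNReal.ofReal_le_ofReal ?_
    rw [hX, Real.le_log_iff_exp_le (by positivity)]
    linarith
  calc P {ω | ∃ k ≤ n, Real.exp (ε * n) < ‖ξ k ω‖}
      ≤ ∑ k ∈ Finset.range (n + 1), P (ξ k ⁻¹' {z | Real.exp (ε * n) < ‖z‖}) :=
        (measure_mono h1).trans (measure_biUnion_finset_le _ _)
    _ ≤ ∑ k ∈ Finset.range (n + 1), P (s n) := Finset.sum_le_sum fun k _ => h2 k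
    _ = (n + 1 : ℕ) * P (s n) := by simp
    -- The factor comes from `n + 1 ≤ 2 * n`.
    _ ≤ ENNReal.ofReal (2 / ε) * ENNReal.ofReal (ε * n) * P (s n) := by
        gcongr
        rw [← ENNReal.ofReal_mul (by positivity), ← ENNReal.ofReal_natCast]
        refine ENNReal.ofReal_le_ofReal ?_
        have : (1 : ℝ) ≤ n := by exact_mod_cast hn
        field_simp
        push_cast
        linarith
    _ ≤ _ := by rw [mul_assoc]; gcongr; exact hmul n

/-- Anti-concentration holds with probability bounded below, the other two events with probability
tending to one, so they intersect for large `n`. A single realisation is enough because the limit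
`y` is deterministic. -/
theorem IsCoefficientNoise.exists_good_realisation (hξ : IsCoefficientNoise P ξ) :
    ∃ ρ : ℝ, 0 < ρ ∧ ∀ (Y : ℕ → Ω → ℝ) (y : ℝ), TendstoInMeasure P Y atTop (fun _ => y) →
      ∀ (c : ℕ → ℕ → ℂ) (κ : ℕ → ℕ), (∀ᶠ n in atTop, κ n < n ∧ c n (κ n) ≠ 0) →
      ∀ ε : ℝ, 0 < ε → ∀ᶠ n : ℕ in atTop, ∃ ω, (∀ k ≤ n, ‖ξ k ω‖ ≤ Real.exp (ε * n)) ∧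
        ρ ≤ ‖ξ n ω‖ ∧ ρ * ‖c n (κ n)‖ ≤ ‖∑ j ∈ Finset.range (n + 1), ξ j ω * c n j‖ ∧
        |Y n ω - y| < ε := by
  obtain ⟨ρ, p, hρ, hp, hanti⟩ := hξ.exists_anticoncentration
  refine ⟨ρ, hρ, fun Y y hY c κ hκ ε hε => ?_⟩
  have h1 := hξ.tendsto_max hε
  have h2 := hY (ENNReal.ofReal ε) (by simpa using hε)
  have h3 : Tendsto (fun n : ℕ => P {ω | ∃ k ≤ n, Real.exp (ε * n) < ‖ξ k ω‖} +
      P {ω | ENNReal.ofReal ε ≤ edist (Y n ω) y}) atTop (𝓝 0) := by simpa using h1.add h2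
  filter_upwards [h3.eventually_lt_const hp, hκ] with n hn hκn
  by_contra! hcon
  have h4 := hanti n (κ n) (c n) hκn.1 hκn.2
  refine (lt_of_lt_of_le hn (h4.trans ((measure_mono ?_).trans (measure_union_le _ _)))).false
  rintro ω ⟨hω1, hω2⟩
  by_cases hA : ∃ k ≤ n, Real.exp (ε * n) < ‖ξ k ω‖
  · exact Or.inl hA
  · right
    push Not at hA
    have := hcon ω hA hω1 hω2
    show ENNReal.ofReal ε ≤ edist (Y n ω) y
    rw [edist_dist, Real.dist_eq]
    exact ENNReal.ofReal_le_ofReal this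

end Noise

/-! ### From exponential rates of the terms to bounds for the limiting potential. -/

/-- Exponential upper bound `exp (n u)` for the deterministic terms of the evolved polynomials, on
the circle of radius `δ` around `z`. -/
def CoeffUpper (a : ℕ → ℕ → ℂ) (t z : ℂ) (δ u : ℝ) : Prop :=
  ∀ ε : ℝ, 0 < ε → ∀ᶠ n : ℕ in atTop, ∀ k ≤ n, ∀ w : ℂ, ‖w - z‖ = δ →
    ‖a n k * heatMonomial (t / n) k w‖ ≤ Real.exp (n * (u + ε))

/-- Exponential lower bound `exp (n u)` for some deterministic term of the evolved polynomials,
other than the last, at the point `z`. -/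
def CoeffLower (a : ℕ → ℕ → ℂ) (t z : ℂ) (u : ℝ) : Prop :=
  ∀ ε : ℝ, 0 < ε → ∀ᶠ n : ℕ in atTop, ∃ k < n,
    Real.exp (n * (u - ε)) ≤ ‖a n k * heatMonomial (t / n) k z‖

theorem le_of_forall_eventually_le {x y C : ℝ} {w : ℕ → ℝ} (hw : Tendsto w atTop (𝓝 0))
    (h : ∀ ε : ℝ, 0 < ε → ∀ᶠ n : ℕ in atTop, x ≤ y + C * ε + w n) : x ≤ y := by
  have h1 : ∀ ε : ℝ, 0 < ε → x ≤ y + C * ε := by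
    intro ε hε
    have h2 : Tendsto (fun n => y + C * ε + w n) atTop (𝓝 (y + C * ε + 0)) :=
      tendsto_const_nhds.add hw
    rw [add_zero] at h2
    exact ge_of_tendsto h2 (h ε hε)
  have h3 : Tendsto (fun ε : ℝ => y + C * ε) (𝓝[>] 0) (𝓝 (y + C * 0)) :=
    (Continuous.tendsto (by fun_prop) 0).mono_left nhdsWithin_le_nhds
  rw [mul_zero, add_zero] at h3
  exact ge_of_tendsto h3 (eventually_mem_nhdsWithin.mono fun ε hε => h1 ε hε)

theorem tendsto_log_succ_div (c : ℝ) :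
    Tendsto (fun n : ℕ => (Real.log (n + 1) + c) / n) atTop (𝓝 0) := by
  have h1 : Tendsto (fun x : ℝ => Real.log (x + 1) / x) atTop (𝓝 0) := by
    have h2 : Tendsto (fun x : ℝ => Real.log (x + 1) / (x + 1)) atTop (𝓝 0) :=
      (Real.isLittleO_log_id_atTop.tendsto_div_nhds_zero).comp (tendsto_atTop_add_const_right _ 1 tendsto_id)
    have h3 : Tendsto (fun x : ℝ => 1 + x⁻¹) atTop (𝓝 (1 + 0)) :=
      tendsto_const_nhds.add tendsto_inv_atTop_zero
    have h4 := h2.mul h3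
    rw [zero_mul] at h4
    refine h4.congr' ?_
    filter_upwards [eventually_gt_atTop 0] with x hx
    field_simp
  have h5 := (h1.comp tendsto_natCast_atTop_atTop).add (tendsto_const_div_atTop_nhds_zero_nat c)
  rw [add_zero] at h5
  refine h5.congr fun n => ?_
  simp only [Function.comp]; ring

section Limit

variable {Ω : Type*} [MeasurableSpace Ω] {P : Measure Ω} [IsProbabilityMeasure P]
  {ξ : ℕ → Ω → ℂ} {a : ℕ → ℕ → ℂ} {g : ℝ → ℝ}

theorem eval_upper_of_coeffUpper {x : ℕ → ℂ} {n : ℕ} {s z : ℂ} {δ u ε η : ℝ}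
    (hx : ∀ k ≤ n, ‖x k‖ ≤ Real.exp (ε * n))
    (h : ∀ k ≤ n, ∀ w : ℂ, ‖w - z‖ = δ → ‖a n k * heatMonomial s k w‖ ≤ Real.exp (n * (u + η)))
    (w : ℂ) (hw : ‖w - z‖ = δ) :
    ‖(heatFlow s (randomPoly a x n)).eval w‖ ≤ (n + 1) * Real.exp (n * (u + η + ε)) := by
  rw [eval_heatFlow_randomPoly]
  calc _ ≤ ∑ k ∈ Finset.range (n + 1), ‖x k * a n k * heatMonomial s k w‖ := norm_sum_le _ _
    _ ≤ ∑ k ∈ Finset.range (n + 1), Real.exp (n * (u + η + ε)) := by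
      refine Finset.sum_le_sum fun k hk => ?_
      have hk' : k ≤ n := by have := Finset.mem_range.1 hk; omega
      rw [mul_assoc, norm_mul, show (n : ℝ) * (u + η + ε) = ε * n + n * (u + η) by ring, Real.exp_add]
      exact mul_le_mul (hx k hk') (h k hk' w hw) (norm_nonneg _) (Real.exp_pos _).le
    _ = _ := by simp

/-- Comparison of the smoothed logarithmic potential of the limit with exponential rates. -/
theorem le_integral_truncLogDiff (hξ : IsCoefficientNoise P ξ) (ha : IsExponentialProfile a g)
    {t : ℂ} {ν : Measure ℂ} (hν : IsZeroLimit P ξ a t ν) {z z' : ℂ} {δ δ' u u' : ℝ}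
    (hδ : 0 < δ) (hδ' : 0 < δ') (hlow : CoeffLower a t z u) (hup : CoeffUpper a t z' δ' u') :
    u - u' ≤ ∫ w, (truncLog δ (z - w) - truncLog δ' (z' - w)) ∂ν := by
  obtain ⟨ρ, hρ, hgood⟩ := hξ.exists_good_realisation
  -- The four `ε` are spent on the lower rate, the upper rate, the size of the noise and the
  -- convergence in probability.
  apply le_of_forall_eventually_le (C := 4) (tendsto_log_succ_div (-Real.log ρ))
  intro ε hε
  -- The index is chosen for every `n` to have a total sequence; it is meaningful only for large
  -- `n`.
  have hex : ∀ n : ℕ, ∃ k, (∃ k < n, Real.exp (n * (u - ε)) ≤ ‖a n k * heatMonomial (t / n) k z‖) →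
      k < n ∧ Real.exp (n * (u - ε)) ≤ ‖a n k * heatMonomial (t / n) k z‖ := by
    intro n
    by_cases h : ∃ k < n, Real.exp (n * (u - ε)) ≤ ‖a n k * heatMonomial (t / n) k z‖
    · obtain ⟨k, hk⟩ := h; exact ⟨k, fun _ => hk⟩
    · exact ⟨0, fun h' => absurd h' h⟩
  choose κ hκ using hex
  have hκ' : ∀ᶠ n in atTop, κ n < n ∧ a n (κ n) * heatMonomial (t / n) (κ n) z ≠ 0 := by
    filter_upwards [hlow ε hε] with n hn
    refine ⟨(hκ n hn).1, norm_pos_iff.1 (lt_of_lt_of_le (Real.exp_pos _) (hκ n hn).2)⟩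
  have hg := hgood _ _ (hν (truncLogDiff hδ hδ' z z'))
    (fun n k => a n k * heatMonomial (t / n) k z) κ hκ' ε hε
  filter_upwards [hg, hlow ε hε, hup ε hε, ha.growth ε hε, eventually_gt_atTop 0] with
    n ⟨ω, hω1, hω2, hω3, hω4⟩ hln hun han hn0
  set p := heatFlow (t / n) (randomPoly a (fun k => ξ k ω) n) with hp
  have hξn : ξ n ω ≠ 0 := norm_pos_iff.1 (hρ.trans_le hω2)
  have hann : a n n ≠ 0 := (han n le_rfl).1
  obtain ⟨hdeg, hlc⟩ := natDegree_heatFlow_randomPoly a (fun k => ξ k ω) n (t / n)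
    (mul_ne_zero hξn hann)
  have hp0 : p ≠ 0 := by
    intro h0
    rw [← hp, h0, Polynomial.leadingCoeff_zero] at hlc
    exact mul_ne_zero hξn hann hlc.symm
  have hn : (0 : ℝ) < n := by exact_mod_cast hn0
  have hlow1 : ρ * Real.exp (n * (u - ε)) ≤ ‖p.eval z‖ := by
    rw [hp, eval_heatFlow_randomPoly]
    refine (mul_le_mul_of_nonneg_left (hκ n hln).2 hρ.le).trans ?_
    simpa only [mul_assoc] using hω3
  have h1 := log_norm_eval_le p hp0 hδ z (by positivity) hlow1
  have h2 := le_log_of_sphere p hp0 hδ' z' (eval_upper_of_coeffUpper hω1 hun)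
  rw [Real.log_mul hρ.ne' (Real.exp_pos _).ne', Real.log_exp] at h1
  rw [Real.log_mul (by positivity) (Real.exp_pos _).ne', Real.log_exp] at h2
  have h3 : ∫ w, truncLogDiff hδ hδ' z z' w ∂(zeroMeasure p) =
      (n : ℝ)⁻¹ * ((p.roots.map fun w => truncLog δ (z - w)).sum -
        (p.roots.map fun w => truncLog δ' (z' - w)).sum) := by
    rw [integral_zeroMeasure, hdeg, ← Multiset.sum_map_sub]
    rfl
  have h4 := (abs_lt.1 hω4).2
  rw [h3] at h4
  -- The logarithms of the leading coefficient in `h1` and `h2` cancel, so its size is irrelevant to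
  -- the comparison.
  have h5 : (n : ℝ)⁻¹ * (Real.log ρ + n * (u - ε) - (Real.log (n + 1) + n * (u' + ε + ε))) ≤
      (n : ℝ)⁻¹ * ((p.roots.map fun w => truncLog δ (z - w)).sum -
        (p.roots.map fun w => truncLog δ' (z' - w)).sum) := by
    apply mul_le_mul_of_nonneg_left _ (by positivity)
    linarith
  have h6 : (n : ℝ)⁻¹ * (Real.log ρ + n * (u - ε) - (Real.log (n + 1) + n * (u' + ε + ε))) =
      u - u' - 3 * ε - (Real.log (n + 1) + -Real.log ρ) / n := by
    field_simp; ring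
  have h7 : ∫ w, truncLogDiff hδ hδ' z z' w ∂ν =
    ∫ w, (truncLog δ (z - w) - truncLog δ' (z' - w)) ∂ν := rfl
  linarith

/-- Upper bound for the smoothed logarithmic potential of the limit, normalised at infinity. -/
theorem integral_truncLogMin_le (hξ : IsCoefficientNoise P ξ) (ha : IsExponentialProfile a g)
    {t : ℂ} {ν : Measure ℂ} (hν : IsZeroLimit P ξ a t ν) {z' : ℂ} {δ' u' : ℝ}
    (hδ' : 0 < δ') (hup : CoeffUpper a t z' δ' u') (K : ℝ) :
    ∫ w, min (truncLog δ' (z' - w)) K ∂ν ≤ u' - g 1 := by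
  obtain ⟨ρ, hρ, hgood⟩ := hξ.exists_good_realisation
  apply le_of_forall_eventually_le (C := 4) (tendsto_log_succ_div (-Real.log ρ))
  intro ε hε
  -- Only the bounds on the noise and the convergence are wanted here, so the anti-concentration
  -- clause is fed dummy coefficients.
  have hg := hgood _ _ (hν (truncLogMin hδ' z' K)) (fun _ _ => 1) (fun _ => 0)
    (by filter_upwards [eventually_gt_atTop 0] with n hn using ⟨hn, one_ne_zero⟩) ε hε
  filter_upwards [hg, hup ε hε, ha.growth ε hε, eventually_gt_atTop 0] with
    n ⟨ω, hω1, hω2, hω3, hω4⟩ hun han hn0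
  set p := heatFlow (t / n) (randomPoly a (fun k => ξ k ω) n) with hp
  have hξn : ξ n ω ≠ 0 := norm_pos_iff.1 (hρ.trans_le hω2)
  have hann : a n n ≠ 0 := (han n le_rfl).1
  obtain ⟨hdeg, hlc⟩ := natDegree_heatFlow_randomPoly a (fun k => ξ k ω) n (t / n)
    (mul_ne_zero hξn hann)
  have hp0 : p ≠ 0 := by
    intro h0
    rw [← hp, h0, Polynomial.leadingCoeff_zero] at hlc
    exact mul_ne_zero hξn hann hlc.symm
  have hn : (0 : ℝ) < n := by exact_mod_cast hn0
  have h2 := le_log_of_sphere p hp0 hδ' z' (eval_upper_of_coeffUpper hω1 hun)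
  rw [Real.log_mul (by positivity) (Real.exp_pos _).ne', Real.log_exp, hp, hlc, norm_mul,
    Real.log_mul (norm_pos_iff.2 hξn).ne' (norm_pos_iff.2 hann).ne', ← hp] at h2
  have hlcρ : Real.log ρ ≤ Real.log ‖ξ n ω‖ := Real.log_le_log hρ hω2
  have hgr := (abs_le.1 (han n le_rfl).2).1
  rw [div_self hn.ne'] at hgr
  have hgr' : n * (g 1 - ε) ≤ Real.log ‖a n n‖ := by
    have : g 1 - ε ≤ 1 / (n : ℝ) * Real.log ‖a n n‖ := by linarith
    have := mul_le_mul_of_nonneg_left this hn.le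
    rwa [← mul_assoc, mul_one_div_cancel hn.ne', one_mul] at this
  have h3 : ∫ w, truncLogMin hδ' z' K w ∂(zeroMeasure p) ≤
      (n : ℝ)⁻¹ * (p.roots.map fun w => truncLog δ' (z' - w)).sum := by
    rw [integral_zeroMeasure, hdeg]
    refine mul_le_mul_of_nonneg_left ?_ (by positivity)
    exact Multiset.sum_map_le_sum_map _ _ fun w _ => min_le_left _ _
  have h4 := (abs_lt.1 hω4).1
  have h5 : (n : ℝ)⁻¹ * (p.roots.map fun w => truncLog δ' (z' - w)).sum ≤
      (n : ℝ)⁻¹ * (Real.log (n + 1) + n * (u' + ε + ε) - Real.log ρ - n * (g 1 - ε)) := by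
    apply mul_le_mul_of_nonneg_left _ (by positivity)
    linarith
  have h6 : (n : ℝ)⁻¹ * (Real.log (n + 1) + n * (u' + ε + ε) - Real.log ρ - n * (g 1 - ε)) =
      u' - g 1 + 3 * ε + (Real.log (n + 1) + -Real.log ρ) / n := by
    field_simp; ring
  have h7 : ∫ w, truncLogMin hδ' z' K w ∂ν = ∫ w, min (truncLog δ' (z' - w)) K ∂ν := rfl
  linarith

end Limit

/-! ### Uniqueness of measures with equal bump integrals -/

/-- A rotation invariant bump function of radius `2 s`: the mean of `-log` over the circle of
radius `s`, corrected by the mean over the circle of radius `2 s`. -/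
noncomputable def bump (s : ℝ) (w : ℂ) : ℝ := truncLog (2 * s) w - truncLog s w

theorem bump_continuous {s : ℝ} (hs : 0 < s) : Continuous (bump s) :=
  (truncLog_continuous (by positivity)).sub (truncLog_continuous hs)

theorem bump_nonneg {s : ℝ} (hs : 0 < s) (w : ℂ) : 0 ≤ bump s w :=
  sub_nonneg.2 (Real.log_le_log (lt_of_lt_of_le hs (le_max_left _ _))
    (max_le_max_right _ (by linarith)))

theorem bump_le {s : ℝ} (hs : 0 < s) (w : ℂ) : bump s w ≤ Real.log 2 := by
  unfold bump truncLog
  have h0 : 0 < max s ‖w‖ := lt_of_lt_of_le hs (le_max_left _ _)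
  rw [sub_le_iff_le_add, ← Real.log_mul (by norm_num) h0.ne']
  refine Real.log_le_log (lt_of_lt_of_le (by positivity : 0 < 2 * s) (le_max_left _ _)) ?_
  apply max_le
  · linarith [le_max_left s ‖w‖]
  · linarith [le_max_right s ‖w‖, norm_nonneg w]

theorem bump_eq_zero {s : ℝ} (hs : 0 < s) {w : ℂ} (hw : 2 * s ≤ ‖w‖) : bump s w = 0 := by
  unfold bump truncLog
  rw [max_eq_right hw, max_eq_right (by linarith), sub_self]

theorem bump_neg (s : ℝ) (w : ℂ) : bump s (-w) = bump s w := by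
  simp [bump, truncLog]

theorem bump_hasCompactSupport {s : ℝ} (hs : 0 < s) : HasCompactSupport (bump s) := by
  refine HasCompactSupport.intro (isCompact_closedBall (0 : ℂ) (2 * s)) fun x hx => ?_
  rw [mem_closedBall_zero_iff, not_le] at hx
  exact bump_eq_zero hs hx.le

theorem integral_bump_pos {s : ℝ} (hs : 0 < s) : 0 < ∫ w, bump s w := by
  refine (bump_continuous hs).integral_pos_of_hasCompactSupport_nonneg_nonzero
    (bump_hasCompactSupport hs) (bump_nonneg hs) (x := 0) ?_
  unfold bump truncLog
  rw [norm_zero, max_eq_left (by positivity), max_eq_left hs.le,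
    Real.log_mul (by norm_num) hs.ne', add_sub_cancel_right]
  exact (Real.log_pos (by norm_num)).ne'

theorem integral_bump_sub (s : ℝ) (u : ℂ) : ∫ x, bump s (x - u) = ∫ w, bump s w :=
  integral_sub_right_eq_self (bump s) u

/-- The bump lives at distance at most `2 * s < d`, where `f` varies by less than `η`: normalised
bumps are an approximate identity. -/
theorem abs_integral_mul_bump_sub_le {f : ℂ → ℝ} (hf : Continuous f) {s η d : ℝ} (hs : 0 < s)
    (hsd : 2 * s < d) (hd : ∀ x y : ℂ, dist x y < d → dist (f x) (f y) < η) (u : ℂ) :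
    |(∫ x, f x * bump s (x - u)) - (∫ w, bump s w) * f u| ≤ η * ∫ w, bump s w := by
  have hbc : Continuous fun x : ℂ => bump s (x - u) := (bump_continuous hs).comp (by fun_prop)
  have hbs : HasCompactSupport fun x : ℂ => bump s (x - u) :=
    (bump_hasCompactSupport hs).comp_homeomorph (Homeomorph.subRight u)
  have h1 : Integrable fun x : ℂ => bump s (x - u) := hbc.integrable_of_hasCompactSupport hbs
  have h2 : Integrable fun x : ℂ => f x * bump s (x - u) :=
    (hf.mul hbc).integrable_of_hasCompactSupport hbs.mul_left
  rw [← integral_bump_sub s u, ← integral_mul_const, ← integral_sub h2 (h1.mul_const _),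
    ← integral_const_mul]
  refine abs_integral_le_integral_abs.trans (integral_mono ((h2.sub (h1.mul_const _)).abs)
    (h1.const_mul _) fun x => ?_)
  rw [mul_comm (bump s (x - u)), ← sub_mul, abs_mul, abs_of_nonneg (bump_nonneg hs _)]
  by_cases hx : 2 * s ≤ ‖x - u‖
  · rw [bump_eq_zero hs hx]; simp
  · refine mul_le_mul_of_nonneg_right ?_ (bump_nonneg hs _)
    have := hd x u (by rw [dist_eq_norm]; linarith)
    rw [Real.dist_eq] at this
    exact this.le

theorem integral_swap_bump {f : ℂ → ℝ} (hf : Continuous f) (hfs : HasCompactSupport f)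
    {s : ℝ} (hs : 0 < s) (ν : Measure ℂ) [IsProbabilityMeasure ν] :
    Integrable (fun u => ∫ x, f x * bump s (x - u)) ν ∧
      ∫ u, (∫ x, f x * bump s (x - u)) ∂ν = ∫ x, f x * ∫ u, bump s (x - u) ∂ν := by
  have hint : Integrable (Function.uncurry fun (u x : ℂ) => f x * bump s (x - u))
      (ν.prod volume) := by
    have h1 : Integrable (fun p : ℂ × ℂ => (1 : ℝ) * (‖f p.2‖ * Real.log 2)) (ν.prod volume) :=
      (integrable_const (1 : ℝ)).mul_prod
        ((hf.integrable_of_hasCompactSupport hfs).norm.mul_const (Real.log 2))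
    refine h1.mono ?_ (ae_of_all _ fun p => ?_)
    · refine Continuous.aestronglyMeasurable ?_
      exact (hf.comp continuous_snd).mul
        ((bump_continuous hs).comp (continuous_snd.sub continuous_fst))
    · simp only [Function.uncurry, norm_mul, one_mul, norm_norm]
      refine mul_le_mul_of_nonneg_left ?_ (norm_nonneg _)
      rw [Real.norm_eq_abs, Real.norm_eq_abs, abs_of_nonneg (bump_nonneg hs _),
        abs_of_nonneg (Real.log_nonneg (by norm_num))]
      exact bump_le hs _
  refine ⟨hint.integral_prod_left, ?_⟩
  rw [integral_integral_swap hint]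
  simp_rw [integral_const_mul]

/-- By Fubini, the integral of the mollified `f` depends on the measure only through bump integrals
centred on the support of `f`; these agree for `ν` and `ν'`, and the mollification is uniformly
close to `f`. -/
theorem integral_eq_of_bumps {ν ν' : Measure ℂ} [IsProbabilityMeasure ν] [IsProbabilityMeasure ν']
    {O : Set ℂ} (hO : IsOpen O)
    (h : ∀ x ∈ O, ∀ s : ℝ, 0 < s → Metric.closedBall x (2 * s) ⊆ O →
      ∫ u, bump s (x - u) ∂ν = ∫ u, bump s (x - u) ∂ν')
    {f : ℂ → ℝ} (hf : Continuous f) (hfs : HasCompactSupport f) (hfO : tsupport f ⊆ O) :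
    ∫ u, f u ∂ν = ∫ u, f u ∂ν' := by
  have hfi : ∀ (μ : Measure ℂ) [IsProbabilityMeasure μ], Integrable f μ :=
    fun μ _ => hf.integrable_of_hasCompactSupport hfs
  -- Bumps of radius at most `e` centred on the support of `f` stay inside `O`.
  obtain ⟨e, he, heO⟩ := hfs.isCompact.exists_cthickening_subset_open hO hfO
  have huc := hfs.uniformContinuous_of_continuous hf
  rw [Metric.uniformContinuous_iff] at huc
  have hle : ∀ η : ℝ, 0 < η → |∫ u, f u ∂ν - ∫ u, f u ∂ν'| ≤ 2 * η := by
    intro η hη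
    obtain ⟨d, hd, hfd⟩ := huc η hη
    set s := min d e / 4 with hs_def
    have hm : 0 < min d e := lt_min hd he
    have hs : 0 < s := by positivity
    have hsd : 2 * s < d := by have := min_le_left d e; linarith
    have hse : 2 * s ≤ e := by have := min_le_right d e; linarith
    have hc := integral_bump_pos hs
    set c := ∫ w, bump s w
    have hG : ∀ u, |(∫ x, f x * bump s (x - u)) - c * f u| ≤ η * c :=
      abs_integral_mul_bump_sub_le hf hs hsd fun x y hxy => hfd hxy
    have hest : ∀ (μ : Measure ℂ) [IsProbabilityMeasure μ],
        |(∫ x, f x * ∫ u, bump s (x - u) ∂μ) - c * ∫ u, f u ∂μ| ≤ η * c := by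
      intro μ _
      obtain ⟨hi, he⟩ := integral_swap_bump hf hfs hs μ
      rw [← he, ← integral_const_mul, ← integral_sub hi ((hfi μ).const_mul _)]
      refine abs_integral_le_integral_abs.trans ?_
      calc _ ≤ ∫ u, η * c ∂μ := integral_mono ((hi.sub ((hfi μ).const_mul _)).abs)
            (integrable_const _) hG
        _ = η * c := by simp
    have heq : (∫ x, f x * ∫ u, bump s (x - u) ∂ν) = ∫ x, f x * ∫ u, bump s (x - u) ∂ν' := by
      refine integral_congr_ae (ae_of_all _ fun x => ?_)
      by_cases hx : x ∈ tsupport f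
      · simp only
        rw [h x (hfO hx) s hs]
        exact ((Metric.closedBall_subset_closedBall hse).trans
          (Metric.closedBall_subset_cthickening hx e)).trans heO
      · simp only [image_eq_zero_of_notMem_tsupport hx, zero_mul]
    have h1 := hest ν
    have h2 := hest ν'
    rw [heq] at h1
    rw [abs_le] at h1 h2
    have h3 : |c * (∫ u, f u ∂ν - ∫ u, f u ∂ν')| ≤ c * (2 * η) := by
      rw [abs_le]; constructor <;> linarith
    rw [abs_mul, abs_of_pos hc] at h3
    exact le_of_mul_le_mul_left h3 hc
  by_contra hne
  have hpos : 0 < |∫ u, f u ∂ν - ∫ u, f u ∂ν'| := abs_pos.2 (sub_ne_zero.2 hne)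
  have := hle _ (by positivity : 0 < |∫ u, f u ∂ν - ∫ u, f u ∂ν'| / 4)
  linarith

/-- No information on `ν` outside `O` is required: a cut-off supported in `O` carries almost all the
mass of `ν'`, hence of `ν` as well, and both are probability measures. -/
theorem measure_eq_of_bumps {ν ν' : Measure ℂ} [IsProbabilityMeasure ν] [IsProbabilityMeasure ν']
    {O : Set ℂ} (hO : IsOpen O) (hO1 : ν' O = 1)
    (h : ∀ x ∈ O, ∀ s : ℝ, 0 < s → Metric.closedBall x (2 * s) ⊆ O →
      ∫ u, bump s (x - u) ∂ν = ∫ u, bump s (x - u) ∂ν') : ν = ν' := by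
  apply ext_of_forall_integral_eq_of_IsFiniteMeasure
  intro f
  have hle : ∀ η : ℝ, 0 < η → |∫ u, f u ∂ν - ∫ u, f u ∂ν'| ≤ ‖f‖ * (2 * η) := by
    intro η hη
    obtain ⟨K, hKO, hK, hKν⟩ := hO.exists_lt_isCompact (μ := ν') (r := 1 - ENNReal.ofReal η) (by
      rw [hO1]; exact ENNReal.sub_lt_self (by simp) (by simp) (by simpa using hη))
    obtain ⟨χ, hχ1, hχs, hχO, hχ01⟩ := exists_continuousMap_one_of_isCompact_subset_isOpen hK hO hKO
    have hχi : ∀ (μ : Measure ℂ) [IsProbabilityMeasure μ], Integrable χ μ :=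
      fun μ _ => χ.continuous.integrable_of_hasCompactSupport hχs
    have hfχs : HasCompactSupport fun u => f u * χ u := HasCompactSupport.mul_left hχs
    have hfχc : Continuous fun u => f u * χ u := f.continuous.mul χ.continuous
    have h1 := integral_eq_of_bumps hO h χ.continuous hχs hχO
    have h2 := integral_eq_of_bumps hO h hfχc hfχs
      ((tsupport_mul_subset_right (f := fun u => f u) (g := fun u => χ u)).trans hχO)
    have hχη : 1 - η ≤ ∫ u, χ u ∂ν' := by
      have h3 : ν'.real K ≤ ∫ u, χ u ∂ν' := by
        rw [← integral_indicator_one hK.measurableSet]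
        refine integral_mono ((integrable_const 1).indicator hK.measurableSet) (hχi ν') fun u => ?_
        by_cases hu : u ∈ K
        · simp [hu, hχ1 hu]
        · simp only [Set.indicator_of_notMem hu]; exact (hχ01 u).1
      have h4 : 1 - ENNReal.ofReal η ≤ ENNReal.ofReal (ν'.real K) := by
        rw [ofReal_measureReal]; exact hKν.le
      rw [← ENNReal.ofReal_one, ← ENNReal.ofReal_sub _ hη.le,
        ENNReal.ofReal_le_ofReal_iff measureReal_nonneg] at h4
      linarith
    have hest : ∀ (μ : Measure ℂ) [IsProbabilityMeasure μ], 1 - η ≤ ∫ u, χ u ∂μ →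
        |∫ u, f u ∂μ - ∫ u, f u * χ u ∂μ| ≤ ‖f‖ * η := by
      intro μ _ hμ
      have hfi : Integrable f μ := f.integrable μ
      have hfχi : Integrable (fun u => f u * χ u) μ := hfχc.integrable_of_hasCompactSupport hfχs
      rw [← integral_sub hfi hfχi]
      refine abs_integral_le_integral_abs.trans ?_
      calc _ ≤ ∫ u, ‖f‖ * (1 - χ u) ∂μ := by
            refine integral_mono ((hfi.sub hfχi).abs)
              (((integrable_const 1).sub (hχi μ)).const_mul _) fun u => ?_
            have : f u - f u * χ u = f u * (1 - χ u) := by ring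
            simp only [this, abs_mul]
            rw [abs_of_nonneg (sub_nonneg.2 (hχ01 u).2)]
            exact mul_le_mul_of_nonneg_right (f.norm_coe_le_norm u) (sub_nonneg.2 (hχ01 u).2)
        _ = ‖f‖ * (1 - ∫ u, χ u ∂μ) := by
            rw [integral_const_mul, integral_sub (integrable_const 1) (hχi μ)]; simp
        _ ≤ ‖f‖ * η := by gcongr; linarith
    have h5 := hest ν (by rw [h1]; exact hχη)
    have h6 := hest ν' hχη
    rw [h2] at h5
    rw [abs_le] at h5 h6 ⊢
    constructor <;> linarith
  by_contra hne
  have hpos : 0 < |∫ u, f u ∂ν - ∫ u, f u ∂ν'| := abs_pos.2 (sub_ne_zero.2 hne)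
  have h2 := hle (|∫ u, f u ∂ν - ∫ u, f u ∂ν'| / (4 * (‖f‖ + 1))) (by positivity)
  have h3 : ‖f‖ * (2 * (|∫ u, f u ∂ν - ∫ u, f u ∂ν'| / (4 * (‖f‖ + 1)))) ≤
      |∫ u, f u ∂ν - ∫ u, f u ∂ν'| / 2 := by
    have : ‖f‖ / (‖f‖ + 1) ≤ 1 := (div_le_one (by positivity)).2 (by linarith)
    calc _ = (‖f‖ / (‖f‖ + 1)) * (|∫ u, f u ∂ν - ∫ u, f u ∂ν'| / 2) := by field_simp; ring
      _ ≤ 1 * (|∫ u, f u ∂ν - ∫ u, f u ∂ν'| / 2) := by gcongr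
      _ = _ := one_mul _
  linarith

/-! ### Logarithmic potentials -/

/-- Fatou's lemma, stated for Bochner integrals. -/
theorem integrable_of_tendsto_of_integral_le {α : Type*} [MeasurableSpace α] {μ : Measure α}
    {F : ℕ → α → ℝ} {f : α → ℝ} {B : ℝ} (hF : ∀ n, Integrable (F n) μ) (hF0 : ∀ n x, 0 ≤ F n x)
    (hlim : ∀ᵐ x ∂μ, Tendsto (fun n => F n x) atTop (𝓝 (f x))) (hB : ∀ n, ∫ x, F n x ∂μ ≤ B) :
    Integrable f μ ∧ ∫ x, f x ∂μ ≤ B := by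
  have hfm : AEStronglyMeasurable f μ := aestronglyMeasurable_of_tendsto_ae _ (fun n => (hF n).1) hlim
  have hf0 : ∀ᵐ x ∂μ, 0 ≤ f x := by
    filter_upwards [hlim] with x hx using ge_of_tendsto' hx fun n => hF0 n x
  have h1 : ∫⁻ x, ENNReal.ofReal (f x) ∂μ ≤ ENNReal.ofReal B := by
    calc ∫⁻ x, ENNReal.ofReal (f x) ∂μ
        = ∫⁻ x, liminf (fun n => ENNReal.ofReal (F n x)) atTop ∂μ := by
          refine lintegral_congr_ae ?_
          filter_upwards [hlim] with x hx
          exact ((ENNReal.continuous_ofReal.tendsto _).comp hx).liminf_eq.symm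
      _ ≤ liminf (fun n => ∫⁻ x, ENNReal.ofReal (F n x) ∂μ) atTop :=
          lintegral_liminf_le' fun n => (hF n).1.aemeasurable.ennreal_ofReal
      _ ≤ ENNReal.ofReal B := by
          refine liminf_le_of_le (by isBoundedDefault) fun b hb => ?_
          obtain ⟨n, hn⟩ := hb.exists
          refine hn.trans ?_
          rw [← ofReal_integral_eq_lintegral_ofReal (hF n) (ae_of_all _ (hF0 n))]
          exact ENNReal.ofReal_le_ofReal (hB n)
  have hfi : Integrable f μ :=
    ⟨hfm, by rw [hasFiniteIntegral_iff_ofReal hf0]; exact h1.trans_lt ENNReal.ofReal_lt_top⟩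
  refine ⟨hfi, ?_⟩
  have hB0 : 0 ≤ B := (integral_nonneg (hF0 0)).trans (hB 0)
  rw [← ofReal_integral_eq_lintegral_ofReal hfi hf0, ENNReal.ofReal_le_ofReal_iff hB0] at h1
  exact h1

/-- Finiteness of the logarithmic moment `∫ log⁺ |w| dν`. -/
def HasLogMoment (ν : Measure ℂ) : Prop := Integrable (fun w => truncLog 1 w) ν

/-- The logarithmic potential. -/
noncomputable def logPot (ν : Measure ℂ) (z : ℂ) : ℝ := ∫ w, Real.log ‖z - w‖ ∂ν

theorem truncLog_neg (δ : ℝ) (w : ℂ) : truncLog δ (-w) = truncLog δ w := by simp [truncLog]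

theorem integrable_truncLog_iff {ν : Measure ℂ} [IsProbabilityMeasure ν] {δ δ' : ℝ} (hδ : 0 < δ)
    (hδ' : 0 < δ') (z z' : ℂ) : Integrable (fun w => truncLog δ (z - w)) ν ↔
      Integrable (fun w => truncLog δ' (z' - w)) ν := by
  have key : ∀ {δ δ' : ℝ} (hδ : 0 < δ) (hδ' : 0 < δ') (z z' : ℂ),
      Integrable (fun w => truncLog δ' (z' - w)) ν → Integrable (fun w => truncLog δ (z - w)) ν := by
    intro δ δ' hδ hδ' z z' h
    have h2 := h.add ((truncLogDiff hδ hδ' z z').integrable ν)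
    refine h2.congr (ae_of_all _ fun w => ?_)
    show truncLog δ' (z' - w) + (truncLog δ (z - w) - truncLog δ' (z' - w)) = _
    ring
  exact ⟨key hδ' hδ z' z, key hδ hδ' z z'⟩

theorem HasLogMoment.integrable_truncLog {ν : Measure ℂ} [IsProbabilityMeasure ν]
    (h : HasLogMoment ν) {δ : ℝ} (hδ : 0 < δ) (z : ℂ) :
    Integrable (fun w => truncLog δ (z - w)) ν := by
  rw [integrable_truncLog_iff hδ one_pos z 0]
  simpa only [HasLogMoment, zero_sub, truncLog_neg] using h

theorem hasLogMoment_of_integrable {ν : Measure ℂ} [IsProbabilityMeasure ν] {δ : ℝ} (hδ : 0 < δ)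
    {z : ℂ} (h : Integrable (fun w => truncLog δ (z - w)) ν) : HasLogMoment ν := by
  rw [integrable_truncLog_iff hδ one_pos z 0] at h
  simpa only [HasLogMoment, zero_sub, truncLog_neg] using h

/-- Fatou's lemma as the cut-off height tends to infinity. The kernel is at least `Real.log δ`, and
subtracting this constant makes the integrands nonnegative. -/
theorem hasLogMoment_of_min_le {ν : Measure ℂ} [IsProbabilityMeasure ν] {δ : ℝ} (hδ : 0 < δ)
    {z : ℂ} {B : ℝ} (h : ∀ K : ℝ, ∫ w, min (truncLog δ (z - w)) K ∂ν ≤ B) :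
    HasLogMoment ν ∧ ∫ w, truncLog δ (z - w) ∂ν ≤ B := by
  have h1 := integrable_of_tendsto_of_integral_le (μ := ν)
    (F := fun n w => min (truncLog δ (z - w)) (Real.log δ + n) - Real.log δ)
    (f := fun w => truncLog δ (z - w) - Real.log δ) (B := B - Real.log δ)
    (fun n => ((truncLogMin hδ z (Real.log δ + n)).integrable ν).sub (integrable_const _))
    (fun n w => sub_nonneg.2 (le_min (log_radius_le_truncLog hδ _) (by simp)))
    (ae_of_all _ fun w => by
      refine (tendsto_const_nhds).congr' ?_
      obtain ⟨N, hN⟩ := exists_nat_ge (truncLog δ (z - w) - Real.log δ)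
      filter_upwards [eventually_ge_atTop N] with n hn
      have : (N : ℝ) ≤ n := by exact_mod_cast hn
      rw [min_eq_left (by linarith)])
    (fun n => by
      have h1 : Integrable (fun w => min (truncLog δ (z - w)) (Real.log δ + n)) ν :=
        (truncLogMin hδ z (Real.log δ + n)).integrable ν
      rw [integral_sub h1 (integrable_const _)]
      simpa using h (Real.log δ + n))
  have h2 : Integrable (fun w => truncLog δ (z - w)) ν := by
    refine (h1.1.add (integrable_const (Real.log δ))).congr (ae_of_all _ fun w => ?_)
    simp
  refine ⟨hasLogMoment_of_integrable hδ h2, ?_⟩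
  have h3 := h1.2
  rw [integral_sub h2 (integrable_const _)] at h3
  simpa using h3

theorem tendsto_truncLog (w : ℂ) (hw : w ≠ 0) :
    Tendsto (fun δ => truncLog δ w) (𝓝[>] 0) (𝓝 (Real.log ‖w‖)) := by
  refine tendsto_const_nhds.congr' ?_
  filter_upwards [Ioo_mem_nhdsGT (norm_pos_iff.2 hw)] with δ hδ
  unfold truncLog
  rw [max_eq_right hδ.2.le]

theorem truncLog_mono {δ δ' : ℝ} (hδ : 0 < δ) (h : δ ≤ δ') (w : ℂ) :
    truncLog δ w ≤ truncLog δ' w :=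
  Real.log_le_log (lt_of_lt_of_le hδ (le_max_left _ _)) (max_le_max_right _ h)

/-- An atom at `z` of mass `c` would push the truncated potential down by `c * log (1 / δ)`, against
the uniform lower bound. It has to be excluded separately because `Real.log 0 = 0` hides it. Away
from the atom, Fatou's lemma applies as `δ` tends to zero. -/
theorem HasLogMoment.integrable_log {ν : Measure ℂ} [IsProbabilityMeasure ν]
    (h : HasLogMoment ν) {z : ℂ} {B : ℝ}
    (hB : ∀ δ : ℝ, 0 < δ → δ ≤ 1 → B ≤ ∫ w, truncLog δ (z - w) ∂ν) :
    Integrable (fun w => Real.log ‖z - w‖) ν ∧ ∀ᵐ w ∂ν, z - w ≠ 0 := by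
  set C := ∫ w, truncLog 1 (z - w) ∂ν with hC
  have hnull : ν {z} = 0 := by
    have hreal : ν.real {z} = 0 := by
      by_contra hne
      have hpos : 0 < ν.real {z} := lt_of_le_of_ne measureReal_nonneg (Ne.symm hne)
      have hle : ∀ M : ℝ, 0 ≤ M → ν.real {z} * M ≤ C - B := by
        intro M hM
        have hδ : 0 < Real.exp (-M) := Real.exp_pos _
        have hδ1 : Real.exp (-M) ≤ 1 := Real.exp_le_one_iff.2 (by linarith)
        have h1 := hB _ hδ hδ1
        have hi1 := h.integrable_truncLog one_pos z
        have hi2 := h.integrable_truncLog hδ z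
        have h2 : ν.real {z} * M ≤ ∫ w, (truncLog 1 (z - w) - truncLog (Real.exp (-M)) (z - w)) ∂ν := by
          rw [← smul_eq_mul, ← integral_indicator_const M (measurableSet_singleton z)]
          refine integral_mono ((integrable_const M).indicator (measurableSet_singleton z))
            (hi1.sub hi2) fun w => ?_
          by_cases hw : w = z
          · simp [hw, truncLog, max_eq_left hδ.le]
          · rw [Set.indicator_of_notMem (by simpa using hw)]
            exact sub_nonneg.2 (truncLog_mono hδ hδ1 _)
        rw [integral_sub hi1 hi2] at h2
        linarith
      have h0 := hle 0 le_rfl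
      have h3 := hle ((C - B + 1) / ν.real {z}) (by
        rw [mul_zero] at h0; positivity)
      rw [mul_div_cancel₀ _ hne] at h3
      linarith
    rw [measureReal_def, ENNReal.toReal_eq_zero_iff] at hreal
    exact hreal.resolve_right (measure_ne_top _ _)
  have hae : ∀ᵐ w ∂ν, z - w ≠ 0 := by
    have : ∀ᵐ w ∂ν, w ∉ ({z} : Set ℂ) := measure_eq_zero_iff_ae_notMem.1 hnull
    filter_upwards [this] with w hw h0
    exact hw (sub_eq_zero.1 h0).symm
  refine ⟨?_, hae⟩
  have hseq : Tendsto (fun n : ℕ => 1 / ((n : ℝ) + 1)) atTop (𝓝[>] 0) :=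
    tendsto_nhdsWithin_iff.2 ⟨tendsto_one_div_add_atTop_nhds_zero_nat,
      Eventually.of_forall fun n => Set.mem_Ioi.2 (by positivity)⟩
  have hpos : ∀ n : ℕ, 0 < 1 / ((n : ℝ) + 1) := fun n => by positivity
  have hle1 : ∀ n : ℕ, 1 / ((n : ℝ) + 1) ≤ 1 := fun n => by
    rw [div_le_one (by positivity)]; linarith [Nat.cast_nonneg (α := ℝ) n]
  have h1 := integrable_of_tendsto_of_integral_le (μ := ν)
    (F := fun n w => truncLog 1 (z - w) - truncLog (1 / ((n : ℝ) + 1)) (z - w))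
    (f := fun w => truncLog 1 (z - w) - Real.log ‖z - w‖) (B := C - B)
    (fun n => (h.integrable_truncLog one_pos z).sub (h.integrable_truncLog (hpos n) z))
    (fun n w => sub_nonneg.2 (truncLog_mono (hpos n) (hle1 n) _))
    (by
      filter_upwards [hae] with w hw
      exact tendsto_const_nhds.sub ((tendsto_truncLog _ hw).comp hseq))
    (fun n => by
      rw [integral_sub (h.integrable_truncLog one_pos z) (h.integrable_truncLog (hpos n) z)]
      linarith [hB _ (hpos n) (hle1 n)])
  refine ((h.integrable_truncLog one_pos z).sub h1.1).congr (ae_of_all _ fun w => ?_)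
  simp

theorem tendsto_integral_truncLog {ν : Measure ℂ} [IsProbabilityMeasure ν]
    (h : HasLogMoment ν) {z : ℂ} (hz : Integrable (fun w => Real.log ‖z - w‖) ν)
    (hae : ∀ᵐ w ∂ν, z - w ≠ 0) :
    Tendsto (fun δ => ∫ w, truncLog δ (z - w) ∂ν) (𝓝[>] 0) (𝓝 (logPot ν z)) := by
  refine tendsto_integral_filter_of_dominated_convergence
    (fun w => |Real.log ‖z - w‖| + |truncLog 1 (z - w)|) ?_ ?_
    (hz.abs.add (h.integrable_truncLog one_pos z).abs) ?_
  · filter_upwards [self_mem_nhdsWithin] with δ hδ using (h.integrable_truncLog hδ z).1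
  · filter_upwards [Ioo_mem_nhdsGT one_pos] with δ hδ
    filter_upwards [hae] with w hw
    have h1 := log_le_truncLog δ (z - w) hw
    have h2 := truncLog_mono hδ.1 hδ.2.le (z - w)
    rw [Real.norm_eq_abs, abs_le]
    constructor
    · linarith [neg_abs_le (Real.log ‖z - w‖), abs_nonneg (truncLog 1 (z - w))]
    · linarith [le_abs_self (truncLog 1 (z - w)), abs_nonneg (Real.log ‖z - w‖)]
  · filter_upwards [hae] with w hw using tendsto_truncLog _ hw

/-- Exponential upper bound `exp (n u)` for the deterministic terms near the point `z`. -/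
def CoeffUpperAt (a : ℕ → ℕ → ℂ) (t z : ℂ) (u : ℝ) : Prop :=
  ∀ η : ℝ, 0 < η → ∃ δ₀ : ℝ, 0 < δ₀ ∧ ∀ δ : ℝ, 0 < δ → δ ≤ δ₀ → CoeffUpper a t z δ (u + η)

/-- An upper bound `B` for the logarithmic potential at `z`, in smoothed form. -/
def PotentialLe (ν : Measure ℂ) (z : ℂ) (B : ℝ) : Prop :=
  ∀ η : ℝ, 0 < η → ∃ δ₀ : ℝ, 0 < δ₀ ∧ ∀ δ : ℝ, 0 < δ → δ ≤ δ₀ → ∀ K : ℝ,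
    ∫ w, min (truncLog δ (z - w)) K ∂ν ≤ B + η

theorem PotentialLe.hasLogMoment {ν : Measure ℂ} [IsProbabilityMeasure ν] {z : ℂ} {B : ℝ}
    (h : PotentialLe ν z B) : HasLogMoment ν := by
  obtain ⟨δ, hδ, hK⟩ := h 1 one_pos
  exact (hasLogMoment_of_min_le hδ (hK δ hδ le_rfl)).1

theorem PotentialLe.logPot_le {ν : Measure ℂ} [IsProbabilityMeasure ν] {z : ℂ} {B : ℝ}
    (h : PotentialLe ν z B) (hz : Integrable (fun w => Real.log ‖z - w‖) ν)
    (hae : ∀ᵐ w ∂ν, z - w ≠ 0) : logPot ν z ≤ B := by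
  refine le_of_forall_pos_le_add fun η hη => ?_
  obtain ⟨δ, hδ, hK⟩ := h η hη
  obtain ⟨h1, h2⟩ := hasLogMoment_of_min_le hδ (hK δ hδ le_rfl)
  refine le_trans (integral_mono_ae hz (h1.integrable_truncLog hδ z) ?_) h2
  filter_upwards [hae] with w hw using log_le_truncLog δ _ hw

section Limit

variable {Ω : Type*} [MeasurableSpace Ω] {P : Measure Ω} [IsProbabilityMeasure P]
  {ξ : ℕ → Ω → ℂ} {a : ℕ → ℕ → ℂ} {g : ℝ → ℝ} {t : ℂ} {ν : Measure ℂ}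

theorem potentialLe_of_coeffUpperAt (hξ : IsCoefficientNoise P ξ) (ha : IsExponentialProfile a g)
    (hν : IsZeroLimit P ξ a t ν) {z : ℂ} {u : ℝ}
    (hup : CoeffUpperAt a t z u) : PotentialLe ν z (u - g 1) := by
  intro η hη
  obtain ⟨δ₀, hδ₀, h⟩ := hup η hη
  refine ⟨δ₀, hδ₀, fun δ hδ hδ' K => ?_⟩
  have := integral_truncLogMin_le hξ ha hν hδ (h δ hδ hδ') K
  linarith

theorem integrable_log_of_coeff [IsProbabilityMeasure ν] (hξ : IsCoefficientNoise P ξ)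
    (ha : IsExponentialProfile a g) (hν : IsZeroLimit P ξ a t ν) {z : ℂ} {u : ℝ}
    (hup : CoeffUpperAt a t z u) (hlow : CoeffLower a t z u) :
    Integrable (fun w => Real.log ‖z - w‖) ν ∧ ∀ᵐ w ∂ν, z - w ≠ 0 := by
  have hm := (potentialLe_of_coeffUpperAt hξ ha hν hup).hasLogMoment
  obtain ⟨δ', hδ', h⟩ := hup 1 one_pos
  refine hm.integrable_log (B := u - (u + 1) + ∫ w, truncLog δ' (z - w) ∂ν) fun δ hδ _ => ?_
  have h1 := le_integral_truncLogDiff hξ ha hν hδ hδ' hlow (h δ' hδ' le_rfl)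
  rw [integral_sub (hm.integrable_truncLog hδ z) (hm.integrable_truncLog hδ' z)] at h1
  linarith

theorem le_logPot_sub [IsProbabilityMeasure ν] (hξ : IsCoefficientNoise P ξ)
    (ha : IsExponentialProfile a g) (hν : IsZeroLimit P ξ a t ν) {z z' : ℂ} {u u' : ℝ}
    (hup : CoeffUpperAt a t z u) (hlow : CoeffLower a t z u)
    (hup' : CoeffUpperAt a t z' u') (hlow' : CoeffLower a t z' u') :
    u - u' ≤ logPot ν z - logPot ν z' := by
  have hm := (potentialLe_of_coeffUpperAt hξ ha hν hup).hasLogMoment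
  obtain ⟨hi, hne⟩ := integrable_log_of_coeff hξ ha hν hup hlow
  obtain ⟨hi', hne'⟩ := integrable_log_of_coeff hξ ha hν hup' hlow'
  refine le_of_forall_pos_le_add fun η hη => ?_
  obtain ⟨δ₀, hδ₀, h⟩ := hup' η hη
  have h1 := (tendsto_integral_truncLog hm hi hne).sub (tendsto_integral_truncLog hm hi' hne')
  have h2 : u - u' - η ≤ logPot ν z - logPot ν z' := by
    refine ge_of_tendsto h1 ?_
    filter_upwards [Ioo_mem_nhdsGT hδ₀] with δ hδ
    have h3 := le_integral_truncLogDiff hξ ha hν hδ.1 hδ.1 hlow (h δ hδ.1 hδ.2.le)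
    rw [integral_sub (hm.integrable_truncLog hδ.1 z) (hm.integrable_truncLog hδ.1 z')] at h3
    linarith
  linarith

/-- Matching upper and lower rates allow the smoothing radius to be sent to zero. Only differences
are obtained, since the leading coefficient has been cancelled. -/
theorem logPot_sub_eq [IsProbabilityMeasure ν] (hξ : IsCoefficientNoise P ξ)
    (ha : IsExponentialProfile a g) (hν : IsZeroLimit P ξ a t ν) {z z' : ℂ} {u u' : ℝ}
    (hup : CoeffUpperAt a t z u) (hlow : CoeffLower a t z u)
    (hup' : CoeffUpperAt a t z' u') (hlow' : CoeffLower a t z' u') :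
    logPot ν z - logPot ν z' = u - u' := by
  have h1 := le_logPot_sub hξ ha hν hup hlow hup' hlow'
  have h2 := le_logPot_sub hξ ha hν hup' hlow' hup hlow
  linarith

end Limit

/-! ### Averages of potentials over curves -/

/-- The uniform probability measure on `(0, 2π]`. -/
noncomputable def angleMeasure : Measure ℝ :=
  (ENNReal.ofReal (2 * Real.pi))⁻¹ • volume.restrict (Set.Ioc 0 (2 * Real.pi))

instance : IsProbabilityMeasure angleMeasure := by
  constructor
  rw [angleMeasure, Measure.smul_apply, Measure.restrict_apply_univ, Real.volume_Ioc, sub_zero,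
    smul_eq_mul]
  exact ENNReal.inv_mul_cancel (by simpa using Real.pi_pos) ENNReal.ofReal_ne_top

theorem integral_angleMeasure (f : ℝ → ℝ) :
    ∫ θ, f θ ∂angleMeasure = (2 * Real.pi)⁻¹ * ∫ θ in 0..2 * Real.pi, f θ := by
  rw [angleMeasure, integral_smul_measure, intervalIntegral.integral_of_le Real.two_pi_pos.le,
    smul_eq_mul, ENNReal.toReal_inv, ENNReal.toReal_ofReal Real.two_pi_pos.le]

theorem circleAverage_eq_integral_angleMeasure (f : ℂ → ℝ) (c : ℂ) (R : ℝ) :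
    Real.circleAverage f c R = ∫ θ, f (circleMap c R θ) ∂angleMeasure := by
  rw [Real.circleAverage_def, integral_angleMeasure, smul_eq_mul]

theorem integrable_angleMeasure_iff {f : ℂ → ℝ} {c : ℂ} {R : ℝ} :
    Integrable (fun θ => f (circleMap c R θ)) angleMeasure ↔ CircleIntegrable f c R := by
  rw [angleMeasure, integrable_smul_measure (ENNReal.inv_ne_zero.2 ENNReal.ofReal_ne_top)
    (by simpa using Real.pi_pos),
    circleIntegrable_def, intervalIntegrable_iff_integrableOn_Ioc_of_le Real.two_pi_pos.le,
    IntegrableOn]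

/-- Jensen's formula, and the reason for truncating in this way: smoothing a potential over circles
amounts to truncating its kernel. -/
theorem circleAverage_log_norm_sub {s : ℝ} (hs : 0 < s) (x u : ℂ) :
    Real.circleAverage (fun z => Real.log ‖z - u‖) x s = truncLog s (x - u) := by
  rw [circleAverage_log_norm_sub_const_eq_log_radius_add_posLog hs.ne', Real.posLog, truncLog]
  rcases le_total s ‖x - u‖ with h | h
  · rw [max_eq_right h, max_eq_right, Real.log_mul (by positivity) (by linarith [hs] : 0 < ‖x - u‖).ne', Real.log_inv]
    · ring
    · apply Real.log_nonneg
      rw [inv_mul_eq_div, one_le_div hs]; exact h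
  · rw [max_eq_left h, max_eq_left, add_zero]
    apply Real.log_nonpos (by positivity)
    rw [inv_mul_eq_div, div_le_one hs]; exact h

theorem posLog_norm_sub_le {M : ℝ} {v u : ℂ} (hv : ‖v‖ ≤ M) :
    max 0 (Real.log ‖v - u‖) ≤ Real.log (1 + M) + truncLog 1 u := by
  have hM : 0 ≤ M := (norm_nonneg v).trans hv
  have h1 : 1 ≤ max 1 ‖u‖ := le_max_left _ _
  have h2 : 0 ≤ truncLog 1 u := Real.log_nonneg h1
  have h3 : 0 ≤ Real.log (1 + M) := Real.log_nonneg (by linarith)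
  refine max_le (by linarith) ?_
  rcases eq_or_ne (v - u) 0 with h0 | h0
  · rw [h0, norm_zero, Real.log_zero]; linarith
  · unfold truncLog
    rw [← Real.log_mul (by positivity) (by positivity)]
    refine Real.log_le_log (norm_pos_iff.2 h0) ?_
    have := norm_sub_le v u
    have := le_max_right 1 ‖u‖
    nlinarith

/-- Integrability of the logarithmic kernel along a curve. -/
theorem HasLogMoment.integrable_prod {ν : Measure ℂ} [IsProbabilityMeasure ν]
    (h : HasLogMoment ν) {Θ : Type*} [MeasurableSpace Θ] {μ : Measure Θ} [IsProbabilityMeasure μ]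
    {γ : Θ → ℂ} (hγ : Measurable γ) {M m : ℝ} (hM : ∀ θ, ‖γ θ‖ ≤ M)
    (hi : ∀ᵐ u ∂ν, Integrable (fun θ => Real.log ‖γ θ - u‖) μ)
    (hm : ∀ᵐ u ∂ν, m ≤ ∫ θ, Real.log ‖γ θ - u‖ ∂μ) :
    Integrable (Function.uncurry fun θ u => Real.log ‖γ θ - u‖) (μ.prod ν) := by
  have hmeas : Measurable (Function.uncurry fun θ (u : ℂ) => Real.log ‖γ θ - u‖) :=
    ((hγ.comp measurable_fst).sub measurable_snd).norm.log
  rw [integrable_prod_iff' hmeas.aestronglyMeasurable]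
  refine ⟨hi, ?_⟩
  have hdom : Integrable (fun u => 2 * (Real.log (1 + M) + truncLog 1 u) - m) ν :=
    (((integrable_const _).add h).const_mul 2).sub (integrable_const m)
  refine hdom.mono' ?_ ?_
  · exact (hmeas.aestronglyMeasurable.norm.prod_swap).integral_prod_right'
  · filter_upwards [hi, hm] with u hiu hmu
    rw [Real.norm_eq_abs, abs_of_nonneg (integral_nonneg fun _ => norm_nonneg _)]
    -- Since `|x| = 2 * max 0 x - x` and the positive part has a bound uniform along the curve, a
    -- lower bound for the mean controls the `L¹` norm.
    have h1 : ∫ θ, ‖Real.log ‖γ θ - u‖‖ ∂μ ≤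
        ∫ θ, (2 * (Real.log (1 + M) + truncLog 1 u) - Real.log ‖γ θ - u‖) ∂μ := by
      refine integral_mono hiu.norm ((integrable_const _).sub hiu) fun θ => ?_
      have h2 := posLog_norm_sub_le (u := u) (hM θ)
      have h3 := le_max_left 0 (Real.log ‖γ θ - u‖)
      have h4 := le_max_right 0 (Real.log ‖γ θ - u‖)
      rw [Real.norm_eq_abs]
      apply abs_le.2 ⟨by linarith, ?_⟩
      simp only
      rcases le_total 0 (Real.log ‖γ θ - u‖) with h5 | h5
      · linarith
      · linarith
    rw [integral_sub (integrable_const _) hiu] at h1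
    simp only [Function.uncurry_apply_pair, integral_const, probReal_univ, one_smul] at h1 ⊢
    linarith

theorem HasLogMoment.integrable_circle {ν : Measure ℂ} [IsProbabilityMeasure ν]
    (h : HasLogMoment ν) (x : ℂ) {s : ℝ} (hs : 0 < s) :
    Integrable (Function.uncurry fun θ u => Real.log ‖circleMap x s θ - u‖)
      (angleMeasure.prod ν) := by
  refine h.integrable_prod (M := ‖x‖ + s) (m := Real.log s) (by fun_prop) (fun θ => ?_)
    (ae_of_all _ fun u => ?_) (ae_of_all _ fun u => ?_)
  · refine (norm_add_le _ _).trans ?_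
    simp [abs_of_pos hs]
  · exact (integrable_angleMeasure_iff (f := fun z => Real.log ‖z - u‖)).2
      (circleIntegrable_log_norm_sub_const s)
  · rw [← circleAverage_eq_integral_angleMeasure (fun z => Real.log ‖z - u‖),
      circleAverage_log_norm_sub hs]
    exact log_radius_le_truncLog hs _

/-- The mean of a potential over a circle is a truncated potential. -/
theorem HasLogMoment.circleAverage_logPot {ν : Measure ℂ} [IsProbabilityMeasure ν]
    (h : HasLogMoment ν) (x : ℂ) {s : ℝ} (hs : 0 < s) :
    Real.circleAverage (logPot ν) x s = ∫ u, truncLog s (x - u) ∂ν := by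
  rw [circleAverage_eq_integral_angleMeasure]
  unfold logPot
  rw [integral_integral_swap (h.integrable_circle x hs)]
  refine integral_congr_ae (ae_of_all _ fun u => ?_)
  simp only
  rw [← circleAverage_eq_integral_angleMeasure (fun z => Real.log ‖z - u‖),
    circleAverage_log_norm_sub hs]

/-- This is the bridge from the potential to the measure: circle means of the potential are all that
the uniqueness statements for bumps require. -/
theorem HasLogMoment.integral_bump {ν : Measure ℂ} [IsProbabilityMeasure ν]
    (h : HasLogMoment ν) (x : ℂ) {s : ℝ} (hs : 0 < s) :
    ∫ u, bump s (x - u) ∂ν =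
      Real.circleAverage (logPot ν) x (2 * s) - Real.circleAverage (logPot ν) x s := by
  have h2 : 0 < 2 * s := by positivity
  rw [h.circleAverage_logPot x hs, h.circleAverage_logPot x h2,
    ← integral_sub (h.integrable_truncLog h2 x) (h.integrable_truncLog hs x)]
  rfl

theorem HasLogMoment.circleIntegrable_logPot {ν : Measure ℂ} [IsProbabilityMeasure ν]
    (h : HasLogMoment ν) (x : ℂ) {s : ℝ} (hs : 0 < s) : CircleIntegrable (logPot ν) x s := by
  rw [← integrable_angleMeasure_iff]
  exact (h.integrable_circle x hs).integral_prod_left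

theorem circleAverage_congr_off_finite {f h : ℂ → ℝ} {x : ℂ} {s : ℝ} (hs : 0 < s) {S : Set ℂ}
    (hS : (S ∩ Metric.sphere x s).Finite) (hfh : ∀ z ∉ S, f z = h z) :
    Real.circleAverage f x s = Real.circleAverage h x s := by
  refine Real.circleAverage_congr_codiscreteWithin ?_ hs.ne'
  rw [abs_of_pos hs]
  have h1 : (S ∩ Metric.sphere x s)ᶜ ∈ codiscreteWithin (Metric.sphere x s) :=
    compl_finite_mem_codiscreteWithin hS
  filter_upwards [h1, self_mem_codiscreteWithin (Metric.sphere x s)] with z hz hz'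
  exact hfh z fun hzS => hz ⟨hzS, hz'⟩

/-- Probability measures are determined by their potentials, up to an additive constant and off a
set that meets every circle in finitely many points. -/
theorem measure_eq_of_logPot {ν ν' : Measure ℂ} [IsProbabilityMeasure ν] [IsProbabilityMeasure ν']
    (h : HasLogMoment ν) (h' : HasLogMoment ν') {S : Set ℂ}
    (hS : ∀ (x : ℂ) (s : ℝ), 0 < s → (S ∩ Metric.sphere x s).Finite) {c : ℝ}
    (heq : ∀ z ∉ S, logPot ν z = logPot ν' z + c) : ν = ν' := by
  have key : ∀ (x : ℂ) (s : ℝ), 0 < s →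
      Real.circleAverage (logPot ν) x s = Real.circleAverage (logPot ν') x s + c := by
    intro x s hs
    rw [circleAverage_congr_off_finite hs (hS x s hs) heq]
    rw [Real.circleAverage_fun_add (h'.circleIntegrable_logPot x hs) (circleIntegrable_const c x s),
      Real.circleAverage_const]
  refine measure_eq_of_bumps isOpen_univ measure_univ fun x _ s hs _ => ?_
  rw [h.integral_bump x hs, h'.integral_bump x hs, key x s hs, key x (2 * s) (by positivity)]
  ring

/-! ### Exponential profiles -/

section Profile

variable {a : ℕ → ℕ → ℂ} {g : ℝ → ℝ}

theorem IsRegularProfile.hasDerivAt (hg : IsRegularProfile g) {α : ℝ} (hα : α ∈ Set.Ioo (0 : ℝ) 1) :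
    HasDerivAt g (deriv g α) α :=
  ((hg.smooth.differentiableOn (by simp)).differentiableAt (isOpen_Ioo.mem_nhds hα)).hasDerivAt

theorem IsRegularProfile.contDiffOn_deriv (hg : IsRegularProfile g) :
    ContDiffOn ℝ ((⊤ : ℕ∞) : WithTop ℕ∞) (deriv g) (Set.Ioo 0 1) :=
  hg.smooth.deriv_of_isOpen isOpen_Ioo (by simp)

theorem IsRegularProfile.hasDerivAt_deriv (hg : IsRegularProfile g) {α : ℝ}
    (hα : α ∈ Set.Ioo (0 : ℝ) 1) : HasDerivAt (deriv g) (deriv (deriv g) α) α :=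
  ((hg.contDiffOn_deriv.differentiableOn (by simp)).differentiableAt
    (isOpen_Ioo.mem_nhds hα)).hasDerivAt

theorem IsRegularProfile.strictAntiOn_deriv (hg : IsRegularProfile g) :
    StrictAntiOn (deriv g) (Set.Ioo 0 1) := by
  refine strictAntiOn_of_deriv_neg (convex_Ioo 0 1) hg.contDiffOn_deriv.continuousOn fun α hα => ?_
  rw [interior_Ioo] at hα
  exact hg.deriv2_neg α hα

/-- As `g'` decreases, a bound near `1` suffices, and there the mean value theorem compares `g'`
with the slopes towards `1`, which have a finite limit. -/
theorem exists_le_deriv (ha : IsExponentialProfile a g) (hg : IsRegularProfile g) :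
    ∃ D : ℝ, ∀ α ∈ Set.Ioo (0 : ℝ) 1, D ≤ deriv g α := by
  have h1 := ha.left_deriv_one.hasDerivWithinAt
  set D := derivWithin g (Set.Icc 0 1) 1
  rw [hasDerivWithinAt_iff_tendsto_slope] at h1
  have h2 : ∀ᶠ α in 𝓝[Set.Icc 0 1 \ {1}] (1 : ℝ), D - 1 < slope g 1 α :=
    h1.eventually_const_lt (by linarith)
  have h3 : Set.Icc 0 1 \ {1} ∈ 𝓝[<] (1 : ℝ) := by
    filter_upwards [Ioo_mem_nhdsLT (zero_lt_one (α := ℝ))] with α hα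
    exact ⟨⟨hα.1.le, hα.2.le⟩, hα.2.ne⟩
  have h4 : ∀ᶠ α in 𝓝[<] (1 : ℝ), D - 1 < slope g 1 α :=
    h2.filter_mono (nhdsWithin_le_of_mem h3)
  refine ⟨D - 1, fun α hα => ?_⟩
  obtain ⟨β, hβ1, hβ2⟩ := (h4.and (Ioo_mem_nhdsLT hα.2)).exists
  obtain ⟨c, hc, hc'⟩ := exists_deriv_eq_slope g hβ2.2
    (ha.continuousOn.mono (Set.Icc_subset_Icc (hα.1.trans hβ2.1).le le_rfl))
    (fun x hx => (hg.hasDerivAt ⟨(hα.1.trans hβ2.1).trans hx.1, hx.2⟩).differentiableAt.differentiableWithinAt)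
  have h5 : slope g 1 β = deriv g c := by
    rw [hc', slope_def_field, ← neg_div_neg_eq]; ring_nf
  have h6 := hg.strictAntiOn_deriv hα ⟨(hα.1.trans hβ2.1).trans hc.1, hc.2⟩ (hβ2.1.trans hc.1)
  linarith

/-- The derivative may blow up at `0`. After subtraction of a lower bound it is a nonnegative
derivative of a continuous function, and such a derivative is integrable. -/
theorem intervalIntegrable_deriv (ha : IsExponentialProfile a g) (hg : IsRegularProfile g) :
    IntervalIntegrable (deriv g) volume 0 1 := by
  obtain ⟨D, hD⟩ := exists_le_deriv ha hg
  have h1 : IntegrableOn (fun α => deriv g α - D) (Set.Ioc 0 1) := by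
    refine intervalIntegral.integrableOn_deriv_of_nonneg (g := fun α => g α - D * α)
      (ha.continuousOn.sub (by fun_prop)) (fun α hα => ?_) fun α hα => sub_nonneg.2 (hD α hα)
    have h2 := (hg.hasDerivAt hα).fun_sub ((hasDerivAt_id α).const_mul D)
    simpa using h2
  rw [intervalIntegrable_iff_integrableOn_Ioc_of_le zero_le_one]
  have hc : IntegrableOn (fun _ => D) (Set.Ioc (0 : ℝ) 1) volume :=
    integrableOn_const (by simp) (by simp)
  have h2 := h1.add hc
  refine h2.congr_fun (fun α _ => ?_) measurableSet_Ioc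
  simp

theorem integral_deriv_eq (ha : IsExponentialProfile a g) (hg : IsRegularProfile g) {β : ℝ}
    (hβ : β ∈ Set.Icc (0 : ℝ) 1) : ∫ α in β..1, deriv g α = g 1 - g β := by
  refine intervalIntegral.integral_eq_sub_of_hasDerivAt_of_le hβ.2
    (ha.continuousOn.mono (Set.Icc_subset_Icc hβ.1 le_rfl))
    (fun x hx => hg.hasDerivAt ⟨hβ.1.trans_lt hx.1, hx.2⟩)
    ((intervalIntegrable_deriv ha hg).mono_set ?_)
  rw [Set.uIcc_of_le hβ.2, Set.uIcc_of_le zero_le_one]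
  exact Set.Icc_subset_Icc hβ.1 le_rfl

/-- The rotation invariant potential with profile `g`, normalised at infinity. -/
noncomputable def profilePot (g : ℝ → ℝ) (z : ℂ) : ℝ :=
  ∫ α in (0 : ℝ)..1, max (Real.log ‖z‖) (-deriv g α)

theorem intervalIntegrable_profilePot (ha : IsExponentialProfile a g) (hg : IsRegularProfile g)
    (c : ℝ) : IntervalIntegrable (fun α => max c (-deriv g α)) volume 0 1 := by
  have h1 := (intervalIntegrable_deriv ha hg).neg
  rw [intervalIntegrable_iff_integrableOn_Ioc_of_le zero_le_one] at h1 ⊢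
  exact (integrableOn_const (C := c) (by simp) (by simp)).sup h1

theorem intervalIntegrable_sub {f : ℝ → ℝ} (h : IntervalIntegrable f volume 0 1) {x y : ℝ}
    (hx : 0 ≤ x) (hxy : x ≤ y) (hy : y ≤ 1) : IntervalIntegrable f volume x y := by
  refine h.mono_set ?_
  rw [Set.uIcc_of_le hxy, Set.uIcc_of_le zero_le_one]
  exact Set.Icc_subset_Icc hx hy

/-- Split the integral at `β`, bounding the maximum below by `Real.log ‖z‖` before `β` and by `-g'`
after it. With `exists_eq_profilePot`, this says that `g 1 + profilePot g z` is the Legendre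
transform of `g`, the exponential rate at time zero. -/
theorem le_profilePot (ha : IsExponentialProfile a g) (hg : IsRegularProfile g) {β : ℝ}
    (hβ : β ∈ Set.Icc (0 : ℝ) 1) (z : ℂ) : g β + β * Real.log ‖z‖ ≤ g 1 + profilePot g z := by
  have hi := intervalIntegrable_profilePot ha hg (Real.log ‖z‖)
  have hi1 := intervalIntegrable_sub hi le_rfl hβ.1 hβ.2
  have hi2 := intervalIntegrable_sub hi hβ.1 hβ.2 le_rfl
  have hd2 := (intervalIntegrable_sub (intervalIntegrable_deriv ha hg) hβ.1 hβ.2 le_rfl)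
  unfold profilePot
  rw [← intervalIntegral.integral_add_adjacent_intervals hi1 hi2]
  have h1 : ∫ _ in (0 : ℝ)..β, Real.log ‖z‖ ≤ ∫ α in (0 : ℝ)..β, max (Real.log ‖z‖) (-deriv g α) :=
    intervalIntegral.integral_mono_on hβ.1 intervalIntegrable_const hi1 fun α _ => le_max_left _ _
  have h2 : ∫ α in β..1, -deriv g α ≤ ∫ α in β..1, max (Real.log ‖z‖) (-deriv g α) :=
    intervalIntegral.integral_mono_on hβ.2 hd2.neg hi2 fun α _ => le_max_right _ _
  rw [intervalIntegral.integral_const, sub_zero, smul_eq_mul] at h1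
  rw [intervalIntegral.integral_neg, integral_deriv_eq ha hg hβ] at h2
  linarith

/-- The maximiser is the point at which the increasing function `-g'` crosses `Real.log ‖z‖`; there
both bounds in `le_profilePot` are sharp. -/
theorem exists_eq_profilePot (ha : IsExponentialProfile a g) (hg : IsRegularProfile g) (z : ℂ) :
    ∃ β ∈ Set.Icc (0 : ℝ) 1, g β + β * Real.log ‖z‖ = g 1 + profilePot g z := by
  -- The point `0` is added to cover the case that `-g'` lies above `Real.log ‖z‖` throughout.
  set S : Set ℝ := insert 0 {α | α ∈ Set.Ioo (0 : ℝ) 1 ∧ -deriv g α ≤ Real.log ‖z‖} with hS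
  have hS0 : (0 : ℝ) ∈ S := Set.mem_insert _ _
  have hS1 : ∀ α ∈ S, α ≤ 1 := by
    rintro α (rfl | h)
    · exact zero_le_one
    · exact h.1.2.le
  have hbdd : BddAbove S := ⟨1, hS1⟩
  have hβ : sSup S ∈ Set.Icc (0 : ℝ) 1 := ⟨le_csSup hbdd hS0, csSup_le ⟨0, hS0⟩ hS1⟩
  refine ⟨sSup S, hβ, ?_⟩
  have hi := intervalIntegrable_profilePot ha hg (Real.log ‖z‖)
  have hi1 := intervalIntegrable_sub hi le_rfl hβ.1 hβ.2
  have hi2 := intervalIntegrable_sub hi hβ.1 hβ.2 le_rfl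
  unfold profilePot
  rw [← intervalIntegral.integral_add_adjacent_intervals hi1 hi2]
  have h1 : ∫ α in (0 : ℝ)..sSup S, max (Real.log ‖z‖) (-deriv g α) =
      ∫ _ in (0 : ℝ)..sSup S, Real.log ‖z‖ := by
    rw [intervalIntegral.integral_of_le hβ.1, intervalIntegral.integral_of_le hβ.1,
      integral_Ioc_eq_integral_Ioo, integral_Ioc_eq_integral_Ioo]
    refine setIntegral_congr_fun measurableSet_Ioo fun α hα => ?_
    obtain ⟨α', hα', hlt⟩ := exists_lt_of_lt_csSup ⟨0, hS0⟩ hα.2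
    rcases hα' with rfl | h
    · exact absurd hα.1 (not_lt.2 hlt.le)
    · have := hg.strictAntiOn_deriv ⟨hα.1, hlt.trans h.1.2⟩ h.1 hlt
      exact max_eq_left (by linarith [h.2])
  have h2 : ∫ α in sSup S..1, max (Real.log ‖z‖) (-deriv g α) = ∫ α in sSup S..1, -deriv g α := by
    rw [intervalIntegral.integral_of_le hβ.2, intervalIntegral.integral_of_le hβ.2,
      integral_Ioc_eq_integral_Ioo, integral_Ioc_eq_integral_Ioo]
    refine setIntegral_congr_fun measurableSet_Ioo fun α hα => ?_
    refine max_eq_right ?_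
    by_contra hcon
    have : α ∈ S := Or.inr ⟨⟨hβ.1.trans_lt hα.1, hα.2⟩, (not_le.1 hcon).le⟩
    exact absurd (le_csSup hbdd this) (not_le.2 hα.1)
  rw [h1, h2, intervalIntegral.integral_const, intervalIntegral.integral_neg,
    integral_deriv_eq ha hg hβ, sub_zero, smul_eq_mul]
  ring

theorem profilePot_le_add (ha : IsExponentialProfile a g) (hg : IsRegularProfile g) {z w : ℂ}
    {η : ℝ} (hη : 0 ≤ η) (h : Real.log ‖w‖ ≤ Real.log ‖z‖ + η) :
    profilePot g w ≤ profilePot g z + η := by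
  have hz := intervalIntegrable_profilePot ha hg (Real.log ‖z‖)
  have hw := intervalIntegrable_profilePot ha hg (Real.log ‖w‖)
  have h1 : profilePot g w ≤ ∫ α in (0 : ℝ)..1, (max (Real.log ‖z‖) (-deriv g α) + η) := by
    refine intervalIntegral.integral_mono_on zero_le_one hw (hz.add intervalIntegrable_const)
      fun α _ => ?_
    refine max_le ?_ ?_
    · linarith [le_max_left (Real.log ‖z‖) (-deriv g α)]
    · linarith [le_max_right (Real.log ‖z‖) (-deriv g α)]
  rw [intervalIntegral.integral_add hz intervalIntegrable_const] at h1
  simpa [profilePot] using h1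

theorem norm_coeff_le {n k : ℕ} (hn : 0 < n) {ε : ℝ} (h0 : a n k ≠ 0)
    (h : |(1 / (n : ℝ)) * Real.log ‖a n k‖ - g ((k : ℝ) / n)| ≤ ε) :
    Real.exp (n * (g (k / n) - ε)) ≤ ‖a n k‖ ∧ ‖a n k‖ ≤ Real.exp (n * (g (k / n) + ε)) := by
  have hn' : (0 : ℝ) < n := by exact_mod_cast hn
  have hpos := norm_pos_iff.2 h0
  have h1 : Real.log ‖a n k‖ = n * ((1 / (n : ℝ)) * Real.log ‖a n k‖) := by field_simp
  rw [abs_le] at h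
  constructor
  · rw [← Real.le_log_iff_exp_le hpos, h1]
    exact mul_le_mul_of_nonneg_left (by linarith) hn'.le
  · rw [← Real.log_le_iff_le_exp hpos, h1]
    exact mul_le_mul_of_nonneg_left (by linarith) hn'.le

theorem coeffUpperAt_zero (ha : IsExponentialProfile a g) (hg : IsRegularProfile g) {z : ℂ}
    (hz : z ≠ 0) : CoeffUpperAt a 0 z (g 1 + profilePot g z) := by
  intro η hη
  have hz' := norm_pos_iff.2 hz
  have he : 1 < Real.exp η := Real.one_lt_exp_iff.2 hη
  refine ⟨min (‖z‖ / 2) (‖z‖ * (Real.exp η - 1)), lt_min (by positivity)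
    (mul_pos hz' (by linarith)), fun δ hδ hδ' ε hε => ?_⟩
  have hd1 := hδ'.trans (min_le_left _ _)
  have hd2 := hδ'.trans (min_le_right _ _)
  filter_upwards [ha.growth ε hε, eventually_gt_atTop 0] with n hn hn0 k hk w hw
  have hn' : (0 : ℝ) < n := by exact_mod_cast hn0
  have hw1 : ‖z‖ - δ ≤ ‖w‖ := by
    have := norm_sub_norm_le z w
    rw [norm_sub_rev, hw] at this; linarith
  have hw2 : ‖w‖ ≤ ‖z‖ * Real.exp η := by
    have := norm_sub_norm_le w z
    rw [hw] at this; linarith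
  have hwpos : 0 < ‖w‖ := by linarith
  have hlog : Real.log ‖w‖ ≤ Real.log ‖z‖ + η := by
    rw [← Real.log_exp η, ← Real.log_mul hz'.ne' (Real.exp_pos _).ne']
    exact Real.log_le_log hwpos hw2
  have h1 := profilePot_le_add ha hg hη.le hlog
  have hkn : (k : ℝ) / n ∈ Set.Icc (0 : ℝ) 1 :=
    ⟨by positivity, (div_le_one hn').2 (by exact_mod_cast hk)⟩
  have h2 := le_profilePot ha hg hkn w
  rw [zero_div, heatMonomial_zero_time, norm_mul, norm_pow]
  have h3 : ‖w‖ ^ k = Real.exp (n * ((k / n) * Real.log ‖w‖)) := by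
    rw [← mul_assoc, mul_div_cancel₀ _ hn'.ne', ← Real.log_pow, Real.exp_log (by positivity)]
  calc ‖a n k‖ * ‖w‖ ^ k ≤ Real.exp (n * (g (k / n) + ε)) * ‖w‖ ^ k := by
        gcongr; exact (norm_coeff_le hn0 (hn k hk).1 (hn k hk).2).2
    _ = Real.exp (n * (g (k / n) + k / n * Real.log ‖w‖ + ε)) := by
        rw [h3, ← Real.exp_add]; ring_nf
    _ ≤ _ := by
        refine Real.exp_le_exp.2 (mul_le_mul_of_nonneg_left (by linarith) hn'.le)

theorem coeffLower_zero (ha : IsExponentialProfile a g) (hg : IsRegularProfile g) {z : ℂ}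
    (hz : z ≠ 0) : CoeffLower a 0 z (g 1 + profilePot g z) := by
  intro ε hε
  have hz' := norm_pos_iff.2 hz
  obtain ⟨β, hβ, hβeq⟩ := exists_eq_profilePot ha hg z
  -- Subtracting one makes the index strictly less than `n` even for `β = 1`; the truncation of the
  -- subtraction at `0` does no harm in the limit.
  set κ : ℕ → ℕ := fun n => ⌊β * n⌋₊ - 1 with hκ
  have hκlim : Tendsto (fun n : ℕ => (κ n : ℝ) / n) atTop (𝓝 β) := by
    have h2 : Tendsto (fun n : ℕ => β - 2 / (n : ℝ)) atTop (𝓝 (β - 0)) :=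
      tendsto_const_nhds.sub (tendsto_const_div_atTop_nhds_zero_nat 2)
    rw [sub_zero] at h2
    refine tendsto_of_tendsto_of_tendsto_of_le_of_le' h2 tendsto_const_nhds ?_ ?_
    · filter_upwards [eventually_gt_atTop 0] with n hn
      have hn' : (0 : ℝ) < n := by exact_mod_cast hn
      rw [le_div_iff₀ hn', sub_mul, div_mul_cancel₀ _ hn'.ne']
      have h3 := Nat.lt_floor_add_one (β * n)
      have h4 : (⌊β * n⌋₊ : ℝ) ≤ κ n + 1 := by
        have : ⌊β * n⌋₊ ≤ κ n + 1 := by simp only [hκ]; omega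
        exact_mod_cast this
      linarith
    · filter_upwards [eventually_gt_atTop 0] with n hn
      have hn' : (0 : ℝ) < n := by exact_mod_cast hn
      rw [div_le_iff₀ hn']
      have h3 := Nat.floor_le (mul_nonneg hβ.1 hn'.le)
      have h4 : (κ n : ℝ) ≤ ⌊β * n⌋₊ := by
        have : κ n ≤ ⌊β * n⌋₊ := Nat.sub_le _ _
        exact_mod_cast this
      linarith
  have hκlt : ∀ n : ℕ, 0 < n → κ n < n := by
    intro n hn
    have h3 : ⌊β * n⌋₊ ≤ n := by
      rw [← Nat.floor_natCast (R := ℝ) n]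
      exact Nat.floor_le_floor (by simpa using mul_le_mul_of_nonneg_right hβ.2 (Nat.cast_nonneg (α := ℝ) n))
    simp only [hκ]; omega
  have hκmem : ∀ᶠ n : ℕ in atTop, (κ n : ℝ) / n ∈ Set.Icc (0 : ℝ) 1 := by
    filter_upwards [eventually_gt_atTop 0] with n hn
    have hn' : (0 : ℝ) < n := by exact_mod_cast hn
    exact ⟨by positivity, (div_le_one hn').2 (by exact_mod_cast (hκlt n hn).le)⟩
  have hcont : ContinuousWithinAt (fun x => g x + x * Real.log ‖z‖) (Set.Icc 0 1) β :=
    (ha.continuousOn.add (by fun_prop)) β hβ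
  have hlim : Tendsto (fun n : ℕ => g ((κ n : ℝ) / n) + (κ n : ℝ) / n * Real.log ‖z‖) atTop
      (𝓝 (g β + β * Real.log ‖z‖)) :=
    hcont.tendsto.comp (tendsto_nhdsWithin_iff.2 ⟨hκlim, hκmem⟩)
  rw [hβeq] at hlim
  filter_upwards [hlim.eventually_const_lt (by linarith : g 1 + profilePot g z - ε / 2 < _),
    ha.growth (ε / 2) (by positivity), eventually_gt_atTop 0] with n h1 hn hn0
  refine ⟨κ n, hκlt n hn0, ?_⟩
  have hn' : (0 : ℝ) < n := by exact_mod_cast hn0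
  have hk := hn (κ n) (hκlt n hn0).le
  rw [zero_div, heatMonomial_zero_time, norm_mul, norm_pow]
  have h3 : ‖z‖ ^ κ n = Real.exp (n * ((κ n / n) * Real.log ‖z‖)) := by
    rw [← mul_assoc, mul_div_cancel₀ _ hn'.ne', ← Real.log_pow, Real.exp_log (by positivity)]
  calc Real.exp (n * (g 1 + profilePot g z - ε))
      ≤ Real.exp (n * (g (κ n / n) + κ n / n * Real.log ‖z‖ - ε / 2)) :=
        Real.exp_le_exp.2 (mul_le_mul_of_nonneg_left (by linarith) hn'.le)
    _ = Real.exp (n * (g (κ n / n) - ε / 2)) * ‖z‖ ^ κ n := by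
        rw [h3, ← Real.exp_add]; ring_nf
    _ ≤ _ := by gcongr; exact (norm_coeff_le hn0 hk.1 hk.2).1

end Profile

/-! ### The limit at time zero -/

section TimeZero

variable {a : ℕ → ℕ → ℂ} {g : ℝ → ℝ}

/-- The uniform measure on the parameter rectangle `(0, 1) × (0, 2π]`. -/
noncomputable def paramMeasure : Measure (ℝ × ℝ) :=
  (volume.restrict (Set.Ioo (0 : ℝ) 1)).prod angleMeasure

/-- The parametrisation `(α, θ) ↦ exp (-g' α + i θ)`. -/
noncomputable def profileMap (g : ℝ → ℝ) (p : ℝ × ℝ) : ℂ :=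
  circleMap 0 (Real.exp (-deriv g p.1)) p.2

instance : IsProbabilityMeasure (volume.restrict (Set.Ioo (0 : ℝ) 1)) :=
  ⟨by rw [Measure.restrict_apply_univ, Real.volume_Ioo]; simp⟩

instance : IsProbabilityMeasure paramMeasure := by unfold paramMeasure; infer_instance

theorem measurable_profileMap (g : ℝ → ℝ) : Measurable (profileMap g) := by
  unfold profileMap circleMap
  have h : Measurable fun p : ℝ × ℝ => deriv g p.1 := (measurable_deriv g).comp measurable_fst
  have h2 : Measurable fun p : ℝ × ℝ => Real.exp (-deriv g p.1) := Real.measurable_exp.comp h.neg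
  exact measurable_const.add ((Complex.measurable_ofReal.comp h2).mul (by fun_prop))

theorem norm_profileMap (g : ℝ → ℝ) (p : ℝ × ℝ) : ‖profileMap g p‖ = Real.exp (-deriv g p.1) := by
  simp [profileMap]

/-- The limiting zero distribution at time zero. -/
noncomputable def profileMeasure (g : ℝ → ℝ) : Measure ℂ := paramMeasure.map (profileMap g)

instance (g : ℝ → ℝ) : IsProbabilityMeasure (profileMeasure g) :=
  Measure.isProbabilityMeasure_map (measurable_profileMap g).aemeasurable

theorem ae_paramMeasure : ∀ᵐ p ∂paramMeasure, p.1 ∈ Set.Ioo (0 : ℝ) 1 := by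
  unfold paramMeasure
  exact Measure.quasiMeasurePreserving_fst.ae (ae_restrict_mem measurableSet_Ioo)

theorem hasLogMoment_profileMeasure (ha : IsExponentialProfile a g) (hg : IsRegularProfile g) :
    HasLogMoment (profileMeasure g) := by
  obtain ⟨D, hD⟩ := exists_le_deriv ha hg
  unfold HasLogMoment profileMeasure
  rw [integrable_map_measure (truncLog_continuous one_pos).aestronglyMeasurable
    (measurable_profileMap g).aemeasurable]
  refine Integrable.of_bound (C := |D|) ?_ ?_
  · exact ((truncLog_continuous one_pos).measurable.comp (measurable_profileMap g)).aestronglyMeasurable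
  · filter_upwards [ae_paramMeasure] with p hp
    simp only [Function.comp, truncLog, norm_profileMap]
    rw [Real.norm_eq_abs, abs_of_nonneg (Real.log_nonneg (le_max_left _ _))]
    have h1 : max 1 (Real.exp (-deriv g p.1)) ≤ Real.exp |D| := by
      refine max_le (Real.one_le_exp (abs_nonneg _)) (Real.exp_le_exp.2 ?_)
      linarith [hD _ hp, neg_abs_le D]
    rw [← Real.log_exp |D|]
    exact Real.log_le_log (lt_of_lt_of_le one_pos (le_max_left _ _)) h1

theorem integrable_log_profileMap (g : ℝ → ℝ) (z : ℂ) (α : ℝ) :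
    Integrable (fun θ => Real.log ‖profileMap g (α, θ) - z‖) angleMeasure :=
  (integrable_angleMeasure_iff (f := fun w => Real.log ‖w - z‖) (c := 0)
    (R := Real.exp (-deriv g α))).2 (circleIntegrable_log_norm_sub_const _)

theorem integral_log_profileMap (g : ℝ → ℝ) {z : ℂ} (hz : z ≠ 0) (α : ℝ) :
    ∫ θ, Real.log ‖profileMap g (α, θ) - z‖ ∂angleMeasure =
      max (Real.log ‖z‖) (-deriv g α) := by
  have hz' := norm_pos_iff.2 hz
  have h1 := circleAverage_log_norm_sub (Real.exp_pos (-deriv g α)) 0 z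
  rw [circleAverage_eq_integral_angleMeasure] at h1
  refine Eq.trans ?_ (h1.trans ?_)
  · rfl
  rw [truncLog, zero_sub, norm_neg, max_comm]
  rcases le_total (Real.log ‖z‖) (-deriv g α) with h | h
  · rw [max_eq_right h, max_eq_right, Real.log_exp]
    exact (Real.log_le_iff_le_exp hz').1 h
  · rw [max_eq_left h, max_eq_left]
    exact (Real.le_log_iff_exp_le hz').1 h

theorem integral_abs_log_profileMap_le {g : ℝ → ℝ} {z : ℂ} (hz : z ≠ 0) {α D : ℝ}
    (hD : D ≤ deriv g α) : ∫ θ, ‖Real.log ‖profileMap g (α, θ) - z‖‖ ∂angleMeasure ≤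
      2 * (Real.log (1 + Real.exp (-D)) + truncLog 1 z) - Real.log ‖z‖ := by
  set C := Real.log (1 + Real.exp (-D)) + truncLog 1 z with hC
  have hci := integrable_log_profileMap g z α
  have h1 : ∫ θ, ‖Real.log ‖profileMap g (α, θ) - z‖‖ ∂angleMeasure ≤
      ∫ θ, (2 * C - Real.log ‖profileMap g (α, θ) - z‖) ∂angleMeasure := by
    refine integral_mono hci.norm ((integrable_const _).sub hci) fun θ => ?_
    have hM : ‖profileMap g (α, θ)‖ ≤ Real.exp (-D) := by
      rw [norm_profileMap]; exact Real.exp_le_exp.2 (by simpa using hD)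
    have h2 := posLog_norm_sub_le (u := z) hM
    have h3 := le_max_left 0 (Real.log ‖profileMap g (α, θ) - z‖)
    have h4 := le_max_right 0 (Real.log ‖profileMap g (α, θ) - z‖)
    rw [← hC] at h2
    show ‖Real.log ‖profileMap g (α, θ) - z‖‖ ≤ 2 * C - Real.log ‖profileMap g (α, θ) - z‖
    rw [Real.norm_eq_abs]
    exact abs_le.2 ⟨by linarith, by
      rcases le_total 0 (Real.log ‖profileMap g (α, θ) - z‖) with h5 | h5 <;> linarith⟩
  rw [integral_sub (integrable_const _) hci, integral_log_profileMap g hz α] at h1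
  simp only [integral_const, probReal_univ, one_smul] at h1
  linarith [le_max_left (Real.log ‖z‖) (-deriv g α)]

/-- The mean of `log ‖w - z‖` over the circle `‖w‖ = exp (-g' α)` is the larger of `log ‖z‖` and
`-g' α`; it remains to integrate over `α`. -/
theorem logPot_profileMeasure (ha : IsExponentialProfile a g) (hg : IsRegularProfile g) {z : ℂ}
    (hz : z ≠ 0) : logPot (profileMeasure g) z = profilePot g z := by
  obtain ⟨D, hD⟩ := exists_le_deriv ha hg
  have hmeas : Measurable fun p : ℝ × ℝ => Real.log ‖profileMap g p - z‖ :=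
    ((measurable_profileMap g).sub_const z).norm.log
  have hint : Integrable (fun p : ℝ × ℝ => Real.log ‖profileMap g p - z‖)
      ((volume.restrict (Set.Ioo (0 : ℝ) 1)).prod angleMeasure) := by
    rw [integrable_prod_iff hmeas.aestronglyMeasurable]
    refine ⟨ae_of_all _ (integrable_log_profileMap g z), ?_⟩
    refine Integrable.of_bound
      (C := 2 * (Real.log (1 + Real.exp (-D)) + truncLog 1 z) - Real.log ‖z‖) ?_ ?_
    · exact hmeas.aestronglyMeasurable.norm.integral_prod_right'
    · filter_upwards [ae_restrict_mem measurableSet_Ioo] with α hα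
      rw [Real.norm_eq_abs, abs_of_nonneg (integral_nonneg fun _ => norm_nonneg _)]
      exact integral_abs_log_profileMap_le hz (hD α hα)
  have hm : Measurable fun w : ℂ => Real.log ‖w - z‖ := (measurable_id.sub_const z).norm.log
  unfold logPot profileMeasure profilePot
  simp_rw [norm_sub_rev z]
  rw [integral_map (measurable_profileMap g).aemeasurable hm.aestronglyMeasurable, paramMeasure,
    integral_prod _ hint, intervalIntegral.integral_of_le zero_le_one,
    integral_Ioc_eq_integral_Ioo]
  simp_rw [integral_log_profileMap g hz]

/-- Identification of the limiting zero distribution at time zero. -/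
theorem zeroLimit_zero_eq {Ω : Type*} [MeasurableSpace Ω] {P : Measure Ω} [IsProbabilityMeasure P]
    {ξ : ℕ → Ω → ℂ} (hξ : IsCoefficientNoise P ξ) (ha : IsExponentialProfile a g)
    (hg : IsRegularProfile g) {ν : Measure ℂ} [IsProbabilityMeasure ν]
    (hν : IsZeroLimit P ξ a 0 ν) : ν = profileMeasure g := by
  have hup : ∀ z : ℂ, z ≠ 0 → CoeffUpperAt a 0 z (g 1 + profilePot g z) :=
    fun z hz => coeffUpperAt_zero ha hg hz
  have hlow : ∀ z : ℂ, z ≠ 0 → CoeffLower a 0 z (g 1 + profilePot g z) :=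
    fun z hz => coeffLower_zero ha hg hz
  -- The rates are available only away from the origin, and one point does not affect circle means.
  refine measure_eq_of_logPot (S := {0}) (c := logPot ν 1 - profilePot g 1)
    (potentialLe_of_coeffUpperAt hξ ha hν (hup 1 one_ne_zero)).hasLogMoment
    (hasLogMoment_profileMeasure ha hg) (fun x s _ => (Set.finite_singleton 0).inter_of_left _)
    fun z hz => ?_
  have hz' : z ≠ 0 := hz
  rw [logPot_profileMeasure ha hg hz']
  have := logPot_sub_eq hξ ha hν (hup z hz') (hlow z hz') (hup 1 one_ne_zero) (hlow 1 one_ne_zero)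
  linarith

end TimeZero

/-! ### Real-linear maps of the plane -/

/-- The real-linear map `u ↦ a u + b ū`. -/
noncomputable def conjLin (a b : ℂ) : ℂ →L[ℝ] ℂ :=
  (ContinuousLinearMap.mul ℝ ℂ a) + (ContinuousLinearMap.mul ℝ ℂ b).comp
    (Complex.conjCLE : ℂ →L[ℝ] ℂ)

@[simp] theorem conjLin_apply (a b u : ℂ) : conjLin a b u = a * u + b * (starRingEnd ℂ) u := by
  simp [conjLin]

theorem det_conjLin (a b : ℂ) :
    LinearMap.det (conjLin a b : ℂ →ₗ[ℝ] ℂ) = Complex.normSq a - Complex.normSq b := by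
  rw [← LinearMap.det_toMatrix Complex.basisOneI, Matrix.det_fin_two]
  simp [LinearMap.toMatrix_apply, Complex.normSq_apply]
  ring

/-! ### First order condition for rotations of small disks -/

theorem rotation_preimage_closedBall (c : Circle) (ε : ℝ) :
    (rotation c) ⁻¹' Metric.closedBall (0 : ℂ) ε = Metric.closedBall 0 ε := by
  ext u
  simp only [Set.mem_preimage, mem_closedBall_zero_iff, LinearIsometryEquiv.norm_map]

theorem integral_closedBall_rotate {E : Type*} [NormedAddCommGroup E] [NormedSpace ℝ E]
    (f : ℂ → E) (ε : ℝ) (c : Circle) :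
    ∫ u in Metric.closedBall (0 : ℂ) ε, f (c * u) = ∫ u in Metric.closedBall (0 : ℂ) ε, f u := by
  have h1 := (LinearIsometryEquiv.measurePreserving (rotation c)).setIntegral_preimage_emb
    (rotation c).toHomeomorph.measurableEmbedding f (Metric.closedBall (0 : ℂ) ε)
  rw [← h1, rotation_preimage_closedBall]
  rfl

/-- The quarter turn preserves the disk and changes the sign of `u ^ 2`. -/
theorem integral_closedBall_sq (ε : ℝ) :
    ∫ u in Metric.closedBall (0 : ℂ) ε, u ^ 2 = 0 := by
  have h := integral_closedBall_rotate (fun u : ℂ => u ^ 2) ε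
    (Circle.exp (Real.pi / 2))
  have h2 : ((Circle.exp (Real.pi / 2) : Circle) : ℂ) = Complex.I := by
    rw [Circle.coe_exp]; push_cast; exact Complex.exp_pi_div_two_mul_I
  simp only [h2, mul_pow, Complex.I_sq, neg_one_mul, integral_neg] at h
  exact self_eq_neg.1 h.symm

theorem integral_normSq_closedBall_pos {ε : ℝ} (hε : 0 < ε) :
    0 < ∫ u in Metric.closedBall (0 : ℂ) ε, ‖u‖ ^ 2 := by
  have hint : IntegrableOn (fun u : ℂ => ‖u‖ ^ 2) (Metric.closedBall 0 ε) :=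
    (by fun_prop : Continuous fun u : ℂ => ‖u‖ ^ 2).continuousOn.integrableOn_compact
      (isCompact_closedBall _ _)
  rw [setIntegral_pos_iff_support_of_nonneg_ae (ae_of_all _ fun u => by positivity) hint]
  have h2 : Metric.ball (ε / 2 : ℂ) (ε / 2) ⊆
      Function.support (fun u : ℂ => ‖u‖ ^ 2) ∩ Metric.closedBall 0 ε := by
    intro u hu
    rw [Metric.mem_ball, dist_eq_norm] at hu
    have h3 : ‖(ε / 2 : ℂ)‖ = ε / 2 := by
      rw [norm_div, Complex.norm_real, Real.norm_eq_abs, abs_of_pos hε]; simp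
    constructor
    · rw [Function.mem_support]
      refine pow_ne_zero _ (norm_ne_zero_iff.2 ?_)
      rintro rfl
      rw [zero_sub, norm_neg, h3] at hu
      exact lt_irrefl _ hu
    · rw [mem_closedBall_zero_iff]
      have := norm_sub_norm_le u (ε / 2 : ℂ)
      linarith
  exact lt_of_lt_of_le (Metric.measure_ball_pos _ _ (by positivity)) (measure_mono h2)

/-- In the product of the two linear maps the terms in `u ^ 2` integrate to zero and only those in
`‖u‖ ^ 2` survive. -/
theorem integral_conjLin (a a' b b' η : ℂ) (ε : ℝ) :
    ∫ u in Metric.closedBall (0 : ℂ) ε,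
      ((starRingEnd ℂ) (conjLin a a' u) * conjLin b b' (η * u)).re =
      (((starRingEnd ℂ) a * b + a' * (starRingEnd ℂ) b') * η).re *
        ∫ u in Metric.closedBall (0 : ℂ) ε, ‖u‖ ^ 2 := by
  have hc : ∀ f : ℂ → ℂ, Continuous f → IntegrableOn f (Metric.closedBall 0 ε) := fun f hf =>
    hf.continuousOn.integrableOn_compact (isCompact_closedBall _ _)
  have hr : ∀ f : ℂ → ℝ, Continuous f → IntegrableOn f (Metric.closedBall 0 ε) := fun f hf =>
    hf.continuousOn.integrableOn_compact (isCompact_closedBall _ _)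
  have h1 : ∀ u : ℂ, ((starRingEnd ℂ) (conjLin a a' u) * conjLin b b' (η * u)).re =
      (((starRingEnd ℂ) a * b + a' * (starRingEnd ℂ) b') * η).re * ‖u‖ ^ 2 +
      (((starRingEnd ℂ) a' * b * η + a * (starRingEnd ℂ) b' * η) * u ^ 2).re := by
    intro u
    rw [← Complex.normSq_eq_norm_sq]
    simp only [conjLin_apply, map_add, map_mul, Complex.conj_conj, Complex.add_re, Complex.mul_re,
      Complex.mul_im, Complex.add_im, Complex.conj_re, Complex.conj_im, Complex.normSq_apply, pow_two]
    ring
  simp_rw [h1]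
  rw [integral_add (hr _ (by fun_prop)) (hr _ (by fun_prop)), integral_const_mul]
  have h2 : ∫ u in Metric.closedBall (0 : ℂ) ε,
      (((starRingEnd ℂ) a' * b * η + a * (starRingEnd ℂ) b' * η) * u ^ 2).re = 0 := by
    have h3 := integral_re (μ := volume.restrict (Metric.closedBall (0 : ℂ) ε))
      (f := fun u => ((starRingEnd ℂ) a' * b * η + a * (starRingEnd ℂ) b' * η) * u ^ 2)
      (hc _ (by fun_prop))
    rw [integral_const_mul, integral_closedBall_sq, mul_zero] at h3
    simpa using h3
  rw [h2, add_zero]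

/-- The choice `c = exp (-i arg κ)` gives `‖κ‖ ≤ κ.re`, which forces `κ` to be real. -/
theorem eq_zero_im_of_forall_re_le {κ : ℂ} (h : ∀ c : Circle, (κ * ((c : ℂ) - 1)).re ≤ 0) :
    κ.im = 0 := by
  by_contra hne
  have hκ : κ ≠ 0 := fun h0 => hne (by simp [h0])
  have hpos := norm_pos_iff.2 hκ
  have h1 := h (Circle.ofConjDivSelf κ hκ)
  have h2 := h (Circle.exp (-κ.arg))
  have h3 : κ * ((Circle.exp (-κ.arg) : Circle) : ℂ) = ‖κ‖ := by
    rw [Circle.coe_exp]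
    nth_rewrite 1 [← Complex.norm_mul_exp_arg_mul_I κ]
    rw [mul_assoc, ← Complex.exp_add]
    push_cast
    rw [neg_mul, add_neg_cancel, Complex.exp_zero, mul_one]
  rw [mul_sub, h3, mul_one, Complex.sub_re, Complex.ofReal_re] at h2
  have h4 : ‖κ‖ ^ 2 = κ.re ^ 2 + κ.im ^ 2 := by
    rw [← Complex.normSq_eq_norm_sq, Complex.normSq_apply]; ring
  have h5 : 0 < κ.im ^ 2 := by positivity
  nlinarith

/-- If rotating small disks around `0` does not increase the correlation of `F` and `G`, then the
derivatives of `F` and `G` are compatible. -/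
theorem im_eq_zero_of_rotations {F G : ℂ → ℂ} {a a' b b' : ℂ} {ε₀ : ℝ} (hε₀ : 0 < ε₀)
    (hF : HasFDerivAt F (conjLin a a') 0) (hG : HasFDerivAt G (conjLin b b') 0)
    (hGi : IntegrableOn G (Metric.closedBall 0 ε₀))
    (hFGi : ∀ c : Circle, IntegrableOn (fun u => (starRingEnd ℂ) (F u) * (G (c * u) - G u))
      (Metric.closedBall 0 ε₀))
    (h : ∀ ε : ℝ, 0 < ε → ε ≤ ε₀ → ∀ c : Circle, ∫ u in Metric.closedBall (0 : ℂ) ε,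
      ((starRingEnd ℂ) (F u) * (G (c * u) - G u)).re ≤ 0) :
    ((starRingEnd ℂ) a * b + a' * (starRingEnd ℂ) b').im = 0 := by
  apply eq_zero_im_of_forall_re_le
  intro c
  set κ := (starRingEnd ℂ) a * b + a' * (starRingEnd ℂ) b'
  set C := ‖conjLin a a'‖ + ‖conjLin b b'‖ with hC
  have hA : ∀ u, ‖conjLin a a' u‖ ≤ C * ‖u‖ := fun u =>
    ((conjLin a a').le_opNorm u).trans (mul_le_mul_of_nonneg_right (by simp [hC]) (norm_nonneg _))
  have hB : ∀ u, ‖conjLin b b' u‖ ≤ C * ‖u‖ := fun u =>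
    ((conjLin b b').le_opNorm u).trans (mul_le_mul_of_nonneg_right (by simp [hC]) (norm_nonneg _))
  have hC0 : 0 ≤ C := by positivity
  have key : ∀ τ : ℝ, 0 < τ → τ ≤ 1 → (κ * ((c : ℂ) - 1)).re ≤ τ * (4 * C + 2) := by
    intro τ hτ hτ1
    have hF' := (hasFDerivAt_iff_isLittleO_nhds_zero.1 hF).def hτ
    have hG' := (hasFDerivAt_iff_isLittleO_nhds_zero.1 hG).def hτ
    obtain ⟨ε₁, hε₁, hball⟩ := Metric.eventually_nhds_iff.1 (hF'.and hG')
    set ε := min ε₀ (ε₁ / 2) with hεdef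
    have hε : 0 < ε := lt_min hε₀ (by positivity)
    have hεε₀ : ε ≤ ε₀ := min_le_left _ _
    have hεε₁ : ε < ε₁ := (min_le_right _ _).trans_lt (by linarith)
    have hsub : Metric.closedBall (0 : ℂ) ε ⊆ Metric.closedBall 0 ε₀ :=
      Metric.closedBall_subset_closedBall hεε₀
    set D := Metric.closedBall (0 : ℂ) ε with hD
    have hGc : IntegrableOn (fun u => G (c * u)) D := by
      have h1 := (LinearIsometryEquiv.measurePreserving (rotation c)).integrableOn_comp_preimage
        (rotation c).toHomeomorph.measurableEmbedding (f := G) (s := D)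
      rw [hD, rotation_preimage_closedBall] at h1
      exact h1.2 (hGi.mono_set hsub)
    have hGd : IntegrableOn (fun u => G (c * u) - G u) D := hGc.sub (hGi.mono_set hsub)
    -- Because rotation preserves the integral of `G`, a constant may be subtracted from `F`. Both
    -- factors then vanish to first order, and the integral is of the order of the integral of `‖u‖
    -- ^ 2`.
    have hzero : ∫ u in D, (G (c * u) - G u) = 0 := by
      rw [integral_sub hGc (hGi.mono_set hsub), integral_closedBall_rotate, sub_self]
    have hI := h ε hε hεε₀ c
    have hshift : ∫ u in D, ((starRingEnd ℂ) (F u - F 0) * (G (c * u) - G u)).re ≤ 0 := by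
      have h1 : ∀ u, ((starRingEnd ℂ) (F u - F 0) * (G (c * u) - G u)).re =
          ((starRingEnd ℂ) (F u) * (G (c * u) - G u)).re -
            ((starRingEnd ℂ) (F 0) * (G (c * u) - G u)).re := by
        intro u; rw [map_sub, sub_mul, Complex.sub_re]
      simp_rw [h1]
      have h2 : IntegrableOn (fun u => (starRingEnd ℂ) (F 0) * (G (c * u) - G u)) D :=
        hGd.const_mul _
      have h4 : IntegrableOn (fun u => ((starRingEnd ℂ) (F u) * (G (c * u) - G u)).re) D :=
        ((hFGi c).mono_set hsub).re
      have h5 : IntegrableOn (fun u => ((starRingEnd ℂ) (F 0) * (G (c * u) - G u)).re) D := h2.re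
      rw [integral_sub h4 h5]
      have h3 : ∫ u in D, ((starRingEnd ℂ) (F 0) * (G (c * u) - G u)).re = 0 := by
        have := integral_re h2
        rw [integral_const_mul, hzero, mul_zero] at this
        simpa using this
      rw [h3, sub_zero]
      exact hI
    have hpt : ∀ u ∈ D, ((starRingEnd ℂ) (conjLin a a' u) * conjLin b b' (((c : ℂ) - 1) * u)).re -
        ((starRingEnd ℂ) (F u - F 0) * (G (c * u) - G u)).re ≤ τ * (4 * C + 2) * ‖u‖ ^ 2 := by
      intro u hu
      have hu1 : ‖u‖ < ε₁ := (mem_closedBall_zero_iff.1 hu).trans_lt hεε₁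
      have hcu : ‖(c : ℂ) * u‖ = ‖u‖ := by rw [norm_mul, Circle.norm_coe, one_mul]
      obtain ⟨f1, g1⟩ := hball (show dist u 0 < ε₁ by simpa using hu1)
      obtain ⟨-, g2⟩ := hball (show dist ((c : ℂ) * u) 0 < ε₁ by rw [dist_zero_right, hcu]; exact hu1)
      rw [zero_add] at f1 g1 g2
      rw [hcu] at g2
      set A := conjLin a a' u with hAu
      set dF := F u - F 0 with hdF
      set dG := G (c * u) - G u with hdG
      set B := conjLin b b' (((c : ℂ) - 1) * u) with hBu
      have hBeq : B = conjLin b b' (c * u) - conjLin b b' u := by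
        rw [hBu, sub_mul, one_mul, map_sub]
      have hBd : ‖dG - B‖ ≤ 2 * τ * ‖u‖ := by
        have : dG - B = (G (c * u) - G 0 - conjLin b b' (c * u)) - (G u - G 0 - conjLin b b' u) := by
          rw [hBeq, hdG]; ring
        rw [this]
        refine (norm_sub_le _ _).trans ?_
        linarith
      have hBn : ‖B‖ ≤ 2 * C * ‖u‖ := by
        rw [hBeq]
        refine (norm_sub_le _ _).trans ?_
        have h1 := hB (c * u)
        rw [hcu] at h1
        linarith [hB u]
      have hdGn : ‖dG‖ ≤ (2 * C + 2) * ‖u‖ := by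
        have : dG = (dG - B) + B := by ring
        rw [this]
        refine (norm_add_le _ _).trans ?_
        nlinarith [norm_nonneg u]
      -- The two pieces contribute `2 * C * τ` and `τ * (2 * C + 2)` times `‖u‖ ^ 2`, together the
      -- constant `4 * C + 2`.
      have hsplit : (starRingEnd ℂ) A * B - (starRingEnd ℂ) dF * dG =
          -((starRingEnd ℂ) A * (dG - B)) - (starRingEnd ℂ) (dF - A) * dG := by
        have hconj : (starRingEnd ℂ) (dF - A) = (starRingEnd ℂ) dF - (starRingEnd ℂ) A := map_sub _ _ _
        rw [hconj]; ring
      rw [← Complex.sub_re, hsplit]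
      refine (Complex.re_le_norm _).trans ((norm_sub_le _ _).trans ?_)
      rw [norm_neg, norm_mul, norm_mul, Complex.norm_conj, Complex.norm_conj]
      have hu0 := norm_nonneg u
      have e1 : ‖A‖ * ‖dG - B‖ ≤ (C * ‖u‖) * (2 * τ * ‖u‖) :=
        mul_le_mul (hA u) hBd (norm_nonneg _) (by positivity)
      have e2 : ‖dF - A‖ * ‖dG‖ ≤ (τ * ‖u‖) * ((2 * C + 2) * ‖u‖) :=
        mul_le_mul f1 hdGn (norm_nonneg _) (by positivity)
      nlinarith
    have hm := integral_normSq_closedBall_pos hε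
    have hcont : IntegrableOn (fun u : ℂ => ‖u‖ ^ 2) D :=
      (by fun_prop : Continuous fun u : ℂ => ‖u‖ ^ 2).continuousOn.integrableOn_compact
        (isCompact_closedBall _ _)
    have hi1 : IntegrableOn (fun u => ((starRingEnd ℂ) (conjLin a a' u) *
        conjLin b b' (((c : ℂ) - 1) * u)).re) D :=
      (by fun_prop : Continuous fun u => ((starRingEnd ℂ) (conjLin a a' u) *
        conjLin b b' (((c : ℂ) - 1) * u)).re).continuousOn.integrableOn_compact
          (isCompact_closedBall _ _)
    have hi2 : IntegrableOn (fun u => ((starRingEnd ℂ) (F u - F 0) * (G (c * u) - G u)).re) D := by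
      have h1 : IntegrableOn (fun u => (starRingEnd ℂ) (F u - F 0) * (G (c * u) - G u)) D := by
        have h2 := ((hFGi c).mono_set hsub).sub (hGd.const_mul ((starRingEnd ℂ) (F 0)))
        refine h2.congr_fun (fun u _ => ?_) measurableSet_closedBall
        simp only [Pi.sub_apply, map_sub]; ring
      exact h1.re
    have hint := setIntegral_mono_on (hi1.sub hi2) (hcont.const_mul (τ * (4 * C + 2)))
      measurableSet_closedBall hpt
    simp only [Pi.sub_apply] at hint
    rw [integral_sub hi1 hi2, integral_const_mul, integral_conjLin] at hint
    have : (κ * ((c : ℂ) - 1)).re * ∫ u in D, ‖u‖ ^ 2 ≤ τ * (4 * C + 2) * ∫ u in D, ‖u‖ ^ 2 := by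
      linarith
    exact le_of_mul_le_mul_right this hm
  have hlim : Tendsto (fun τ : ℝ => τ * (4 * C + 2)) (𝓝[>] 0) (𝓝 (0 * (4 * C + 2))) :=
    (Continuous.tendsto (by fun_prop) 0).mono_left nhdsWithin_le_nhds
  rw [zero_mul] at hlim
  refine ge_of_tendsto hlim ?_
  filter_upwards [Ioo_mem_nhdsGT one_pos] with τ hτ using key τ hτ.1 hτ.2.le

/-! ### The parametrisation by a rectangle in the plane -/

/-- The parameter rectangle `(0, 1) × (0, 2π]`, as a subset of the complex plane. -/
def paramRect : Set ℂ := {w | w.re ∈ Set.Ioo (0 : ℝ) 1 ∧ w.im ∈ Set.Ioc 0 (2 * Real.pi)}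

theorem measurableSet_paramRect : MeasurableSet paramRect :=
  (Complex.measurable_re measurableSet_Ioo).inter (Complex.measurable_im measurableSet_Ioc)

/-- The parametrisation `α + i θ ↦ exp (-g' α + i θ)`. -/
noncomputable def rectMap (g : ℝ → ℝ) (w : ℂ) : ℂ :=
  Complex.exp ((-deriv g w.re : ℝ) + w.im * Complex.I)

theorem rectMap_eq (g : ℝ → ℝ) (w : ℂ) : rectMap g w = profileMap g (w.re, w.im) := by
  rw [rectMap, profileMap, circleMap, zero_add, Complex.exp_add, Complex.ofReal_exp]

theorem norm_rectMap (g : ℝ → ℝ) (w : ℂ) : ‖rectMap g w‖ = Real.exp (-deriv g w.re) := by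
  rw [rectMap_eq, norm_profileMap]

theorem rectMap_ne_zero (g : ℝ → ℝ) (w : ℂ) : rectMap g w ≠ 0 := Complex.exp_ne_zero _

theorem measurable_rectMap (g : ℝ → ℝ) : Measurable (rectMap g) := by
  have h : rectMap g = profileMap g ∘ Complex.measurableEquivRealProd := by
    ext w; rw [rectMap_eq]; rfl
  rw [h]
  exact (measurable_profileMap g).comp Complex.measurableEquivRealProd.measurable

/-- Lebesgue measure on a planar rectangle is invariant under rotations of small disks, so these are
available as rearrangements of a transport plan. -/
theorem profileMeasure_eq_map (g : ℝ → ℝ) : profileMeasure g =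
    ((ENNReal.ofReal (2 * Real.pi))⁻¹ • volume.restrict paramRect).map (rectMap g) := by
  have h : rectMap g = profileMap g ∘ Complex.measurableEquivRealProd := by
    ext w; rw [rectMap_eq]; rfl
  have h1 : paramMeasure = ((ENNReal.ofReal (2 * Real.pi))⁻¹ •
      volume.restrict paramRect).map Complex.measurableEquivRealProd := by
    have h2 : paramRect = Complex.measurableEquivRealProd ⁻¹'
        (Set.Ioo (0 : ℝ) 1 ×ˢ Set.Ioc 0 (2 * Real.pi)) := by
      ext w; simp [paramRect]
    rw [Measure.map_smul, h2, (Complex.volume_preserving_equiv_real_prod.restrict_preimage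
      (measurableSet_Ioo.prod measurableSet_Ioc)).map_eq, paramMeasure, angleMeasure,
      Measure.prod_smul_right, Measure.prod_restrict, Measure.volume_eq_prod]
  rw [profileMeasure, h1, Measure.map_map (measurable_profileMap g)
    Complex.measurableEquivRealProd.measurable, h]

section

variable {a : ℕ → ℕ → ℂ} {g : ℝ → ℝ}

theorem hasFDerivAt_exponent (hg : IsRegularProfile g) {w : ℂ} (hw : w.re ∈ Set.Ioo (0 : ℝ) 1) :
    HasFDerivAt (fun w : ℂ => ((-deriv g w.re : ℝ) : ℂ) + w.im * Complex.I)
      (conjLin (((-deriv (deriv g) w.re : ℝ) + 1) / 2) (((-deriv (deriv g) w.re : ℝ) - 1) / 2)) w := by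
  have h1 : HasFDerivAt (fun w : ℂ => deriv g w.re) (deriv (deriv g) w.re • Complex.reCLM) w :=
    (hg.hasDerivAt_deriv hw).comp_hasFDerivAt w Complex.reCLM.hasFDerivAt
  have h2 : HasFDerivAt (fun w : ℂ => ((-deriv g w.re : ℝ) : ℂ))
      (Complex.ofRealCLM.comp (-(deriv (deriv g) w.re • Complex.reCLM))) w :=
    Complex.ofRealCLM.hasFDerivAt.comp w h1.fun_neg
  have h3 : HasFDerivAt (fun w : ℂ => (w.im : ℂ)) (Complex.ofRealCLM.comp Complex.imCLM) w :=
    Complex.ofRealCLM.hasFDerivAt.comp w Complex.imCLM.hasFDerivAt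
  have h4 := h2.fun_add (h3.mul_const Complex.I)
  refine h4.congr_fderiv ?_
  ext u
  simp only [conjLin_apply, add_apply, ContinuousLinearMap.comp_apply,
    neg_apply, smul_apply, Complex.ofRealCLM_apply,
    Complex.reCLM_apply, Complex.imCLM_apply, smul_eq_mul]
  apply Complex.ext <;> simp <;> ring

theorem HasFDerivAt.cexp_conjLin {h : ℂ → ℂ} {p q w : ℂ} (hh : HasFDerivAt h (conjLin p q) w) :
    HasFDerivAt (fun w => Complex.exp (h w))
      (conjLin (Complex.exp (h w) * p) (Complex.exp (h w) * q)) w := by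
  have h1 := (Complex.hasDerivAt_exp (h w)).hasFDerivAt.restrictScalars ℝ
  refine (h1.comp w hh).congr_fderiv ?_
  ext u
  simp
  ring

theorem hasFDerivAt_rectMap (hg : IsRegularProfile g) {w : ℂ} (hw : w.re ∈ Set.Ioo (0 : ℝ) 1) :
    HasFDerivAt (rectMap g)
      (conjLin (rectMap g w * (((-deriv (deriv g) w.re : ℝ) + 1) / 2))
        (rectMap g w * (((-deriv (deriv g) w.re : ℝ) - 1) / 2))) w :=
  HasFDerivAt.cexp_conjLin (hasFDerivAt_exponent hg hw)

/-- The transport map in the rectangle parametrisation. -/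
noncomputable def rectTransport (g : ℝ → ℝ) (t w : ℂ) : ℂ :=
  rectMap g w + t * (w.re * (rectMap g w)⁻¹)

theorem hasFDerivAt_rectTransport (hg : IsRegularProfile g) (t : ℂ) {w : ℂ}
    (hw : w.re ∈ Set.Ioo (0 : ℝ) 1) :
    HasFDerivAt (rectTransport g t)
      (conjLin (rectMap g w * (((-deriv (deriv g) w.re : ℝ) + 1) / 2) + t * (rectMap g w)⁻¹ *
          (1 / 2 - w.re * (((-deriv (deriv g) w.re : ℝ) + 1) / 2)))
        (rectMap g w * (((-deriv (deriv g) w.re : ℝ) - 1) / 2) + t * (rectMap g w)⁻¹ *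
          (1 / 2 - w.re * (((-deriv (deriv g) w.re : ℝ) - 1) / 2)))) w := by
  have h1 := hasFDerivAt_rectMap hg hw
  have h2 : HasFDerivAt (fun w => (rectMap g w)⁻¹) _ w :=
    ((hasDerivAt_inv (rectMap_ne_zero g w)).hasFDerivAt.restrictScalars ℝ).comp w h1
  have h3 : HasFDerivAt (fun w : ℂ => (w.re : ℂ)) (Complex.ofRealCLM.comp Complex.reCLM) w :=
    Complex.ofRealCLM.hasFDerivAt.comp w Complex.reCLM.hasFDerivAt
  have h4 := h1.fun_add ((h3.mul h2).const_mul t)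
  refine h4.congr_fderiv ?_
  have hne := rectMap_ne_zero g w
  ext u
  -- The factor `w.re` contributes the real part of the increment, hence the summands `1 / 2` in
  -- both coefficients.
  have hre : (u.re : ℂ) = (u + (starRingEnd ℂ) u) / 2 := Complex.re_eq_add_conj u
  simp only [conjLin_apply, add_apply, ContinuousLinearMap.comp_apply, smul_apply,
    Complex.ofRealCLM_apply, Complex.reCLM_apply, smul_eq_mul, hre,
    ContinuousLinearMap.coe_restrictScalars', ContinuousLinearMap.toSpanSingleton_apply]
  field_simp
  ring

/-! ### The transport map in polar coordinates -/

/-- The derivative of the maximised function is `g' β - g' α`, positive before `α` and negative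
after it. -/
theorem alphaZero_eq (ha : IsExponentialProfile a g) (hg : IsRegularProfile g) {z : ℂ} {α : ℝ}
    (hα : α ∈ Set.Ioo (0 : ℝ) 1) (hz : Real.log ‖z‖ = -deriv g α) : alphaZero g z = α := by
  set h : ℝ → ℝ := fun β => g β + β * Real.log ‖z‖ with hh
  have hc : ContinuousOn h (Set.Icc 0 1) := ha.continuousOn.add (by fun_prop)
  have hd : ∀ β ∈ Set.Ioo (0 : ℝ) 1, deriv h β = deriv g β - deriv g α := by
    intro β hβ
    have := (hg.hasDerivAt hβ).fun_add ((hasDerivAt_id' β).mul_const (Real.log ‖z‖))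
    rw [one_mul] at this
    rw [hh, this.deriv, hz, ← sub_eq_add_neg]
  have hmono : StrictMonoOn h (Set.Icc 0 α) := by
    refine strictMonoOn_of_deriv_pos (convex_Icc 0 α)
      (hc.mono (Set.Icc_subset_Icc le_rfl hα.2.le)) fun β hβ => ?_
    rw [interior_Icc] at hβ
    have hβ' : β ∈ Set.Ioo (0 : ℝ) 1 := ⟨hβ.1, hβ.2.trans hα.2⟩
    rw [hd β hβ']
    exact sub_pos.2 (hg.strictAntiOn_deriv hβ' hα hβ.2)
  have hanti : StrictAntiOn h (Set.Icc α 1) := by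
    refine strictAntiOn_of_deriv_neg (convex_Icc α 1)
      (hc.mono (Set.Icc_subset_Icc hα.1.le le_rfl)) fun β hβ => ?_
    rw [interior_Icc] at hβ
    have hβ' : β ∈ Set.Ioo (0 : ℝ) 1 := ⟨hα.1.trans hβ.1, hβ.2⟩
    rw [hd β hβ']
    exact sub_neg.2 (hg.strictAntiOn_deriv hα hβ' hβ.1)
  have hlt : ∀ β ∈ Set.Icc (0 : ℝ) 1, β ≠ α → h β < h α := by
    intro β hβ hne
    rcases lt_or_gt_of_ne hne with hlt | hgt
    · exact hmono ⟨hβ.1, hlt.le⟩ ⟨hα.1.le, le_rfl⟩ hlt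
    · exact hanti ⟨le_rfl, hα.2.le⟩ ⟨hgt.le, hβ.2⟩ hgt
  have hα' : α ∈ Set.Icc (0 : ℝ) 1 := ⟨hα.1.le, hα.2.le⟩
  have hset : {α : ℝ | α ∈ Set.Icc (0 : ℝ) 1 ∧ IsMaxOn h (Set.Icc 0 1) α} = {α} := by
    ext β
    constructor
    · rintro ⟨hβ, hmax⟩
      by_contra hne
      exact absurd (hmax hα') (not_le.2 (hlt β hβ hne))
    · rintro rfl
      refine ⟨hα', fun γ hγ => ?_⟩
      by_cases hγα : γ = β
      · show h γ ≤ h β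
        rw [hγα]
      · exact (hlt γ hγ hγα).le
  rw [alphaZero, hset, csSup_singleton]

theorem transportMap_rectMap (ha : IsExponentialProfile a g) (hg : IsRegularProfile g) (t : ℂ)
    {w : ℂ} (hw : w.re ∈ Set.Ioo (0 : ℝ) 1) :
    transportMap g t (rectMap g w) = rectTransport g t w := by
  rw [transportMap, alphaZero_eq ha hg hw (by rw [norm_rectMap, Real.log_exp]), rectTransport,
    div_eq_mul_inv]

/-- The displacement of the transport map at a point of modulus `exp (-g' α)` is `‖t‖ * α * exp (g'
α)`, so this makes the transport cost finite. If `g'` is unbounded above it tends to infinity at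
`0`, and the condition `vanishing` takes over there. -/
theorem exists_mul_exp_deriv_le (hg : IsRegularProfile g) :
    ∃ C : ℝ, 0 ≤ C ∧ ∀ α ∈ Set.Ioo (0 : ℝ) 1, α * Real.exp (deriv g α) ≤ C := by
  by_cases hb : ∃ B : ℝ, ∀ α ∈ Set.Ioo (0 : ℝ) 1, deriv g α ≤ B
  · obtain ⟨B, hB⟩ := hb
    refine ⟨Real.exp B, (Real.exp_pos _).le, fun α hα => ?_⟩
    calc α * Real.exp (deriv g α) ≤ 1 * Real.exp B :=
          mul_le_mul hα.2.le (Real.exp_le_exp.2 (hB α hα)) (Real.exp_pos _).le zero_le_one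
      _ = _ := one_mul _
  · push Not at hb
    have htop : Tendsto (deriv g) (𝓝[>] 0) atTop := by
      rw [tendsto_atTop]
      intro B
      obtain ⟨α, hα, hαB⟩ := hb B
      filter_upwards [Ioo_mem_nhdsGT hα.1] with β hβ
      exact (hαB.trans (hg.strictAntiOn_deriv ⟨hβ.1, hβ.2.trans hα.2⟩ hα hβ.2)).le
    have h1 := (hg.vanishing htop).eventually_lt_const (one_pos : (0 : ℝ) < 1)
    obtain ⟨β, hβ, hβ'⟩ := mem_nhdsGT_iff_exists_Ioo_subset.1 h1
    have hβ0 : (0 : ℝ) < β := hβ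
    set c := min β 1 / 2 with hc
    have hm : 0 < min β 1 := lt_min hβ0 one_pos
    have hc0 : 0 < c := by positivity
    have hcβ : c < β := by have := min_le_left β 1; linarith
    have hc1 : c < 1 := by have := min_le_right β 1; linarith
    refine ⟨max 1 (Real.exp (deriv g c)), le_max_of_le_left zero_le_one, fun α hα => ?_⟩
    rcases lt_or_ge α c with h | h
    · exact le_max_of_le_left (le_of_lt (hβ' ⟨hα.1, h.trans hcβ⟩))
    · refine le_max_of_le_right ?_
      have h2 := hg.strictAntiOn_deriv.antitoneOn ⟨hc0, hc1⟩ hα h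
      calc α * Real.exp (deriv g α) ≤ 1 * Real.exp (deriv g c) :=
            mul_le_mul hα.2.le (Real.exp_le_exp.2 h2) (Real.exp_pos _).le zero_le_one
        _ = _ := one_mul _

/-! ### Optimality is tested by rearrangements -/

/-- Keeping the plan off `D` and composing the target with `S` on `D` gives another coupling,
because `S` preserves the measure on `D`. -/
theorem IsOptimalMap.lintegral_le {T F G : ℂ → ℂ} {m ν ν' : Measure ℂ}
    (h : IsOptimalMap T ν ν') (hF : Measurable F) (hG : Measurable G) (hν : ν = m.map F)
    (hTG : ∀ᵐ w ∂m, T (F w) = G w) (hfin : ∫⁻ w, ‖F w - G w‖ₑ ^ 2 ∂m ≠ ∞)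
    {D : Set ℂ} (hD : MeasurableSet D) {S : ℂ → ℂ}
    (hS : MeasurePreserving S (m.restrict D) (m.restrict D)) :
    ∫⁻ w in D, ‖F w - G w‖ₑ ^ 2 ∂m ≤ ∫⁻ w in D, ‖F w - G (S w)‖ₑ ^ 2 ∂m := by
  obtain ⟨hT, hcoup, hopt⟩ := h
  have hq0 : ν.map (fun z => (z, T z)) = m.map fun w => (F w, G w) := by
    subst hν
    have hpair : AEMeasurable (fun z => (z, T z)) (m.map F) := aemeasurable_id.prodMk hT
    rw [AEMeasurable.map_map_of_aemeasurable hpair hF.aemeasurable]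
    refine Measure.map_congr ?_
    filter_upwards [hTG] with w hw
    simp [hw]
  rw [hq0] at hcoup hopt
  have hν' : ν' = m.map G := by
    rw [← hcoup.2, Measure.map_map measurable_snd (hF.prodMk hG)]; rfl
  have hsplit : m.restrict Dᶜ + m.restrict D = m := Measure.restrict_compl_add_restrict hD
  set q := (m.restrict Dᶜ).map (fun w => (F w, G w)) +
    (m.restrict D).map (fun w => (F w, G (S w))) with hq
  have hGS : Measurable fun w => G (S w) := hG.comp hS.measurable
  have hqc : q ∈ couplings ν ν' := by
    constructor
    · rw [hq, Measure.map_add _ _ measurable_fst, Measure.map_map measurable_fst (hF.prodMk hG),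
        Measure.map_map measurable_fst (hF.prodMk hGS), hν]
      conv_rhs => rw [← hsplit, Measure.map_add _ _ hF]
      rfl
    · rw [hq, Measure.map_add _ _ measurable_snd, Measure.map_map measurable_snd (hF.prodMk hG),
        Measure.map_map measurable_snd (hF.prodMk hGS), hν']
      conv_rhs => rw [← hsplit, Measure.map_add _ _ hG]
      congr 1
      conv_rhs => rw [← hS.map_eq]
      rw [Measure.map_map hG hS.measurable]
      rfl
  have hcost := hopt q hqc
  have hm : Measurable fun p : ℂ × ℂ => ‖p.1 - p.2‖ₑ ^ 2 := by fun_prop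
  unfold transportCost at hcost
  rw [hq, lintegral_add_measure, lintegral_map hm (hF.prodMk hG), lintegral_map hm (hF.prodMk hG),
    lintegral_map hm (hF.prodMk hGS)] at hcost
  simp only at hcost
  have hsum : ∫⁻ w, ‖F w - G w‖ₑ ^ 2 ∂m = ∫⁻ w in Dᶜ, ‖F w - G w‖ₑ ^ 2 ∂m +
      ∫⁻ w in D, ‖F w - G w‖ₑ ^ 2 ∂m := by
    rw [← lintegral_add_measure, hsplit]
  rw [hsum] at hcost hfin
  -- Finiteness of the total cost allows the common part off `D` to be cancelled.
  exact (ENNReal.add_le_add_iff_left (ENNReal.add_ne_top.1 hfin).1).1 hcost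

end

/-! ### An optimal transport map forces `g'' α = - 1 / (2 α)` -/

theorem norm_sub_sq_eq_re (x y : ℂ) :
    ‖x - y‖ ^ 2 = ‖x‖ ^ 2 + ‖y‖ ^ 2 - 2 * ((starRingEnd ℂ) x * y).re := by
  simp only [← Complex.normSq_eq_norm_sq, Complex.normSq_apply]
  simp
  ring

/-- If `F → G` cannot be improved by rotating the target on a ball, then the linear term in the
expansion of the quadratic cost is nonpositive. -/
theorem integral_re_nonpos_of_lintegral_le {F G : ℂ → ℂ} {ε : ℝ}
    (hF : ContinuousOn F (Metric.closedBall 0 ε)) (hG : ContinuousOn G (Metric.closedBall 0 ε))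
    (c : Circle)
    (h : ∫⁻ u in Metric.closedBall (0 : ℂ) ε, ‖F u - G u‖ₑ ^ 2 ≤
      ∫⁻ u in Metric.closedBall (0 : ℂ) ε, ‖F u - G (c * u)‖ₑ ^ 2) :
    ∫ u in Metric.closedBall (0 : ℂ) ε,
      ((starRingEnd ℂ) (F u) * (G (c * u) - G u)).re ≤ 0 := by
  set D := Metric.closedBall (0 : ℂ) ε with hD
  have hDc : IsCompact D := isCompact_closedBall _ _
  have hmaps : Set.MapsTo (fun u : ℂ => (c : ℂ) * u) D D := by
    intro u hu
    rw [hD, mem_closedBall_zero_iff] at hu ⊢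
    rwa [norm_mul, Circle.norm_coe, one_mul]
  have hGc : ContinuousOn (fun u => G (c * u)) D :=
    hG.comp (continuous_const.mul continuous_id).continuousOn hmaps
  have hconv : ∀ H : ℂ → ℂ, ContinuousOn H D →
      ∫⁻ u in D, ‖H u‖ₑ ^ 2 = ENNReal.ofReal (∫ u in D, ‖H u‖ ^ 2) := by
    intro H hH
    have hi : IntegrableOn (fun u => ‖H u‖ ^ 2) D := (hH.norm.pow 2).integrableOn_compact hDc
    rw [ofReal_integral_eq_lintegral_ofReal hi (ae_of_all _ fun u => by positivity)]
    refine lintegral_congr fun u => ?_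
    rw [ENNReal.ofReal_pow (norm_nonneg _), ofReal_norm]
  have h1 : ∫⁻ u in D, ‖F u - G u‖ₑ ^ 2 = _ := hconv (fun u => F u - G u) (hF.sub hG)
  have h2 : ∫⁻ u in D, ‖F u - G (c * u)‖ₑ ^ 2 = _ :=
    hconv (fun u => F u - G (c * u)) (hF.sub hGc)
  rw [h1, h2, ENNReal.ofReal_le_ofReal_iff (integral_nonneg fun u => by positivity)] at h
  -- The squares of `F` and of `G` contribute the same to both costs, so only the cross terms are
  -- compared.
  have hrot : ∫ u in D, ‖G (c * u)‖ ^ 2 = ∫ u in D, ‖G u‖ ^ 2 :=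
    integral_closedBall_rotate (fun u => ‖G u‖ ^ 2) ε c
  have i1 : IntegrableOn (fun u => ‖F u - G u‖ ^ 2) D :=
    ((hF.sub hG).norm.pow 2).integrableOn_compact hDc
  have i2 : IntegrableOn (fun u => ‖F u - G (c * u)‖ ^ 2) D :=
    ((hF.sub hGc).norm.pow 2).integrableOn_compact hDc
  have i3 : IntegrableOn (fun u => ‖G u‖ ^ 2) D := (hG.norm.pow 2).integrableOn_compact hDc
  have i4 : IntegrableOn (fun u => ‖G (c * u)‖ ^ 2) D := (hGc.norm.pow 2).integrableOn_compact hDc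
  have heq : ∀ u, ((starRingEnd ℂ) (F u) * (G (c * u) - G u)).re =
      2⁻¹ * ((‖F u - G u‖ ^ 2 - ‖F u - G (c * u)‖ ^ 2) + (‖G (c * u)‖ ^ 2 - ‖G u‖ ^ 2)) := by
    intro u
    rw [norm_sub_sq_eq_re, norm_sub_sq_eq_re, mul_sub, Complex.sub_re]
    ring
  simp_rw [heq]
  have e1 := integral_add (i1.sub i2) (i4.sub i3)
  have e2 := integral_sub i1 i2
  have e3 := integral_sub i4 i3
  simp only [Pi.sub_apply] at e1
  rw [integral_const_mul, e1, e2, e3, hrot]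
  linarith

section

variable {a : ℕ → ℕ → ℂ} {g : ℝ → ℝ}

theorem ae_mem_paramRect_smul (c : ℝ≥0∞) : ∀ᵐ w ∂(c • volume.restrict paramRect),
    w ∈ paramRect :=
  Measure.ae_smul_measure (ae_restrict_mem measurableSet_paramRect) c

theorem measurable_rectTransport (g : ℝ → ℝ) (t : ℂ) : Measurable (rectTransport g t) :=
  (measurable_rectMap g).add (((Complex.measurable_ofReal.comp Complex.measurable_re).mul
    (measurable_rectMap g).inv).const_mul t)

theorem rectCost_ne_top (hg : IsRegularProfile g) (t : ℂ) :
    ∫⁻ w, ‖rectMap g w - rectTransport g t w‖ₑ ^ 2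
      ∂((ENNReal.ofReal (2 * Real.pi))⁻¹ • volume.restrict paramRect) ≠ ∞ := by
  obtain ⟨C, hC, hb⟩ := exists_mul_exp_deriv_le hg
  set m := (ENNReal.ofReal (2 * Real.pi))⁻¹ • volume.restrict paramRect
  have hm : m Set.univ ≠ ∞ := by
    have h1 : (m.map (rectMap g)) Set.univ = 1 := by
      rw [← profileMeasure_eq_map]; exact measure_univ
    rw [Measure.map_apply (measurable_rectMap g) MeasurableSet.univ, Set.preimage_univ] at h1
    rw [h1]; exact ENNReal.one_ne_top
  have hle : ∫⁻ w, ‖rectMap g w - rectTransport g t w‖ₑ ^ 2 ∂m ≤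
      ∫⁻ _, ENNReal.ofReal ((‖t‖ * C) ^ 2) ∂m := by
    refine lintegral_mono_ae ?_
    filter_upwards [ae_mem_paramRect_smul _] with w hw
    rw [← ofReal_norm, ← ENNReal.ofReal_pow (norm_nonneg _)]
    refine ENNReal.ofReal_le_ofReal (pow_le_pow_left₀ (norm_nonneg _) ?_ 2)
    rw [rectTransport, sub_add_cancel_left, norm_neg, norm_mul, norm_mul, norm_inv, norm_rectMap,
      ← Real.exp_neg, neg_neg, Complex.norm_real, Real.norm_of_nonneg hw.1.1.le]
    exact mul_le_mul_of_nonneg_left (hb _ hw.1) (norm_nonneg _)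
  refine ne_top_of_le_ne_top ?_ hle
  rw [lintegral_const]
  exact ENNReal.mul_ne_top ENNReal.ofReal_ne_top hm

theorem measurePreserving_rotate_closedBall (p : ℂ) (ε : ℝ) (c : Circle) :
    MeasurePreserving (fun w => p + c * (w - p)) (volume.restrict (Metric.closedBall p ε))
      (volume.restrict (Metric.closedBall p ε)) := by
  have h1 : MeasurePreserving (fun w : ℂ => w - p) := measurePreserving_sub_right volume p
  have h2 : MeasurePreserving (fun w : ℂ => (c : ℂ) * w) :=
    LinearIsometryEquiv.measurePreserving (rotation c)
  have h3 : MeasurePreserving (fun w : ℂ => p + w) := measurePreserving_add_left volume p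
  have h4 := ((h3.comp h2).comp h1).restrict_preimage
    (measurableSet_closedBall (x := p) (ε := ε))
  have hset : ((fun w : ℂ => p + w) ∘ (fun w : ℂ => (c : ℂ) * w)) ∘ (fun w : ℂ => w - p) ⁻¹'
      Metric.closedBall p ε = Metric.closedBall p ε := by
    ext w
    have hc : ‖(c : ℂ)‖ = 1 := Circle.norm_coe c
    simp [dist_eq_norm, hc]
  rw [hset] at h4
  exact h4

theorem setLIntegral_closedBall_translate (f : ℂ → ℝ≥0∞) (p : ℂ) (ε : ℝ) :
    ∫⁻ w in Metric.closedBall p ε, f w = ∫⁻ u in Metric.closedBall (0 : ℂ) ε, f (p + u) := by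
  have h := (measurePreserving_add_left volume p).setLIntegral_comp_preimage_emb
    (measurableEmbedding_addLeft p) f (Metric.closedBall p ε)
  rw [← h]
  congr 2
  ext w
  simp

/-- Rotations of small disks around a parameter point `α + i θ` make a bilinear expression in the
derivatives of `rectMap` and `rectTransport` real. Its imaginary part factors as `Im (t exp (-2 i
θ)) * (1 / 2 + α g'' α)`. -/
theorem deriv2_of_isOptimalMap (ha : IsExponentialProfile a g) (hg : IsRegularProfile g) {t : ℂ}
    (ht : t ≠ 0) {ν' : Measure ℂ} (h : IsOptimalMap (transportMap g t) (profileMeasure g) ν')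
    {α : ℝ} (hα : α ∈ Set.Ioo (0 : ℝ) 1) : α * deriv (deriv g) α = -(1 / 2) := by
  set m := (ENNReal.ofReal (2 * Real.pi))⁻¹ • volume.restrict paramRect with hm
  have hc0 : (ENNReal.ofReal (2 * Real.pi))⁻¹ ≠ 0 := ENNReal.inv_ne_zero.2 ENNReal.ofReal_ne_top
  have hc1 : (ENNReal.ofReal (2 * Real.pi))⁻¹ ≠ ∞ :=
    ENNReal.inv_ne_top.2 (by simp [Real.pi_pos])
  have hTG : ∀ᵐ w ∂m, transportMap g t (rectMap g w) = rectTransport g t w := by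
    filter_upwards [ae_mem_paramRect_smul _] with w hw
    exact transportMap_rectMap ha hg t hw.1
  -- The angle only has to make the first factor nonzero: `π / 4` if `t` is real, and `π` otherwise.
  obtain ⟨θ, hθ, hθt⟩ : ∃ θ ∈ Set.Ioo 0 (2 * Real.pi),
      (t * Complex.exp (-(2 * θ) * Complex.I)).im ≠ 0 := by
    have hpi := Real.pi_pos
    by_cases him : t.im = 0
    · refine ⟨Real.pi / 4, ⟨by positivity, by linarith⟩, ?_⟩
      have : (-(2 * ((Real.pi / 4 : ℝ) : ℂ)) * Complex.I) = -((Real.pi / 2 : ℂ) * Complex.I) := by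
        push_cast; ring
      rw [this, Complex.exp_neg, Complex.exp_pi_div_two_mul_I]
      have : t.re ≠ 0 := fun h0 => ht (Complex.ext h0 him)
      simpa using this
    · refine ⟨Real.pi, ⟨hpi, by linarith⟩, ?_⟩
      have : (-(2 * (Real.pi : ℂ)) * Complex.I) = -(2 * Real.pi * Complex.I) := by ring
      rw [this, Complex.exp_neg, Complex.exp_two_pi_mul_I]
      simpa using him
  set p : ℂ := ⟨α, θ⟩ with hp
  have hopen : IsOpen {w : ℂ | w.re ∈ Set.Ioo (0 : ℝ) 1 ∧ w.im ∈ Set.Ioo 0 (2 * Real.pi)} :=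
    (isOpen_Ioo.preimage Complex.continuous_re).inter (isOpen_Ioo.preimage Complex.continuous_im)
  obtain ⟨ε₀, hε₀, hball⟩ := Metric.nhds_basis_closedBall.mem_iff.1
    (hopen.mem_nhds (show p ∈ _ from ⟨hα, hθ⟩))
  have hre : ∀ u ∈ Metric.closedBall (0 : ℂ) ε₀, (p + u).re ∈ Set.Ioo (0 : ℝ) 1 := by
    intro u hu
    refine (hball ?_).1
    simpa [dist_eq_norm] using hu
  set F : ℂ → ℂ := fun u => rectMap g (p + u) with hF
  set G : ℂ → ℂ := fun u => rectTransport g t (p + u) with hG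
  have hFc : ContinuousOn F (Metric.closedBall 0 ε₀) := fun u hu =>
    ((hasFDerivAt_rectMap hg (hre u hu)).continuousAt.comp
      (f := fun u => p + u) (by fun_prop)).continuousWithinAt
  have hGc : ContinuousOn G (Metric.closedBall 0 ε₀) := fun u hu =>
    ((hasFDerivAt_rectTransport hg t (hre u hu)).continuousAt.comp
      (f := fun u => p + u) (by fun_prop)).continuousWithinAt
  have hpre : p.re ∈ Set.Ioo (0 : ℝ) 1 := hα
  have hshift : HasFDerivAt (fun u : ℂ => p + u) (ContinuousLinearMap.id ℝ ℂ) 0 :=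
    (hasFDerivAt_id _).const_add p
  have hp0 : p = p + 0 := (add_zero p).symm
  have hcomp : ∀ {H : ℂ → ℂ} {A : ℂ →L[ℝ] ℂ}, HasFDerivAt H A p →
      HasFDerivAt (fun u => H (p + u)) A 0 := by
    intro H A hA
    rw [hp0] at hA
    have h2 := hA.comp (0 : ℂ) hshift
    rwa [ContinuousLinearMap.comp_id] at h2
  have hFd := hcomp (hasFDerivAt_rectMap hg hpre)
  have hGd := hcomp (hasFDerivAt_rectTransport hg t hpre)
  have hkey := im_eq_zero_of_rotations hε₀ hFd hGd
    (hGc.integrableOn_compact (isCompact_closedBall _ _)) (fun c => ?_) (fun ε hε hεε₀ c => ?_)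
  · have hexp : (starRingEnd ℂ) (rectMap g p) * (t * (rectMap g p)⁻¹) =
        t * Complex.exp (-(2 * θ) * Complex.I) := by
      have h1 : (starRingEnd ℂ) (rectMap g p) =
          Complex.exp ((-deriv g α : ℝ) - θ * Complex.I) := by
        rw [rectMap, ← Complex.exp_conj]
        simp [hp, sub_eq_add_neg]
      rw [h1, rectMap, ← Complex.exp_neg, mul_left_comm, ← Complex.exp_add]
      congr 2
      simp only [hp]; ring
    set f := rectMap g p
    set d := deriv (deriv g) p.re with hd
    have hq : ∀ x : ℂ, (x * (starRingEnd ℂ) x).im = 0 := fun x => by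
      rw [Complex.mul_conj]; exact Complex.ofReal_im _
    set s := t * f⁻¹ with hs
    -- With `p = (-d + 1) / 2` and `q = (-d - 1) / 2`, the last two terms are conjugate up to real
    -- coefficients, whose difference is `(p - q) / 2 - α (p ^ 2 - q ^ 2) = 1 / 2 + α d`.
    have hre : (starRingEnd ℂ) (f * (((-d : ℝ) + 1) / 2)) *
          (f * (((-d : ℝ) + 1) / 2) + s * (1 / 2 - p.re * (((-d : ℝ) + 1) / 2))) +
        (f * (((-d : ℝ) - 1) / 2)) * (starRingEnd ℂ)
          (f * (((-d : ℝ) - 1) / 2) + s * (1 / 2 - p.re * (((-d : ℝ) - 1) / 2))) =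
        ((((-d + 1) / 2) ^ 2 + ((-d - 1) / 2) ^ 2 : ℝ) : ℂ) * (f * (starRingEnd ℂ) f) +
        (((-d + 1) / 2 * (1 / 2 - p.re * ((-d + 1) / 2)) : ℝ) : ℂ) * ((starRingEnd ℂ) f * s) +
        (((-d - 1) / 2 * (1 / 2 - p.re * ((-d - 1) / 2)) : ℝ) : ℂ) *
          (starRingEnd ℂ) ((starRingEnd ℂ) f * s) := by
      simp only [map_mul, map_add, map_sub, map_div₀, map_one, Complex.conj_ofReal, map_ofNat,
        Complex.conj_conj]
      push_cast
      ring
    rw [hre, Complex.add_im, Complex.add_im, Complex.im_ofReal_mul, Complex.im_ofReal_mul,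
      Complex.im_ofReal_mul, Complex.conj_im, hq, hexp] at hkey
    have h1 : ((t * Complex.exp (-(2 * θ) * Complex.I)).im) * (1 / 2 + α * d) = 0 := by
      have h2 : p.re = α := rfl
      rw [h2] at hkey
      linear_combination hkey
    rcases mul_eq_zero.1 h1 with h2 | h2
    · exact absurd h2 hθt
    · have h3 : α * d = -(1 / 2) := by linarith
      exact h3
  · have hmaps : Set.MapsTo (fun u : ℂ => (c : ℂ) * u) (Metric.closedBall 0 ε₀)
        (Metric.closedBall 0 ε₀) := by
      intro u hu
      rw [mem_closedBall_zero_iff] at hu ⊢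
      rwa [norm_mul, Circle.norm_coe, one_mul]
    exact ((Complex.continuous_conj.comp_continuousOn hFc).mul ((hGc.comp
      (continuous_const.mul continuous_id).continuousOn hmaps).sub hGc)).integrableOn_compact
      (isCompact_closedBall _ _)
  · have hsub : Metric.closedBall (0 : ℂ) ε ⊆ Metric.closedBall 0 ε₀ :=
      Metric.closedBall_subset_closedBall hεε₀
    refine integral_re_nonpos_of_lintegral_le (hFc.mono hsub) (hGc.mono hsub) c ?_
    have hDsub : Metric.closedBall p ε ⊆ paramRect := fun w hw => by
      have h1 := hball (Metric.closedBall_subset_closedBall hεε₀ hw)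
      exact ⟨h1.1, h1.2.1, h1.2.2.le⟩
    have hmD : m.restrict (Metric.closedBall p ε) =
        (ENNReal.ofReal (2 * Real.pi))⁻¹ • volume.restrict (Metric.closedBall p ε) := by
      rw [hm, Measure.restrict_smul, Measure.restrict_restrict measurableSet_closedBall,
        Set.inter_eq_left.2 hDsub]
    have hrot := (measurePreserving_rotate_closedBall p ε c).smul_measure
      (ENNReal.ofReal (2 * Real.pi))⁻¹
    rw [← hmD] at hrot
    have h1 := h.lintegral_le (measurable_rectMap g) (measurable_rectTransport g t)
      (profileMeasure_eq_map g) hTG (rectCost_ne_top hg t) measurableSet_closedBall hrot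
    rw [hmD, lintegral_smul_measure, lintegral_smul_measure, smul_eq_mul, smul_eq_mul,
      ENNReal.mul_le_mul_iff_right hc0 hc1, setLIntegral_closedBall_translate,
      setLIntegral_closedBall_translate _ p] at h1
    simpa only [add_sub_cancel_left] using h1

end

/-! ### Profiles of the uniform distribution on a disk -/

/-- The derivative of the profile is the one for which the limiting zeros at time zero are uniformly
distributed on the disk of radius `r`. -/
def IsDiskProfile (g : ℝ → ℝ) (r : ℝ) : Prop :=
  ∀ α ∈ Set.Ioo (0 : ℝ) 1, deriv g α = -Real.log r - Real.log α / 2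

section

variable {a : ℕ → ℕ → ℂ} {g : ℝ → ℝ} {r : ℝ}

theorem exists_isDiskProfile (hg : IsRegularProfile g)
    (h : ∀ α ∈ Set.Ioo (0 : ℝ) 1, α * deriv (deriv g) α = -(1 / 2)) :
    ∃ r : ℝ, 0 < r ∧ IsDiskProfile g r := by
  have hd : ∀ α ∈ Set.Ioo (0 : ℝ) 1, HasDerivAt (fun α => deriv g α + Real.log α / 2) 0 α := by
    intro α hα
    have h1 := (hg.hasDerivAt_deriv hα).fun_add ((Real.hasDerivAt_log hα.1.ne').div_const 2)
    have h2 : deriv (deriv g) α + α⁻¹ / 2 = 0 := by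
      have hne := hα.1.ne'
      have := h α hα
      field_simp
      linarith
    rwa [h2] at h1
  obtain ⟨K, hK⟩ := isOpen_Ioo.exists_is_const_of_deriv_eq_zero isPreconnected_Ioo
    (fun α hα => (hd α hα).differentiableAt.differentiableWithinAt) (fun α hα => (hd α hα).deriv)
  refine ⟨Real.exp (-K), Real.exp_pos _, fun α hα => ?_⟩
  rw [Real.log_exp, ← hK α hα]
  ring

theorem IsDiskProfile.exp_neg_deriv (h : IsDiskProfile g r) (hr : 0 < r) {α : ℝ}
    (hα : α ∈ Set.Ioo (0 : ℝ) 1) : Real.exp (-deriv g α) = r * √α := by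
  rw [h α hα, Real.sqrt_eq_rpow, Real.rpow_def_of_pos hα.1, ← Real.exp_log hr, ← Real.exp_add,
    Real.log_exp]
  congr 1
  ring

theorem IsDiskProfile.deriv2 (h : IsDiskProfile g r) {α : ℝ} (hα : α ∈ Set.Ioo (0 : ℝ) 1) :
    deriv (deriv g) α = -(2 * α)⁻¹ := by
  have h1 : deriv g =ᶠ[𝓝 α] fun α => -Real.log r - Real.log α / 2 := by
    filter_upwards [isOpen_Ioo.mem_nhds hα] with β hβ using h β hβ
  rw [h1.deriv_eq, (((Real.hasDerivAt_log hα.1.ne').div_const 2).const_sub _).deriv, mul_inv]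
  ring

/-- For a disk profile the quotient defining `tSing` is `r ^ 2` at every `α`, so one value of `α`
suffices. -/
theorem IsDiskProfile.tSing_le (h : IsDiskProfile g r) (hr : 0 < r) :
    tSing g ≤ ENNReal.ofReal (r ^ 2) := by
  have hα : (1 / 2 : ℝ) ∈ Set.Ioo (0 : ℝ) 1 := by constructor <;> norm_num
  refine (iInf₂_le (1 / 2 : ℝ) hα).trans ?_
  have h1 : Real.exp (-2 * deriv g (1 / 2)) = r ^ 2 * (1 / 2) := by
    have h2 := h.exp_neg_deriv hr hα
    have h3 : -2 * deriv g (1 / 2) = -deriv g (1 / 2) + -deriv g (1 / 2) := by ring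
    rw [h3, Real.exp_add, h2]
    have := Real.mul_self_sqrt (show (0 : ℝ) ≤ 1 / 2 by norm_num)
    linear_combination r ^ 2 * this
  rw [h.deriv2 hα, h1, ← ENNReal.ofReal_div_of_pos (by norm_num)]
  refine ENNReal.ofReal_le_ofReal (le_of_eq ?_)
  have h3 : |-(2 * (1 / 2 : ℝ))⁻¹ * (r ^ 2 * (1 / 2))| = r ^ 2 / 2 := by
    rw [show -(2 * (1 / 2 : ℝ))⁻¹ * (r ^ 2 * (1 / 2)) = -(r ^ 2 / 2) by norm_num; ring, abs_neg,
      abs_of_nonneg (by positivity)]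
  rw [h3]
  ring

/-- Integration of the derivative, by the mean value theorem on `[0, β]`. Continuity reaches the
endpoints, where the convention `Real.log 0 = 0` gives `β log β` its correct value at `0`. -/
theorem IsDiskProfile.eq_add (h : IsDiskProfile g r) (ha : IsExponentialProfile a g)
    (hg : IsRegularProfile g) {β : ℝ} (hβ : β ∈ Set.Icc (0 : ℝ) 1) :
    g β = g 0 - β * Real.log r - (β * Real.log β - β) / 2 := by
  set f : ℝ → ℝ := fun β => g β + β * Real.log r + (β * Real.log β - β) / 2 with hf
  have hfc : ContinuousOn f (Set.Icc 0 1) := by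
    have h1 : Continuous fun β : ℝ => β * Real.log r + (β * Real.log β - β) / 2 :=
      (continuous_id.mul continuous_const).add
        ((Real.continuous_mul_log.sub continuous_id).div_const 2)
    have h2 := ha.continuousOn.add h1.continuousOn
    refine h2.congr fun x _ => ?_
    simp only [hf, Pi.add_apply]; ring
  have hfd : ∀ x ∈ Set.Ioo (0 : ℝ) 1, HasDerivAt f 0 x := by
    intro x hx
    have h1 := ((hg.hasDerivAt hx).fun_add ((hasDerivAt_id' x).mul_const (Real.log r))).fun_add
      (((Real.hasDerivAt_mul_log hx.1.ne').fun_sub (hasDerivAt_id' x)).div_const 2)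
    rw [h x hx] at h1
    exact h1.congr_deriv (by ring)
  rcases hβ.1.eq_or_lt with h0 | h0
  · rw [← h0]; simp
  · obtain ⟨ξ, hξ, hslope⟩ := exists_hasDerivAt_eq_slope f (fun _ => 0) h0
      (hfc.mono (Set.Icc_subset_Icc le_rfl hβ.2)) fun x hx => hfd x ⟨hx.1, hx.2.trans_le hβ.2⟩
    rw [eq_comm, div_eq_zero_iff, or_iff_left (by linarith), sub_eq_zero] at hslope
    simp only [hf] at hslope
    simp at hslope
    linarith

theorem IsDiskProfile.rectMap_eq (h : IsDiskProfile g r) (hr : 0 < r) {w : ℂ} (hw : w ∈ paramRect) :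
    rectMap g w = circleMap 0 (r * √w.re) w.im := by
  rw [HeatFlowZeros.rectMap_eq, profileMap, h.exp_neg_deriv hr hw.1]

theorem IsDiskProfile.injOn_rectMap (h : IsDiskProfile g r) (hr : 0 < r) :
    Set.InjOn (rectMap g) paramRect := by
  intro w hw v hv hwv
  have h1 : w.re = v.re := by
    have := congrArg norm hwv
    rw [norm_rectMap, norm_rectMap, h.exp_neg_deriv hr hw.1, h.exp_neg_deriv hr hv.1] at this
    exact (Real.sqrt_inj hw.1.1.le hv.1.1.le).1 (mul_left_cancel₀ hr.ne' this)
  refine Complex.ext h1 ?_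
  rw [h.rectMap_eq hr hw, h.rectMap_eq hr hv, ← h1] at hwv
  have hR : r * √w.re ≠ 0 := (mul_pos hr (Real.sqrt_pos.2 hw.1.1)).ne'
  refine injOn_circleMap_of_abs_sub_le (a := 0) (b := 2 * Real.pi) hR ?_ ?_ ?_ hwv
  · rw [zero_sub, abs_neg, abs_of_nonneg Real.two_pi_pos.le]
  · rw [Set.uIoc_of_le Real.two_pi_pos.le]; exact hw.2
  · rw [Set.uIoc_of_le Real.two_pi_pos.le]; exact hv.2

theorem IsDiskProfile.image_rectMap (h : IsDiskProfile g r) (hr : 0 < r) :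
    rectMap g '' paramRect = Metric.ball 0 r \ {0} := by
  ext z
  constructor
  · rintro ⟨w, hw, rfl⟩
    refine ⟨?_, rectMap_ne_zero g w⟩
    rw [mem_ball_zero_iff, norm_rectMap, h.exp_neg_deriv hr hw.1]
    have : √w.re < 1 := by rw [Real.sqrt_lt' one_pos]; simpa using hw.1.2
    nlinarith
  · rintro ⟨hz, hz0⟩
    rw [mem_ball_zero_iff] at hz
    have hz' : 0 < ‖z‖ := norm_pos_iff.2 hz0
    obtain ⟨θ, hθ, hθz⟩ : z ∈ circleMap 0 ‖z‖ '' Set.Ioc 0 (2 * Real.pi) := by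
      rw [image_circleMap_Ioc]; simp
    have hq : ‖z‖ / r < 1 := (div_lt_one hr).2 hz
    have hq0 : 0 < ‖z‖ / r := by positivity
    have hw : (⟨(‖z‖ / r) ^ 2, θ⟩ : ℂ) ∈ paramRect :=
      ⟨⟨by positivity, by show (‖z‖ / r) ^ 2 < 1; nlinarith⟩, hθ⟩
    refine ⟨_, hw, ?_⟩
    rw [h.rectMap_eq hr hw]
    simp only [Real.sqrt_sq hq0.le]
    rw [mul_div_cancel₀ _ hr.ne', hθz]

/-- The Jacobian of `rectMap` is the constant `r ^ 2 / 2`, so the image measure is a multiple of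
Lebesgue measure on the disk, and total mass one fixes the multiple. -/
theorem IsDiskProfile.profileMeasure_eq (h : IsDiskProfile g r) (hg : IsRegularProfile g)
    (hr : 0 < r) : profileMeasure g = uniformDisk r := by
  have h1 := map_withDensity_abs_det_fderiv_eq_addHaar volume
    (measurableSet_paramRect.nullMeasurableSet)
    (fun w hw => (hasFDerivAt_rectMap hg hw.1).hasFDerivWithinAt) (h.injOn_rectMap hr)
  have hdens : (volume.restrict paramRect).withDensity (fun w => ENNReal.ofReal
      |(conjLin (rectMap g w * (((-deriv (deriv g) w.re : ℝ) + 1) / 2))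
        (rectMap g w * (((-deriv (deriv g) w.re : ℝ) - 1) / 2))).det|) =
      ENNReal.ofReal (r ^ 2 / 2) • volume.restrict paramRect := by
    rw [← withDensity_const]
    refine withDensity_congr_ae ?_
    filter_upwards [ae_restrict_mem measurableSet_paramRect] with w hw
    congr 1
    have hdet := det_conjLin (rectMap g w * (((-deriv (deriv g) w.re : ℝ) + 1) / 2))
      (rectMap g w * (((-deriv (deriv g) w.re : ℝ) - 1) / 2))
    have h2 : (((-deriv (deriv g) w.re : ℝ) : ℂ) + 1) / 2 =
        (((-deriv (deriv g) w.re + 1) / 2 : ℝ) : ℂ) := by push_cast; ring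
    have h3 : (((-deriv (deriv g) w.re : ℝ) : ℂ) - 1) / 2 =
        (((-deriv (deriv g) w.re - 1) / 2 : ℝ) : ℂ) := by push_cast; ring
    rw [h2, h3] at hdet ⊢
    rw [ContinuousLinearMap.det, hdet, map_mul, map_mul, Complex.normSq_ofReal,
      Complex.normSq_ofReal, Complex.normSq_eq_norm_sq, norm_rectMap, h.exp_neg_deriv hr hw.1,
      h.deriv2 hw.1, mul_pow, Real.sq_sqrt hw.1.1.le]
    have hne := hw.1.1.ne'
    have : r ^ 2 * w.re * ((- -(2 * w.re)⁻¹ + 1) / 2 * ((- -(2 * w.re)⁻¹ + 1) / 2)) -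
        r ^ 2 * w.re * ((- -(2 * w.re)⁻¹ - 1) / 2 * ((- -(2 * w.re)⁻¹ - 1) / 2)) = r ^ 2 / 2 := by
      field_simp
      ring
    rw [this, abs_of_nonneg (by positivity)]
  rw [hdens, h.image_rectMap hr] at h1
  have hball : volume.restrict (Metric.ball (0 : ℂ) r \ {0}) =
      volume.restrict (Metric.closedBall 0 r) := by
    refine Measure.restrict_congr_set ?_
    refine (sdiff_null_ae_eq_self (measure_singleton 0)).trans ?_
    rw [← Metric.closedBall_sdiff_sphere]
    exact sdiff_null_ae_eq_self (Measure.addHaar_sphere _ _ _)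
  have hc : ENNReal.ofReal (r ^ 2 / 2) ≠ 0 := by simp [hr]
  have hfull : (volume.restrict paramRect).map (rectMap g) =
      (ENNReal.ofReal (r ^ 2 / 2))⁻¹ • volume.restrict (Metric.closedBall 0 r) := by
    rw [← hball, ← h1, Measure.map_smul, smul_smul, ENNReal.inv_mul_cancel hc
      ENNReal.ofReal_ne_top, one_smul]
  have hprof := profileMeasure_eq_map g
  rw [Measure.map_smul, hfull, smul_smul] at hprof
  have huniv : profileMeasure g Set.univ = 1 := measure_univ
  rw [hprof, Measure.smul_apply, Measure.restrict_apply_univ, smul_eq_mul] at huniv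
  rw [hprof, uniformDisk, ProbabilityTheory.cond, ENNReal.eq_inv_of_mul_eq_one_left huniv]

theorem profileMeasure_closedBall (hg : IsRegularProfile g) {α : ℝ} (hα : α ∈ Set.Ioo (0 : ℝ) 1) :
    profileMeasure g (Metric.closedBall 0 (Real.exp (-deriv g α))) = ENNReal.ofReal α := by
  rw [profileMeasure, Measure.map_apply (measurable_profileMap g) measurableSet_closedBall]
  have h1 : profileMap g ⁻¹' Metric.closedBall 0 (Real.exp (-deriv g α)) =ᵐ[paramMeasure]
      Set.Iic α ×ˢ (Set.univ : Set ℝ) := by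
    filter_upwards [ae_paramMeasure] with p hp
    refine propext ?_
    show profileMap g p ∈ Metric.closedBall 0 (Real.exp (-deriv g α)) ↔
      p ∈ Set.Iic α ×ˢ (Set.univ : Set ℝ)
    rw [mem_closedBall_zero_iff, norm_profileMap, Real.exp_le_exp, neg_le_neg_iff,
      hg.strictAntiOn_deriv.le_iff_ge hα hp]
    simp
  rw [measure_congr h1, paramMeasure, Measure.prod_prod, measure_univ, mul_one,
    Measure.restrict_apply measurableSet_Iic]
  have h2 : Set.Iic α ∩ Set.Ioo 0 1 = Set.Ioc 0 α := by
    ext x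
    simp only [Set.mem_inter_iff, Set.mem_Iic, Set.mem_Ioo, Set.mem_Ioc]
    exact ⟨fun h => ⟨h.2.1, h.1⟩, fun h => ⟨h.2, h.1, h.2.trans_lt hα.2⟩⟩
  rw [h2, Real.volume_Ioc, sub_zero]

/-- The disk of radius `ρ = exp (-g' α)` has mass `α` under the profile law and `(ρ / r) ^ 2` under
the uniform law. The case `r ≤ ρ` would give mass one, but `α < 1`. -/
theorem isDiskProfile_of_eq (hg : IsRegularProfile g) (hr : 0 < r)
    (h : profileMeasure g = uniformDisk r) : IsDiskProfile g r := by
  intro α hα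
  have h1 := profileMeasure_closedBall hg hα
  set ρ := Real.exp (-deriv g α) with hρ
  have hρ0 : 0 < ρ := Real.exp_pos _
  rw [h, uniformDisk, ProbabilityTheory.cond_apply measurableSet_closedBall] at h1
  have hvol : ∀ x : ℝ, 0 ≤ x → volume (Metric.closedBall (0 : ℂ) x) =
      ENNReal.ofReal (x ^ 2 * Real.pi) := by
    intro x hx
    rw [Complex.volume_closedBall, ENNReal.ofReal_mul (by positivity), ENNReal.ofReal_pow hx]
    congr 1
    rw [← NNReal.coe_real_pi, ENNReal.ofReal_coe_nnreal]
  have hpi := Real.pi_pos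
  rcases le_or_gt r ρ with hle | hlt
  · rw [Set.inter_eq_left.2 (Metric.closedBall_subset_closedBall hle), ENNReal.inv_mul_cancel
      (by rw [hvol r hr.le]; simp; positivity) (by rw [hvol r hr.le]; exact ENNReal.ofReal_ne_top),
      ← ENNReal.ofReal_one] at h1
    rw [ENNReal.ofReal_eq_ofReal_iff zero_le_one hα.1.le] at h1
    exact absurd h1.symm hα.2.ne
  · rw [Set.inter_eq_right.2 (Metric.closedBall_subset_closedBall hlt.le), hvol r hr.le,
      hvol ρ hρ0.le, ← ENNReal.ofReal_inv_of_pos (by positivity),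
      ← ENNReal.ofReal_mul (by positivity),
      ENNReal.ofReal_eq_ofReal_iff (by positivity) hα.1.le] at h1
    have h2 : α = (ρ / r) ^ 2 := by
      rw [← h1]; field_simp
    have h3 : Real.log ρ = -deriv g α := Real.log_exp _
    have h4 : Real.log α = 2 * (Real.log ρ - Real.log r) := by
      rw [h2, Real.log_pow, Real.log_div hρ0.ne' hr.ne']
      norm_num
    rw [h4, h3]
    ring

end

/-! ### The generating function of the evolved monomials -/

theorem iterate_derivative_X_mul_eq (p : ℂ[X]) (m : ℕ) :
    derivative^[m] (X * p) = X * derivative^[m] p + (m : ℂ[X]) * derivative^[m - 1] p := by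
  rw [mul_comm, Polynomial.iterate_derivative_mul_X, mul_comm, nsmul_eq_mul]

/-- The commutator of `exp (-(s / 2) ∂²)` with multiplication by `X` is `-s ∂ exp (-(s / 2) ∂²)`. On
monomials it is the Hermite recurrence. -/
theorem heatFlow_X_mul (s : ℂ) (p : ℂ[X]) :
    heatFlow s (X * p) = X * heatFlow s p - C s * derivative (heatFlow s p) := by
  have hdeg : (X * p).natDegree ≤ p.natDegree + 1 := by
    refine natDegree_mul_le.trans ?_
    rw [natDegree_X, add_comm]
  rw [heatFlow_eq_sum s (X * p) (N := p.natDegree + 1 + 1) (by omega),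
    heatFlow_eq_sum s p (N := p.natDegree + 1) (by omega)]
  have h0 : derivative^[2 * (p.natDegree + 1)] p = 0 :=
    iterate_derivative_eq_zero (by omega)
  have hsplit : ∀ j : ℕ, C ((1 / (j.factorial : ℂ)) * (-(s / 2)) ^ j) * derivative^[2 * j] (X * p) =
      X * (C ((1 / (j.factorial : ℂ)) * (-(s / 2)) ^ j) * derivative^[2 * j] p) +
      C ((1 / (j.factorial : ℂ)) * (-(s / 2)) ^ j) *
        (((2 * j : ℕ) : ℂ[X]) * derivative^[2 * j - 1] p) := by
    intro j
    rw [iterate_derivative_X_mul_eq]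
    ring
  simp_rw [hsplit]
  rw [Finset.sum_add_distrib, ← Finset.mul_sum, Finset.sum_range_succ, h0, mul_zero, add_zero,
    sub_eq_add_neg]
  congr 1
  -- The commutator terms carry the factor `2 * j`; dropping `j = 0` and shifting the index turns
  -- them into the series of the differentiated flow.
  rw [Finset.sum_range_succ', derivative_sum, Finset.mul_sum, ← Finset.sum_neg_distrib]
  simp only [mul_zero, Nat.cast_zero, zero_mul, add_zero]
  refine Finset.sum_congr rfl fun j _ => ?_
  have h1 : 2 * (j + 1) - 1 = 2 * j + 1 := by omega
  have hfac : ((j + 1).factorial : ℂ) = (j + 1) * j.factorial := by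
    rw [Nat.factorial_succ]; push_cast; ring
  have hj : ((j : ℂ) + 1) ≠ 0 := by exact_mod_cast Nat.succ_ne_zero j
  have hjf : (j.factorial : ℂ) ≠ 0 := by exact_mod_cast j.factorial_ne_zero
  have hcoef : (1 / ((j + 1).factorial : ℂ)) * (-(s / 2)) ^ (j + 1) * (2 * (j + 1) : ℂ) =
      -(s * ((1 / (j.factorial : ℂ)) * (-(s / 2)) ^ j)) := by
    rw [hfac]
    field_simp
    ring
  have hcast : (((2 * (j + 1) : ℕ)) : ℂ[X]) = C (2 * (j + 1) : ℂ) := by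
    rw [← map_natCast C]; push_cast; rfl
  rw [h1, derivative_C_mul, ← Function.iterate_succ_apply' (f := derivative), hcast, ← mul_assoc,
    ← C_mul, hcoef, Nat.succ_eq_add_one, C_neg, C_mul]
  ring

theorem hasDerivAt_gaussian (s z x : ℂ) :
    HasDerivAt (fun x : ℂ => Complex.exp (z * x - s * x ^ 2 / 2))
      ((z - s * x) * Complex.exp (z * x - s * x ^ 2 / 2)) x := by
  have h1 : HasDerivAt (fun x : ℂ => z * x - s * x ^ 2 / 2) (z - s * x) x := by
    have := ((hasDerivAt_id' x).const_mul z).fun_sub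
      ((((hasDerivAt_id' x).fun_pow 2).const_mul s).div_const 2)
    refine this.congr_deriv ?_
    simp
    ring
  refine h1.cexp.congr_deriv (by ring)

/-- Differentiating the right-hand side once more reproduces the recurrence `heatFlow_X_mul`. At `x
= 0` the evolved monomials appear as the Taylor coefficients of the Gaussian. -/
theorem iteratedDeriv_gaussian (s z : ℂ) (k : ℕ) :
    iteratedDeriv k (fun x : ℂ => Complex.exp (z * x - s * x ^ 2 / 2)) =
      fun x => (heatFlow s (X ^ k)).eval (z - s * x) * Complex.exp (z * x - s * x ^ 2 / 2) := by
  induction k with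
  | zero =>
    rw [iteratedDeriv_zero]
    ext x
    have h1 := heatFlow_eq_sum s (X ^ 0) (N := 1) (by simp)
    rw [h1]
    simp
  | succ k ih =>
    rw [iteratedDeriv_succ, ih]
    ext x
    have h1 : HasDerivAt (fun x : ℂ => z - s * x) (-s) x := by
      simpa using ((hasDerivAt_id' x).const_mul s).const_sub z
    have h2 := ((heatFlow s (X ^ k)).hasDerivAt (z - s * x)).comp x h1
    have h3 := (h2.fun_mul (hasDerivAt_gaussian s z x)).deriv
    simp only [Function.comp_apply] at h3
    rw [h3, pow_succ' X k, heatFlow_X_mul]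
    simp only [eval_sub, eval_mul, eval_X, eval_C]
    ring

theorem iteratedDeriv_gaussian_zero (s z : ℂ) (k : ℕ) :
    iteratedDeriv k (fun x : ℂ => Complex.exp (z * x - s * x ^ 2 / 2)) 0 = heatMonomial s k z := by
  rw [iteratedDeriv_gaussian, heatMonomial]
  simp

theorem hasSum_heatMonomial (s z x : ℂ) :
    HasSum (fun k : ℕ => (k.factorial : ℂ)⁻¹ * (x ^ k * heatMonomial s k z))
      (Complex.exp (z * x - s * x ^ 2 / 2)) := by
  have hd : Differentiable ℂ (fun x : ℂ => Complex.exp (z * x - s * x ^ 2 / 2)) :=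
    fun x => (hasDerivAt_gaussian s z x).differentiableAt
  have h := Complex.hasSum_taylorSeries_of_entire hd 0 x
  simpa only [iteratedDeriv_gaussian_zero, sub_zero, smul_eq_mul] using h

theorem norm_heatMonomial_le (s z : ℂ) {ρ M : ℝ} (hρ : 0 < ρ)
    (h : ∀ x : ℂ, ‖x‖ = ρ → ‖Complex.exp (z * x - s * x ^ 2 / 2)‖ ≤ M) (k : ℕ) :
    ‖heatMonomial s k z‖ ≤ k.factorial * M / ρ ^ k := by
  have hd : Differentiable ℂ (fun x : ℂ => Complex.exp (z * x - s * x ^ 2 / 2)) :=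
    fun x => (hasDerivAt_gaussian s z x).differentiableAt
  rw [← iteratedDeriv_gaussian_zero]
  exact Complex.norm_iteratedDeriv_le_of_forall_mem_sphere_norm_le k hρ hd.diffContOnCl
    fun x hx => h x (mem_sphere_zero_iff_norm.1 hx)

/-! ### The quadratic exponent -/

/-- The quadratic form `½ (r² |z|² - Re (t̄ z²)) / (r⁴ - |t|²)`. -/
noncomputable def quadPot (t : ℂ) (r : ℝ) (z : ℂ) : ℝ :=
  (r ^ 2 * ‖z‖ ^ 2 - ((starRingEnd ℂ) t * z ^ 2).re) / (2 * (r ^ 4 - ‖t‖ ^ 2))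

theorem continuous_quadPot (t : ℂ) (r : ℝ) : Continuous (quadPot t r) := by
  unfold quadPot; fun_prop

theorem quadPot_nonneg {t : ℂ} {r : ℝ} (ht : ‖t‖ < r ^ 2) (z : ℂ) : 0 ≤ quadPot t r z := by
  have h0 := norm_nonneg t
  have h1 : 0 < r ^ 4 - ‖t‖ ^ 2 := by nlinarith
  refine div_nonneg ?_ (by positivity)
  have h2 : ((starRingEnd ℂ) t * z ^ 2).re ≤ ‖t‖ * ‖z‖ ^ 2 := by
    refine (Complex.re_le_norm _).trans ?_
    rw [norm_mul, norm_pow, Complex.norm_conj]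
  nlinarith [sq_nonneg ‖z‖]

theorem quadPot_apply {t : ℂ} {r : ℝ} (ht : ‖t‖ < r ^ 2) (y : ℂ) :
    quadPot t r (t * y + r ^ 2 * (starRingEnd ℂ) y) =
      ((t * y + r ^ 2 * (starRingEnd ℂ) y) * y).re / 2 := by
  have h0 := norm_nonneg t
  have h1 : 0 < r ^ 4 - ‖t‖ ^ 2 := by nlinarith
  rw [quadPot, div_eq_div_iff (by positivity) (by norm_num)]
  simp only [← Complex.normSq_eq_norm_sq, Complex.normSq_apply, ← Complex.ofReal_pow]
  simp [pow_two]
  ring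

theorem exists_quadPot_point {t : ℂ} {r : ℝ} (ht : ‖t‖ < r ^ 2) (z : ℂ) :
    ∃ y : ℂ, z = t * y + r ^ 2 * (starRingEnd ℂ) y := by
  have h0 := norm_nonneg t
  have h1 : 0 < r ^ 4 - ‖t‖ ^ 2 := by nlinarith
  refine ⟨(r ^ 2 * (starRingEnd ℂ) z - (starRingEnd ℂ) t * z) / ((r ^ 4 - ‖t‖ ^ 2 : ℝ) : ℂ), ?_⟩
  have hne : ((r ^ 4 - ‖t‖ ^ 2 : ℝ) : ℂ) ≠ 0 := by exact_mod_cast h1.ne'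
  simp only [map_div₀, map_sub, map_mul, Complex.conj_conj, map_pow, Complex.conj_ofReal]
  have h2 : t * (starRingEnd ℂ) t = (‖t‖ : ℂ) ^ 2 := Complex.mul_conj' t
  field_simp
  push_cast
  linear_combination z * h2

/-- Subtracting `r ^ 2 * ‖y‖ ^ 2 / 2` from the left-hand side leaves a concave quadratic in `y` with
critical point `v`, `z = t v + r² v̄`, and critical value `quadPot t r z`. The gap is half of `Re (t
(y - v)²) + r² ‖y - v‖²`, nonnegative because `‖t‖ < r²`. -/
theorem re_le_quadPot {t : ℂ} {r : ℝ} (ht : ‖t‖ < r ^ 2) (z y : ℂ) :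
    (z * y - t * y ^ 2 / 2).re ≤ quadPot t r z + r ^ 2 * ‖y‖ ^ 2 / 2 := by
  obtain ⟨v, rfl⟩ := exists_quadPot_point ht z
  rw [quadPot_apply ht]
  have h1 : 0 ≤ (t * (y - v) ^ 2).re + r ^ 2 * ‖y - v‖ ^ 2 := by
    have h2 := Complex.abs_re_le_norm (t * (y - v) ^ 2)
    rw [norm_mul, norm_pow] at h2
    have h3 := neg_abs_le (t * (y - v) ^ 2).re
    nlinarith [sq_nonneg ‖y - v‖]
  simp only [← Complex.normSq_eq_norm_sq, Complex.normSq_apply, ← Complex.ofReal_pow] at h1 ⊢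
  simp [pow_two] at h1 ⊢
  nlinarith

/-! ### Factorial estimates and the exponential rates for disk profiles. -/

theorem mul_log_sub_le_log_factorial (k : ℕ) :
    k * Real.log k - k ≤ Real.log k.factorial := by
  rcases Nat.eq_zero_or_pos k with rfl | hk
  · simp
  have hk' : (0 : ℝ) < k := by exact_mod_cast hk
  have hf : (0 : ℝ) < k.factorial := by exact_mod_cast k.factorial_pos
  have h := Real.pow_div_factorial_le_exp (k : ℝ) hk'.le k
  have h2 := Real.log_le_log (by positivity) h
  rw [Real.log_exp, Real.log_div (by positivity) hf.ne', Real.log_pow] at h2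
  linarith

theorem log_factorial_le {k : ℕ} (hk : 0 < k) :
    Real.log k.factorial ≤ 1 + Real.log k + (k * Real.log k - k) := by
  induction k, hk using Nat.le_induction with
  | base => simp
  | succ k hk ih =>
    have hk' : (0 : ℝ) < k := by exact_mod_cast hk
    have hf : (0 : ℝ) < k.factorial := by exact_mod_cast k.factorial_pos
    have h1 : Real.log (k + 1).factorial = Real.log (k + 1) + Real.log k.factorial := by
      rw [Nat.factorial_succ]; push_cast
      rw [Real.log_mul (by positivity) hf.ne']
    have h2 : (k + 1) * Real.log k + 1 ≤ (k + 1) * Real.log (k + 1) := by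
      have h3 := Real.one_sub_inv_le_log_of_pos (show (0 : ℝ) < (k + 1) / k by positivity)
      rw [Real.log_div (by positivity) hk'.ne', inv_div] at h3
      have h4 : (k + 1) * (1 - (k : ℝ) / (k + 1)) = 1 := by field_simp; ring
      nlinarith [mul_le_mul_of_nonneg_left h3 (show (0 : ℝ) ≤ k + 1 by positivity)]
    rw [h1]
    push_cast
    linarith

section

variable {a : ℕ → ℕ → ℂ} {g : ℝ → ℝ} {r : ℝ}

/-- Up to subexponential factors the coefficients are a constant power times `r ^ (-k) * √(n ^ k /
k!)`, those of Weyl polynomials. -/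
theorem IsDiskProfile.mul_eq (h : IsDiskProfile g r) (ha : IsExponentialProfile a g)
    (hg : IsRegularProfile g) {n k : ℕ} (hn : 0 < n) (hk : k ≤ n) :
    n * g (k / n) = n * g 0 - k * Real.log r - (k * Real.log k - k * Real.log n - k) / 2 := by
  have hn' : (0 : ℝ) < n := by exact_mod_cast hn
  rw [h.eq_add ha hg ⟨by positivity, (div_le_one hn').2 (by exact_mod_cast hk)⟩]
  have h1 : (k : ℝ) * Real.log (k / n) = k * Real.log k - k * Real.log n := by
    rcases Nat.eq_zero_or_pos k with rfl | hk0
    · simp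
    · rw [Real.log_div (by positivity) hn'.ne']; ring
  rw [← h1]
  field_simp

theorem norm_gaussian_le {t : ℂ} (ht : ‖t‖ < r ^ 2) {n : ℕ} (hn : 0 < n) (z x : ℂ) :
    ‖Complex.exp (z * x - t / n * x ^ 2 / 2)‖ ≤
      Real.exp (n * quadPot t r z + r ^ 2 * ‖x‖ ^ 2 / (2 * n)) := by
  have hn' : (0 : ℝ) < n := by exact_mod_cast hn
  have hnc : (n : ℂ) ≠ 0 := by exact_mod_cast hn.ne'
  rw [Complex.norm_exp, Real.exp_le_exp]
  have h1 := re_le_quadPot ht z (x / n)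
  have h2 : z * x - t / n * x ^ 2 / 2 = ((n : ℝ) : ℂ) * (z * (x / n) - t * (x / n) ^ 2 / 2) := by
    push_cast; field_simp
  rw [h2, Complex.re_ofReal_mul]
  refine (mul_le_mul_of_nonneg_left h1 hn'.le).trans_eq ?_
  rw [norm_div, Complex.norm_natCast]
  field_simp

/-- Cauchy's estimate for the generating function, followed by a factorial bound that cancels the
coefficient profile. A radius `r' > r` is admitted, at the cost of `Real.log (r' / r)`, because
`quadPot t r` is no longer available when `‖t‖ = r ^ 2`. -/
theorem IsDiskProfile.coeffUpperAt (h : IsDiskProfile g r) (ha : IsExponentialProfile a g)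
    (hg : IsRegularProfile g) (hr : 0 < r) {r' : ℝ} (hr' : r ≤ r') {t : ℂ} (ht : ‖t‖ < r' ^ 2)
    (z : ℂ) : CoeffUpperAt a t z (g 0 + Real.log (r' / r) + quadPot t r' z) := by
  intro η hη
  have hr0 : 0 < r' := hr.trans_le hr'
  obtain ⟨δ₀, hδ₀, hδQ⟩ := Metric.continuousAt_iff.1
    ((continuous_quadPot t r').continuousAt (x := z)) η hη
  refine ⟨δ₀ / 2, by positivity, fun δ _ hδ ε hε => ?_⟩
  have hlim : Tendsto (fun n : ℕ => (1 + Real.log n) / n) atTop (𝓝 0) := by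
    have h1 : Tendsto (fun n : ℕ => 1 / (n : ℝ) + Real.log n / n) atTop (𝓝 (0 + 0)) :=
      tendsto_one_div_atTop_nhds_zero_nat.add
        ((Real.isLittleO_log_id_atTop.tendsto_div_nhds_zero).comp tendsto_natCast_atTop_atTop)
    rw [add_zero] at h1
    simpa only [add_div] using h1
  filter_upwards [ha.growth (ε / 2) (by positivity), eventually_gt_atTop 0,
    hlim.eventually_lt_const (show (0 : ℝ) < ε / 2 by positivity)] with n hn hn0 hnlog k hk w hw
  have hn' : (0 : ℝ) < n := by exact_mod_cast hn0
  have hQw : quadPot t r' w ≤ quadPot t r' z + η := by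
    have h1 : dist w z < δ₀ := by rw [dist_eq_norm, hw]; linarith
    have h2 := hδQ h1
    rw [Real.dist_eq] at h2
    linarith [(abs_lt.1 h2).2]
  have hQ0 := quadPot_nonneg ht z
  have hlogr : 0 ≤ Real.log (r' / r) := Real.log_nonneg ((one_le_div hr).2 hr')
  have hcoef := (norm_coeff_le hn0 (hn k hk).1 (hn k hk).2).2
  -- The Cauchy radius chosen below vanishes for `k = 0`.
  rcases Nat.eq_zero_or_pos k with rfl | hk0
  · have h1 : heatMonomial (t / n) 0 w = 1 := by simp [heatMonomial_eq]
    rw [h1, mul_one]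
    refine hcoef.trans (Real.exp_le_exp.2 (mul_le_mul_of_nonneg_left ?_ hn'.le))
    simp only [Nat.cast_zero, zero_div]
    linarith
  have hk' : (0 : ℝ) < k := by exact_mod_cast hk0
  have hkn : (k : ℝ) ≤ n := by exact_mod_cast hk
  have hfac : (0 : ℝ) < k.factorial := by exact_mod_cast k.factorial_pos
  -- This radius minimises `r' ^ 2 * ρ ^ 2 / (2 * n) - k * Real.log ρ`.
  set ρ := √(k * n) / r' with hρ
  have hρ0 : 0 < ρ := by positivity
  have hρ2 : ρ ^ 2 = k * n / r' ^ 2 := by rw [hρ, div_pow, Real.sq_sqrt (by positivity)]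
  have hlogρ : Real.log ρ = (Real.log k + Real.log n) / 2 - Real.log r' := by
    rw [hρ, Real.log_div (by positivity) hr0.ne', Real.log_sqrt (by positivity),
      Real.log_mul hk'.ne' hn'.ne']
  have hmon := norm_heatMonomial_le (t / n) w (M := Real.exp (n * quadPot t r' w + k / 2)) hρ0
    (fun x hx => by
      refine (norm_gaussian_le ht hn0 w x).trans_eq ?_
      rw [hx, hρ2]
      congr 1
      field_simp) k
  have hexp : k.factorial * Real.exp (n * quadPot t r' w + k / 2) / ρ ^ k =
      Real.exp (Real.log k.factorial + (n * quadPot t r' w + k / 2) - k * Real.log ρ) := by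
    rw [Real.exp_sub, Real.exp_add (Real.log _), Real.exp_log hfac, ← Real.log_pow, Real.exp_log (by positivity)]
  rw [hexp] at hmon
  rw [norm_mul]
  refine (mul_le_mul hcoef hmon (norm_nonneg _) (Real.exp_pos _).le).trans ?_
  rw [← Real.exp_add, Real.exp_le_exp, mul_add, h.mul_eq ha hg hn0 hk, hlogρ]
  have hlf := log_factorial_le hk0
  have hlk : Real.log k ≤ Real.log n := Real.log_le_log hk' hkn
  have hnl : 1 + Real.log n ≤ n * (ε / 2) := by
    rw [div_lt_iff₀ hn'] at hnlog; linarith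
  have hkr : k * (Real.log r' - Real.log r) ≤ n * Real.log (r' / r) := by
    rw [← Real.log_div hr0.ne' hr.ne']
    exact mul_le_mul_of_nonneg_right hkn hlogr
  have hQn := mul_le_mul_of_nonneg_left hQw hn'.le
  linarith

/-- It makes the tail of the generating series exponentially smaller than its sum. -/
theorem mul_exp_half_lt_one {q : ℝ} (hq0 : 0 ≤ q) (hq : q < 1) :
    q * Real.exp ((1 - q ^ 2) / 2) < 1 := by
  have h1 : q ^ 2 < Real.exp (q ^ 2 - 1) := by
    have := Real.add_one_lt_exp (show q ^ 2 - 1 ≠ 0 by nlinarith)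
    linarith
  have h2 : Real.exp (q ^ 2 - 1) = Real.exp ((q ^ 2 - 1) / 2) ^ 2 := by
    rw [← Real.exp_nat_mul]; congr 1; push_cast; ring
  rw [h2] at h1
  have h3 : q < Real.exp ((q ^ 2 - 1) / 2) := lt_of_pow_lt_pow_left₀ 2 (Real.exp_pos _).le h1
  have h4 : (1 - q ^ 2) / 2 = -((q ^ 2 - 1) / 2) := by ring
  rw [h4, Real.exp_neg, ← div_eq_mul_inv, div_lt_one (Real.exp_pos _)]
  exact h3

theorem re_gaussian_point {t : ℂ} (ht : ‖t‖ < r ^ 2) {y z : ℂ}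
    (hz : z = t * y + r ^ 2 * (starRingEnd ℂ) y) :
    (z * y - t * y ^ 2 / 2).re = quadPot t r z + (r * ‖y‖) ^ 2 / 2 := by
  rw [hz, quadPot_apply ht, mul_pow]
  simp only [← Complex.normSq_eq_norm_sq, Complex.normSq_apply, ← Complex.ofReal_pow]
  simp [pow_two]
  ring

/-- By contradiction. At `x = n y`, with `y` the critical point belonging to `z`, the generating
series has the exact size `exp (n (A + q² / 2))`. If every term with `k < n` were below the claimed
rate, neither these terms nor the tail could account for that size; the condition `q < 1` is what
controls the tail. -/
theorem IsDiskProfile.coeffLower (h : IsDiskProfile g r) (ha : IsExponentialProfile a g)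
    (hg : IsRegularProfile g) (hr : 0 < r) {t : ℂ} (ht : ‖t‖ < r ^ 2) {y z : ℂ}
    (hz : z = t * y + r ^ 2 * (starRingEnd ℂ) y) (hy : r * ‖y‖ < 1) :
    CoeffLower a t z (g 0 + quadPot t r z) := by
  intro ε hε
  set q := r * ‖y‖ with hq
  have hq0 : 0 ≤ q := by positivity
  set A := quadPot t r z
  set θ := q * Real.exp ((1 - q ^ 2) / 2) with hθ
  have hθ0 : 0 ≤ θ := by positivity
  have hθ1 : θ < 1 := mul_exp_half_lt_one hq0 hy
  set β := Real.exp (-(3 * ε / 4)) with hβ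
  have hβ1 : β < 1 := Real.exp_lt_one_iff.2 (by linarith)
  have hlim : Tendsto (fun n : ℕ => n * β ^ n + θ ^ n / (1 - q)) atTop (𝓝 (0 + 0 / (1 - q))) :=
    (tendsto_self_mul_const_pow_of_lt_one (Real.exp_pos _).le hβ1).add
      ((tendsto_pow_atTop_nhds_zero_of_lt_one hθ0 hθ1).div_const _)
  rw [zero_div, add_zero] at hlim
  filter_upwards [ha.growth (ε / 4) (by positivity), eventually_gt_atTop 0,
    hlim.eventually_lt_const one_pos] with n hn hn0 hsmall
  have hn' : (0 : ℝ) < n := by exact_mod_cast hn0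
  by_contra! hcon
  set x : ℂ := n * y with hx
  have hxn : ‖x‖ = n * ‖y‖ := by rw [hx, norm_mul, Complex.norm_natCast]
  set f : ℕ → ℂ := fun k => (k.factorial : ℂ)⁻¹ * (x ^ k * heatMonomial (t / n) k z) with hf
  have hfn : ∀ k, ‖f k‖ = (n * ‖y‖) ^ k / k.factorial * ‖heatMonomial (t / n) k z‖ := by
    intro k
    rw [hf]
    simp only
    rw [norm_mul, norm_inv, Complex.norm_natCast, norm_mul, norm_pow, hxn]
    ring
  have hsum := hasSum_heatMonomial (t / n) z x
  have hS : ‖Complex.exp (z * x - t / n * x ^ 2 / 2)‖ = Real.exp (n * (A + q ^ 2 / 2)) := by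
    have hnc : (n : ℂ) ≠ 0 := by exact_mod_cast hn0.ne'
    have h2 : z * x - t / n * x ^ 2 / 2 = ((n : ℝ) : ℂ) * (z * y - t * y ^ 2 / 2) := by
      rw [hx]; push_cast; field_simp
    rw [Complex.norm_exp, h2, Complex.re_ofReal_mul, re_gaussian_point ht hz]
  -- Cauchy's estimate at radius `n / r` bounds the terms by a geometric sequence of ratio `q`.
  have hgeo : ∀ k, ‖f k‖ ≤ Real.exp (n * (A + 1 / 2)) * q ^ k := by
    intro k
    have hfac : (0 : ℝ) < k.factorial := by exact_mod_cast k.factorial_pos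
    have hmon := norm_heatMonomial_le (t / n) z (ρ := n / r) (M := Real.exp (n * (A + 1 / 2)))
      (by positivity) (fun x hx => by
        refine (norm_gaussian_le ht hn0 z x).trans_eq ?_
        rw [hx]
        congr 1
        change n * A + _ = _
        field_simp) k
    rw [hfn]
    refine (mul_le_mul_of_nonneg_left hmon (by positivity)).trans_eq ?_
    rw [hq, mul_pow, mul_pow, div_pow]
    field_simp
  -- The rate deficit `ε`, less the `ε / 4` lost in the growth condition, becomes the factor `β ^
  -- n`.
  have hterm : ∀ k < n, ‖f k‖ ≤ Real.exp (n * (A + q ^ 2 / 2)) * β ^ n := by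
    intro k hk
    have hfac : (0 : ℝ) < k.factorial := by exact_mod_cast k.factorial_pos
    have hcoef := (norm_coeff_le hn0 (hn k hk.le).1 (hn k hk.le).2).1
    have h1 := (hcon k hk).le
    rw [norm_mul] at h1
    have h2 : ‖heatMonomial (t / n) k z‖ ≤
        Real.exp (n * (g 0 + A - ε) - n * (g (k / n) - ε / 4)) := by
      rw [Real.exp_sub, le_div_iff₀ (Real.exp_pos _), mul_comm]
      refine (mul_le_mul_of_nonneg_right hcoef (norm_nonneg _)).trans ?_
      exact h1
    have hpow : (n * ‖y‖) ^ k / k.factorial * Real.exp (n * g 0 - n * g (k / n)) ≤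
        Real.exp (n * (q ^ 2 / 2)) := by
      rw [h.mul_eq ha hg hn0 hk.le]
      rcases Nat.eq_zero_or_pos k with rfl | hk0
      · simp
        positivity
      rcases eq_or_ne y 0 with rfl | hy0
      · rw [norm_zero, mul_zero, zero_pow hk0.ne', zero_div, zero_mul]
        positivity
      have hy' : 0 < ‖y‖ := norm_pos_iff.2 hy0
      have hk' : (0 : ℝ) < k := by exact_mod_cast hk0
      -- Half of the logarithm of this inequality, added to half of the lower bound for `log k!`, is
      -- exactly what is needed.
      have h3 := Real.pow_div_factorial_le_exp (n * q ^ 2) (by positivity) k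
      have hqpos : 0 < q := by positivity
      have h4 := Real.log_le_log (by positivity) h3
      rw [Real.log_exp, Real.log_div (by positivity) hfac.ne', Real.log_pow,
        Real.log_mul hn'.ne' (by positivity), Real.log_pow, hq, Real.log_mul hr.ne' hy'.ne'] at h4
      rw [← Real.exp_log (show 0 < (n * ‖y‖) ^ k / k.factorial by positivity), ← Real.exp_add,
        Real.exp_le_exp, Real.log_div (by positivity) hfac.ne', Real.log_pow,
        Real.log_mul hn'.ne' hy'.ne']
      have h5 := mul_log_sub_le_log_factorial k
      push_cast at h4
      rw [hq]
      linarith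
    rw [hfn]
    calc (n * ‖y‖) ^ k / k.factorial * ‖heatMonomial (t / n) k z‖
        ≤ (n * ‖y‖) ^ k / k.factorial *
          Real.exp (n * (g 0 + A - ε) - n * (g (k / n) - ε / 4)) := by gcongr
      _ = ((n * ‖y‖) ^ k / k.factorial * Real.exp (n * g 0 - n * g (k / n))) *
          Real.exp (n * (A - 3 * ε / 4)) := by
          rw [mul_assoc, ← Real.exp_add]; congr 2; ring
      _ ≤ Real.exp (n * (q ^ 2 / 2)) * Real.exp (n * (A - 3 * ε / 4)) := by gcongr
      _ = _ := by
          rw [hβ, ← Real.exp_nat_mul, ← Real.exp_add, ← Real.exp_add]; congr 1; ring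
  have htail := norm_sub_le_of_geometric_bound_of_hasSum hy hgeo hsum n
  have hfin : ‖∑ k ∈ Finset.range n, f k‖ ≤ n * (Real.exp (n * (A + q ^ 2 / 2)) * β ^ n) := by
    refine (norm_sum_le_of_le _ fun k hk => hterm k (Finset.mem_range.1 hk)).trans_eq ?_
    rw [Finset.sum_const, Finset.card_range, nsmul_eq_mul]
  -- The first summand bounds the terms with `k < n`, the second the tail. Their sum is less than
  -- one for large `n`.
  have htotal : Real.exp (n * (A + q ^ 2 / 2)) ≤ Real.exp (n * (A + q ^ 2 / 2)) *
      (n * β ^ n + θ ^ n / (1 - q)) := by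
    have h1 : Real.exp (n * (A + 1 / 2)) * q ^ n / (1 - q) =
        Real.exp (n * (A + q ^ 2 / 2)) * (θ ^ n / (1 - q)) := by
      have h2 : Real.exp (n * (A + 1 / 2)) =
          Real.exp (n * (A + q ^ 2 / 2)) * Real.exp ((1 - q ^ 2) / 2) ^ n := by
        rw [← Real.exp_nat_mul, ← Real.exp_add]; congr 1; ring
      rw [hθ, mul_pow, h2]; ring
    have h3 := norm_sub_norm_le (Complex.exp (z * x - t / n * x ^ 2 / 2))
      (∑ k ∈ Finset.range n, f k)
    rw [norm_sub_rev, hS] at h3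
    rw [h1] at htail
    linarith
  have hpos := Real.exp_pos (n * (A + q ^ 2 / 2))
  nlinarith

end

/-! ### Uniform distributions on ellipses -/

theorem uniformDisk_isProbabilityMeasure {r : ℝ} (hr : 0 < r) :
    IsProbabilityMeasure (uniformDisk r) :=
  cond_isProbabilityMeasure_of_finite (Metric.measure_closedBall_pos volume _ hr).ne'
    (measure_closedBall_lt_top).ne

theorem volume_real_closedBall {r : ℝ} (hr : 0 ≤ r) :
    (volume (Metric.closedBall (0 : ℂ) r)).toReal = Real.pi * r ^ 2 := by
  rw [Complex.volume_closedBall, ENNReal.toReal_mul, ENNReal.toReal_pow, ENNReal.toReal_ofReal hr]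
  simp [mul_comm]

theorem integral_uniformDisk {r : ℝ} (hr : 0 ≤ r) (f : ℂ → ℝ) :
    ∫ z, f z ∂(uniformDisk r) = (Real.pi * r ^ 2)⁻¹ * ∫ z in Metric.closedBall (0 : ℂ) r, f z := by
  rw [uniformDisk, ProbabilityTheory.cond, integral_smul_measure, ENNReal.toReal_inv,
    volume_real_closedBall hr, smul_eq_mul]

theorem uniformDisk_ball {r : ℝ} (hr : 0 < r) : uniformDisk r (Metric.ball 0 r) = 1 := by
  rw [uniformDisk, ProbabilityTheory.cond_apply measurableSet_closedBall,
    Set.inter_eq_right.2 Metric.ball_subset_closedBall, Measure.addHaar_closedBall_eq_addHaar_ball]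
  exact ENNReal.inv_mul_cancel (Metric.measure_ball_pos volume _ hr).ne' measure_ball_lt_top.ne

/-- The image of the uniform distribution on the disk of radius `r` under `w ↦ w + (t / r²) w̄`. -/
noncomputable def ellipseLaw (t : ℂ) (r : ℝ) : Measure ℂ :=
  (uniformDisk r).map (conjLin 1 (t / r ^ 2))

theorem ellipseLaw_isProbabilityMeasure (t : ℂ) {r : ℝ} (hr : 0 < r) :
    IsProbabilityMeasure (ellipseLaw t r) :=
  have := uniformDisk_isProbabilityMeasure hr
  Measure.isProbabilityMeasure_map (conjLin 1 (t / r ^ 2)).continuous.aemeasurable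

theorem ellipseLaw_zero (r : ℝ) : ellipseLaw 0 r = uniformDisk r := by
  have h : (conjLin 1 (0 / r ^ 2) : ℂ → ℂ) = id := by ext u; simp
  rw [ellipseLaw, h, Measure.map_id]

theorem bump_smul {s : ℝ} (hs : 0 < s) (w : ℂ) : bump s (s • w) = bump 1 w := by
  have h : ∀ c : ℝ, 0 < c → truncLog (c * s) (s • w) = Real.log s + truncLog c w := by
    intro c hc
    have h0 : 0 < max c ‖w‖ := lt_max_of_lt_left hc
    rw [truncLog, truncLog, ← Real.log_mul hs.ne' h0.ne', norm_smul, Real.norm_of_nonneg hs.le,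
      mul_max_of_nonneg _ _ hs.le, mul_comm s c]
  have h1 := h 1 one_pos
  rw [one_mul] at h1
  rw [bump, bump, h 2 two_pos, h1, mul_one]
  ring

theorem integral_bump_eq {s : ℝ} (hs : 0 < s) : ∫ w, bump s w = s ^ 2 * ∫ w, bump 1 w := by
  have h := Measure.integral_comp_smul (volume : Measure ℂ) (bump s) s
  simp_rw [bump_smul hs] at h
  rw [h, Complex.finrank_real_complex, abs_of_pos (by positivity), smul_eq_mul, ← mul_assoc,
    mul_inv_cancel₀ (by positivity), one_mul]

/-- On the circle, `‖z‖²` equals `‖x‖² + s² + 2 Re (x̄ (z - x))`, so the quadratic form coincides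
there with the real part of an entire function, and the mean value property applies. -/
theorem circleAverage_quadPot (t : ℂ) (r : ℝ) (x : ℂ) (s : ℝ) :
    Real.circleAverage (quadPot t r) x s =
      quadPot t r x + r ^ 2 / (2 * (r ^ 4 - ‖t‖ ^ 2)) * s ^ 2 := by
  set A := r ^ 2 / (2 * (r ^ 4 - ‖t‖ ^ 2)) with hA
  set f : ℂ → ℂ := fun z => A * ((‖x‖ ^ 2 + s ^ 2 : ℝ) + 2 * (starRingEnd ℂ) x * (z - x)) -
    ((2 * (r ^ 4 - ‖t‖ ^ 2))⁻¹ : ℝ) * ((starRingEnd ℂ) t * z ^ 2) with hf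
  have hfd : Differentiable ℂ f := by fun_prop
  have hQ : ∀ z, quadPot t r z = A * ‖z‖ ^ 2 -
      (2 * (r ^ 4 - ‖t‖ ^ 2))⁻¹ * ((starRingEnd ℂ) t * z ^ 2).re := by
    intro z; rw [quadPot, hA]; ring
  have hQf : ∀ z ∈ Metric.sphere x |s|, quadPot t r z = (f z).re := by
    intro z hz
    have hz' : ‖z - x‖ ^ 2 = s ^ 2 := by
      rw [mem_sphere_iff_norm] at hz
      rw [hz, sq_abs]
    have h1 : ‖z‖ ^ 2 = ‖x‖ ^ 2 + s ^ 2 + 2 * ((starRingEnd ℂ) x * (z - x)).re := by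
      rw [← hz']
      simp only [← Complex.normSq_eq_norm_sq, Complex.normSq_apply]
      simp
      ring
    rw [hQ, h1, hf]
    simp only [Complex.sub_re, Complex.re_ofReal_mul, Complex.add_re, Complex.ofReal_re]
    have h2 : (2 * (starRingEnd ℂ) x * (z - x)).re = 2 * ((starRingEnd ℂ) x * (z - x)).re := by
      rw [mul_assoc]; simp
    rw [h2]
  have h1 : Real.circleAverage f x s = f x := hfd.diffContOnCl.circleAverage
  have h2 := Complex.reCLM.circleAverage_comp_comm
    (hfd.continuous.continuousOn.circleIntegrable' (c := x) (R := s))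
  rw [Real.circleAverage_congr_sphere hQf]
  have h3 : Real.circleAverage (fun z => (f z).re) x s = (f x).re := by
    rw [← h1]; exact h2
  rw [h3, hQ x, hf]
  simp only [Complex.sub_re, Complex.re_ofReal_mul, Complex.add_re, Complex.ofReal_re, sub_self,
    mul_zero, Complex.zero_re]
  ring

/-- The substitution `y = w̄ / r²` turns points of the ellipse into the saddle-point form of
`quadPot_apply`; the disk `‖w‖ < r` becomes `r * ‖y‖ < 1`. -/
theorem conjLin_div_eq {t : ℂ} {r : ℝ} (hr : 0 < r) (w : ℂ) :
    conjLin 1 (t / r ^ 2) w = t * ((starRingEnd ℂ) w / r ^ 2) +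
      r ^ 2 * (starRingEnd ℂ) ((starRingEnd ℂ) w / r ^ 2) := by
  have hrc : (r : ℂ) ≠ 0 := by exact_mod_cast hr.ne'
  simp
  field_simp
  ring

theorem det_conjLin_div {t : ℂ} {r : ℝ} (hr : 0 < r) :
    LinearMap.det (conjLin 1 (t / r ^ 2) : ℂ →ₗ[ℝ] ℂ) = (r ^ 4 - ‖t‖ ^ 2) / r ^ 4 := by
  rw [det_conjLin, Complex.normSq_eq_norm_sq, Complex.normSq_eq_norm_sq, norm_one, norm_div,
    norm_pow, Complex.norm_real, Real.norm_of_nonneg hr.le]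
  field_simp

theorem det_conjLin_div_pos {t : ℂ} {r : ℝ} (hr : 0 < r) (ht : ‖t‖ < r ^ 2) :
    0 < LinearMap.det (conjLin 1 (t / r ^ 2) : ℂ →ₗ[ℝ] ℂ) := by
  rw [det_conjLin_div hr]
  have h0 := norm_nonneg t
  have h1 : 0 < r ^ 4 - ‖t‖ ^ 2 := by nlinarith
  positivity

/-- The linear homeomorphism `w ↦ w + (t / r²) w̄`. -/
noncomputable def ellipseEquiv {t : ℂ} {r : ℝ} (hr : 0 < r) (ht : ‖t‖ < r ^ 2) : ℂ ≃L[ℝ] ℂ :=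
  (conjLin 1 (t / r ^ 2)).toContinuousLinearEquivOfDetNeZero (det_conjLin_div_pos hr ht).ne'

theorem injective_conjLin_div {t : ℂ} {r : ℝ} (hr : 0 < r) (ht : ‖t‖ < r ^ 2) :
    Function.Injective (conjLin 1 (t / r ^ 2)) := (ellipseEquiv hr ht).injective

/-- The open ellipse, the image of the open disk. -/
def openEllipse (t : ℂ) (r : ℝ) : Set ℂ := conjLin 1 (t / r ^ 2) '' Metric.ball 0 r

theorem isOpen_openEllipse {t : ℂ} {r : ℝ} (hr : 0 < r) (ht : ‖t‖ < r ^ 2) :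
    IsOpen (openEllipse t r) :=
  (ellipseEquiv hr ht).toHomeomorph.isOpenMap _ Metric.isOpen_ball

theorem ellipseLaw_openEllipse {t : ℂ} {r : ℝ} (hr : 0 < r) (ht : ‖t‖ < r ^ 2) :
    ellipseLaw t r (openEllipse t r) = 1 := by
  rw [ellipseLaw, Measure.map_apply (conjLin 1 (t / r ^ 2)).continuous.measurable
    (isOpen_openEllipse hr ht).measurableSet, openEllipse,
    Set.preimage_image_eq _ (injective_conjLin_div hr ht), uniformDisk_ball hr]

/-- The support of the bump lies in the ellipse, so its pull-back does not see the boundary of the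
disk, and a linear change of variables remains. The integral of `bump 1` is deliberately left
unevaluated. -/
theorem integral_bump_ellipseLaw_aux {t : ℂ} {r : ℝ} (hr : 0 < r) (ht : ‖t‖ < r ^ 2) {x : ℂ}
    {s : ℝ} (hs : 0 < s) (hsub : Metric.closedBall x (2 * s) ⊆ openEllipse t r) :
    ∫ u, bump s (x - u) ∂(ellipseLaw t r) =
      r ^ 2 / (Real.pi * (r ^ 4 - ‖t‖ ^ 2)) * (s ^ 2 * ∫ w, bump 1 w) := by
  set T := conjLin 1 (t / r ^ 2) with hT
  have hb := (bump_continuous hs)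
  have hcont : Continuous fun u => bump s (x - u) := hb.comp (continuous_const.sub continuous_id)
  rw [ellipseLaw, integral_map T.continuous.aemeasurable hcont.aestronglyMeasurable,
    integral_uniformDisk hr.le, setIntegral_eq_integral_of_forall_compl_eq_zero]
  · have hdet := det_conjLin_div_pos hr ht
    have h1 := Measure.map_linearMap_addHaar_eq_smul_addHaar (volume : Measure ℂ) hdet.ne'
    have h2 : ∫ w, bump s (x - T w) =
        (LinearMap.det (T : ℂ →ₗ[ℝ] ℂ))⁻¹ * ∫ u, bump s (x - u) := by
      rw [← integral_map (φ := T) (f := fun u => bump s (x - u)) T.continuous.aemeasurable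
        hcont.aestronglyMeasurable]
      have h3 : Measure.map T volume = _ := h1
      rw [h3, integral_smul_measure, ENNReal.toReal_ofReal (abs_nonneg _),
        abs_of_pos (inv_pos.2 hdet), smul_eq_mul]
    have h4 : ∫ u, bump s (x - u) = ∫ w, bump s w := by
      rw [← integral_bump_sub s x]
      refine integral_congr_ae (ae_of_all _ fun u => ?_)
      show bump s (x - u) = bump s (u - x)
      rw [← bump_neg, neg_sub]
    rw [h2, h4, integral_bump_eq hs, hT, det_conjLin_div hr]
    have h0 := norm_nonneg t
    have h5 : r ^ 4 - ‖t‖ ^ 2 ≠ 0 := by nlinarith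
    have h6 := Real.pi_ne_zero
    field_simp
  · intro w hw
    apply bump_eq_zero hs
    by_contra! hlt
    have h1 : T w ∈ openEllipse t r := hsub (by
      rw [mem_closedBall_iff_norm, norm_sub_rev]; exact hlt.le)
    obtain ⟨v, hv, hvw⟩ := h1
    have : v = w := injective_conjLin_div hr ht hvw
    subst this
    exact hw (Metric.ball_subset_closedBall hv)

/-! ### Identification of the limit for `‖t‖ < r ^ 2`. -/

section

variable {Ω : Type*} [MeasurableSpace Ω] {P : Measure Ω} [IsProbabilityMeasure P] {ξ : ℕ → Ω → ℂ}
  {a : ℕ → ℕ → ℂ} {g : ℝ → ℝ} {r : ℝ} {t : ℂ} {ν : Measure ℂ}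

theorem IsDiskProfile.potentialLe (h : IsDiskProfile g r) (hξ : IsCoefficientNoise P ξ)
    (ha : IsExponentialProfile a g) (hg : IsRegularProfile g) (hν : IsZeroLimit P ξ a t ν)
    (hr : 0 < r) {r' : ℝ} (hr' : r ≤ r') (ht : ‖t‖ < r' ^ 2) (z : ℂ) :
    PotentialLe ν z (Real.log r' - 1 / 2 + quadPot t r' z) := by
  have h1 := potentialLe_of_coeffUpperAt hξ ha hν (h.coeffUpperAt ha hg hr hr' ht z)
  have h2 := h.eq_add ha hg (β := 1) ⟨zero_le_one, le_rfl⟩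
  rw [h2, Real.log_div (hr.trans_le hr').ne' hr.ne', Real.log_one] at h1
  convert h1 using 1
  ring

/-- Inside the ellipse the two rates agree, so the potential is the quadratic form plus a constant.
Its circle means are quadratic in the radius, and `(2 s)² - s² = 3 s²`. -/
theorem IsDiskProfile.integral_bump (h : IsDiskProfile g r) (hξ : IsCoefficientNoise P ξ)
    (ha : IsExponentialProfile a g) (hg : IsRegularProfile g) [IsProbabilityMeasure ν]
    (hν : IsZeroLimit P ξ a t ν) (hr : 0 < r) (ht : ‖t‖ < r ^ 2) {x : ℂ} {s : ℝ} (hs : 0 < s)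
    (hsub : Metric.closedBall x (2 * s) ⊆ openEllipse t r) :
    ∫ u, bump s (x - u) ∂ν = 3 * r ^ 2 / (2 * (r ^ 4 - ‖t‖ ^ 2)) * s ^ 2 := by
  have hmom := (h.potentialLe hξ ha hg hν hr le_rfl ht 0).hasLogMoment
  have hlow : ∀ z ∈ openEllipse t r, CoeffLower a t z (g 0 + quadPot t r z) := by
    rintro z ⟨w, hw, rfl⟩
    refine h.coeffLower ha hg hr ht (conjLin_div_eq hr w) ?_
    rw [mem_ball_zero_iff] at hw
    rw [norm_div, RCLike.norm_conj, norm_pow, Complex.norm_real, Real.norm_of_nonneg hr.le]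
    have : r * (‖w‖ / r ^ 2) = ‖w‖ / r := by field_simp
    rw [this, div_lt_one hr]
    exact hw
  have hup : ∀ z, CoeffUpperAt a t z (g 0 + quadPot t r z) := by
    intro z
    have := h.coeffUpperAt ha hg hr le_rfl ht z
    rwa [div_self hr.ne', Real.log_one, add_zero] at this
  have hx : x ∈ openEllipse t r := hsub (Metric.mem_closedBall_self (by positivity))
  have hQ : ∀ z ∈ openEllipse t r, logPot ν z = quadPot t r z + (logPot ν x - quadPot t r x) := by
    intro z hz
    have := logPot_sub_eq hξ ha hν (hup z) (hlow z hz) (hup x) (hlow x hx)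
    linarith
  have hCA : ∀ s' : ℝ, 0 < s' → s' ≤ 2 * s → Real.circleAverage (logPot ν) x s' =
      Real.circleAverage (quadPot t r) x s' + (logPot ν x - quadPot t r x) := by
    intro s' hs' hle
    have h1 : Set.EqOn (logPot ν) (fun z => quadPot t r z + (logPot ν x - quadPot t r x))
        (Metric.sphere x |s'|) := by
      intro z hz
      rw [abs_of_pos hs'] at hz
      exact hQ z (hsub (Metric.closedBall_subset_closedBall hle (Metric.sphere_subset_closedBall hz)))
    rw [Real.circleAverage_congr_sphere h1, Real.circleAverage_fun_add
      ((continuous_quadPot t r).continuousOn.circleIntegrable') (circleIntegrable_const _ _ _),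
      Real.circleAverage_const]
  rw [hmom.integral_bump x hs, hCA s hs (by linarith), hCA (2 * s) (by positivity) le_rfl,
    circleAverage_quadPot, circleAverage_quadPot]
  ring

/-- The constant is read off without integration: both formulas for bump integrals apply to the
uniform law on the disk at time zero, and comparing them determines it. -/
theorem IsDiskProfile.integral_bump_one (h : IsDiskProfile g r) (hξ : IsCoefficientNoise P ξ)
    (ha : IsExponentialProfile a g) (hg : IsRegularProfile g)
    (hν : IsZeroLimit P ξ a 0 (uniformDisk r)) (hr : 0 < r) :
    ∫ w, bump 1 w = 3 * Real.pi / 2 := by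
  have := uniformDisk_isProbabilityMeasure hr
  have ht : ‖(0 : ℂ)‖ < r ^ 2 := by rw [norm_zero]; positivity
  have hs : 0 < r / 4 := by positivity
  have hsub : Metric.closedBall (0 : ℂ) (2 * (r / 4)) ⊆ openEllipse 0 r := by
    intro w hw
    refine ⟨w, ?_, by simp⟩
    exact Metric.closedBall_subset_ball (by linarith) hw
  have h1 := h.integral_bump hξ ha hg hν hr ht hs hsub
  have h2 := integral_bump_ellipseLaw_aux hr ht hs hsub
  rw [ellipseLaw_zero, h1] at h2
  have hpi := Real.pi_pos
  rw [norm_zero] at h2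
  field_simp at h2
  linarith

theorem IsDiskProfile.eq_ellipseLaw_of_lt (h : IsDiskProfile g r) (hξ : IsCoefficientNoise P ξ)
    (ha : IsExponentialProfile a g) (hg : IsRegularProfile g) [IsProbabilityMeasure ν]
    (hν0 : IsZeroLimit P ξ a 0 (uniformDisk r))
    (hν : IsZeroLimit P ξ a t ν) (hr : 0 < r) (ht : ‖t‖ < r ^ 2) : ν = ellipseLaw t r := by
  have := ellipseLaw_isProbabilityMeasure t hr
  refine measure_eq_of_bumps (isOpen_openEllipse hr ht) (ellipseLaw_openEllipse hr ht)
    fun x _ s hs hsub => ?_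
  rw [h.integral_bump hξ ha hg hν hr ht hs hsub, integral_bump_ellipseLaw_aux hr ht hs hsub,
    h.integral_bump_one hξ ha hg hν0 hr]
  have h0 := norm_nonneg t
  have h5 : r ^ 4 - ‖t‖ ^ 2 ≠ 0 := by nlinarith
  have h6 := Real.pi_ne_zero
  field_simp

end

/-! ### Potentials averaged along curves -/

instance : NullSingletonClass angleMeasure :=
  ⟨fun x => by simp [angleMeasure]⟩

/-- A bound for the potential along a curve, in averaged and in almost everywhere form. -/
theorem integral_le_of_potentialLe {ν : Measure ℂ} [IsProbabilityMeasure ν] (h : HasLogMoment ν)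
    {Θ : Type*} [MeasurableSpace Θ] {μ : Measure Θ} [IsProbabilityMeasure μ]
    {γ : Θ → ℂ} (hγ : Measurable γ) {M m : ℝ} (hM : ∀ θ, ‖γ θ‖ ≤ M)
    (hi : ∀ u, Integrable (fun θ => Real.log ‖γ θ - u‖) μ)
    (hm : ∀ u, m ≤ ∫ θ, Real.log ‖γ θ - u‖ ∂μ) (hne : ∀ u, ∀ᵐ θ ∂μ, γ θ - u ≠ 0)
    {B : Θ → ℝ} (hB : Integrable B μ) (hle : ∀ θ, PotentialLe ν (γ θ) (B θ)) :
    (∀ᵐ θ ∂μ, logPot ν (γ θ) ≤ B θ) ∧ Integrable (fun θ => logPot ν (γ θ)) μ ∧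
      Integrable (fun u => ∫ θ, Real.log ‖γ θ - u‖ ∂μ) ν ∧
      ∫ u, (∫ θ, Real.log ‖γ θ - u‖ ∂μ) ∂ν = ∫ θ, logPot ν (γ θ) ∂μ ∧
      ∫ u, (∫ θ, Real.log ‖γ θ - u‖ ∂μ) ∂ν ≤ ∫ θ, B θ ∂μ := by
  have hprod := h.integrable_prod hγ hM (ae_of_all _ hi) (ae_of_all _ hm)
  have hmeas : MeasurableSet {p : Θ × ℂ | γ p.1 - p.2 ≠ 0} :=
    ((hγ.comp measurable_fst).sub measurable_snd) (measurableSet_singleton 0).compl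
  have hae : ∀ᵐ θ ∂μ, ∀ᵐ u ∂ν, γ θ - u ≠ 0 := by
    refine Measure.ae_ae_of_ae_prod (p := fun p : Θ × ℂ => γ p.1 - p.2 ≠ 0) ?_
    have h1 : ∀ᵐ p ∂(ν.prod μ), γ p.2 - p.1 ≠ 0 :=
      (Measure.ae_prod_iff_ae_ae (measurable_swap hmeas)).2 (ae_of_all _ hne)
    exact (Measure.measurePreserving_swap (μ := μ) (ν := ν)).quasiMeasurePreserving.ae h1
  have hle' : ∀ᵐ θ ∂μ, logPot ν (γ θ) ≤ B θ := by
    filter_upwards [hprod.prod_right_ae, hae] with θ h1 h2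
    exact (hle θ).logPot_le h1 h2
  have hpot : Integrable (fun θ => logPot ν (γ θ)) μ := hprod.integral_prod_left
  have heq : ∫ u, (∫ θ, Real.log ‖γ θ - u‖ ∂μ) ∂ν = ∫ θ, logPot ν (γ θ) ∂μ :=
    (integral_integral_swap hprod).symm
  refine ⟨hle', hpot, hprod.integral_prod_right, heq, ?_⟩
  rw [heq]
  exact integral_mono_ae hpot hB hle'

theorem ae_circleMap_notMem {x : ℂ} {s : ℝ} (hs : 0 < s) {S : Set ℂ} (hS : S.Countable) :
    ∀ᵐ θ ∂angleMeasure, circleMap x s θ ∉ S := by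
  have h1 : (circleMap x s ⁻¹' S).Countable := hS.preimage_circleMap x hs.ne'
  exact h1.ae_notMem angleMeasure

/-- Averaging the pointwise bound over a circle gives a bound for an integral with continuous
kernel, a form that survives passage to the limit. -/
theorem integral_truncLog_le_of_potentialLe {ν : Measure ℂ} [IsProbabilityMeasure ν] {B : ℂ → ℝ}
    (hB : Continuous B) (h : ∀ z, PotentialLe ν z (B z)) (z : ℂ) {δ : ℝ} (hδ : 0 < δ) :
    ∫ u, truncLog δ (z - u) ∂ν ≤ Real.circleAverage B z δ := by
  have hmom := (h 0).hasLogMoment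
  have hJ : ∀ u, ∫ θ, Real.log ‖circleMap z δ θ - u‖ ∂angleMeasure = truncLog δ (z - u) := by
    intro u
    rw [← circleAverage_eq_integral_angleMeasure (fun z => Real.log ‖z - u‖),
      circleAverage_log_norm_sub hδ]
  have h1 := integral_le_of_potentialLe hmom (μ := angleMeasure) (γ := circleMap z δ)
    (M := ‖z‖ + δ) (m := Real.log δ) (B := fun θ => B (circleMap z δ θ))
    (by fun_prop) (fun θ => (norm_add_le _ _).trans (by simp [abs_of_pos hδ]))
    (fun u => (integrable_angleMeasure_iff (f := fun z => Real.log ‖z - u‖)).2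
      (circleIntegrable_log_norm_sub_const δ))
    (fun u => by rw [hJ]; exact log_radius_le_truncLog hδ _)
    (fun u => by
      filter_upwards [ae_circleMap_notMem hδ (Set.countable_singleton u)] with θ hθ
      exact sub_ne_zero.2 hθ)
    ((integrable_angleMeasure_iff).2 hB.continuousOn.circleIntegrable')
    (fun θ => h _)
  have h2 := h1.2.2.2.2
  simp_rw [hJ] at h2
  rwa [circleAverage_eq_integral_angleMeasure]

/-! ### Stability of the potential bounds for ellipses -/

theorem norm_conjLin_div_le {t : ℂ} {r : ℝ} (hr : 0 < r) (ht : ‖t‖ ≤ r ^ 2) (w : ℂ) :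
    ‖conjLin 1 (t / r ^ 2) w‖ ≤ 2 * ‖w‖ := by
  rw [conjLin_apply, one_mul, two_mul]
  refine (norm_add_le _ _).trans (add_le_add_right ?_ _)
  rw [norm_mul, norm_div, RCLike.norm_conj, norm_pow, Complex.norm_real, Real.norm_of_nonneg hr.le]
  exact mul_le_of_le_one_left (norm_nonneg _) ((div_le_one (by positivity)).2 ht)

theorem ae_uniformDisk (r : ℝ) : ∀ᵐ w ∂(uniformDisk r), ‖w‖ ≤ r := by
  filter_upwards [ProbabilityTheory.ae_cond_mem (μ := volume)
    (measurableSet_closedBall (x := (0 : ℂ)) (ε := r))] with w hw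
  exact mem_closedBall_zero_iff.1 hw

theorem tendsto_integral_truncLog_ellipseLaw {t : ℂ} {r : ℝ} (hr : 0 < r) (ht : ‖t‖ ≤ r ^ 2)
    {σ : ℕ → ℝ} (hσ : ∀ n, |σ n| ≤ 1) (hlim : Tendsto σ atTop (𝓝 1)) (z : ℂ) {δ : ℝ}
    (hδ : 0 < δ) : Tendsto (fun n => ∫ u, truncLog δ (z - u) ∂(ellipseLaw (σ n * t) r)) atTop
      (𝓝 (∫ u, truncLog δ (z - u) ∂(ellipseLaw t r))) := by
  have := uniformDisk_isProbabilityMeasure hr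
  have hc : Continuous fun u => truncLog δ (z - u) :=
    (truncLog_continuous hδ).comp (continuous_const.sub continuous_id)
  have hmap : ∀ t' : ℂ, ∫ u, truncLog δ (z - u) ∂(ellipseLaw t' r) =
      ∫ w, truncLog δ (z - conjLin 1 (t' / r ^ 2) w) ∂(uniformDisk r) := fun t' => by
    rw [ellipseLaw, integral_map (conjLin 1 (t' / r ^ 2)).continuous.aemeasurable
      hc.aestronglyMeasurable]
  simp_rw [hmap]
  refine tendsto_integral_of_dominated_convergence
    (fun _ => |Real.log δ| + |Real.log (max δ (‖z‖ + 2 * r))|) (fun n => ?_) (integrable_const _)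
    (fun n => ?_) (ae_of_all _ fun w => ?_)
  · exact (hc.comp (conjLin 1 (σ n * t / r ^ 2)).continuous).aestronglyMeasurable
  · filter_upwards [ae_uniformDisk r] with w hw
    have h1 : ‖(σ n : ℂ) * t‖ ≤ r ^ 2 := by
      rw [norm_mul, Complex.norm_real, Real.norm_eq_abs]
      exact (mul_le_of_le_one_left (norm_nonneg _) (hσ n)).trans ht
    have h2 : ‖z - conjLin 1 (σ n * t / r ^ 2) w‖ ≤ ‖z‖ + 2 * r := by
      refine (norm_sub_le _ _).trans (add_le_add_right ?_ _)
      exact (norm_conjLin_div_le hr h1 w).trans (by linarith)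
    have h3 : truncLog δ (z - conjLin 1 (σ n * t / r ^ 2) w) ≤
        Real.log (max δ (‖z‖ + 2 * r)) :=
      Real.log_le_log (lt_max_of_lt_left hδ) (max_le_max_left _ h2)
    have h4 := log_radius_le_truncLog hδ (z - conjLin 1 (σ n * t / r ^ 2) w)
    rw [Real.norm_eq_abs, abs_le]
    have h5 := neg_abs_le (Real.log δ)
    have h6 := le_abs_self (Real.log (max δ (‖z‖ + 2 * r)))
    have h7 := abs_nonneg (Real.log δ)
    have h8 := abs_nonneg (Real.log (max δ (‖z‖ + 2 * r)))
    constructor <;> linarith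
  · have h1 : Tendsto (fun n => z - conjLin 1 (σ n * t / r ^ 2) w) atTop
        (𝓝 (z - conjLin 1 (t / r ^ 2) w)) := by
      have h2 : Tendsto (fun n => ((σ n : ℝ) : ℂ)) atTop (𝓝 ((1 : ℝ) : ℂ)) :=
        (Complex.continuous_ofReal.tendsto 1).comp hlim
      have h3 := (((h2.mul_const t).div_const ((r : ℂ) ^ 2)).mul_const
        ((starRingEnd ℂ) w)).const_add (1 * w)
      rw [Complex.ofReal_one, one_mul t] at h3
      simpa only [conjLin_apply] using h3.const_sub z
    exact ((truncLog_continuous hδ).tendsto _).comp h1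

/-- The upper bound for the potential that characterises the limiting distributions. -/
noncomputable def potBound (t : ℂ) (r : ℝ) (z : ℂ) : ℝ := Real.log r - 1 / 2 + quadPot t r z

theorem continuous_potBound (t : ℂ) (r : ℝ) : Continuous (potBound t r) :=
  continuous_const.add (continuous_quadPot t r)

theorem circleAverage_potBound (t : ℂ) (r : ℝ) (z : ℂ) (δ : ℝ) :
    Real.circleAverage (potBound t r) z δ =
      potBound t r z + r ^ 2 / (2 * (r ^ 4 - ‖t‖ ^ 2)) * δ ^ 2 := by
  have h1 : Real.circleAverage (potBound t r) z δ = Real.log r - 1 / 2 +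
      Real.circleAverage (quadPot t r) z δ := by
    unfold potBound
    rw [Real.circleAverage_fun_add (circleIntegrable_const _ _ _)
      ((continuous_quadPot t r).continuousOn.circleIntegrable'), Real.circleAverage_const]
  rw [h1, circleAverage_quadPot, potBound]
  ring

/-- The averaged bounds for `s * t` pass to the limit `s → 1`: the truncated kernel is continuous,
and for fixed `r' > r` the quadratic form stays nonsingular up to `‖t‖ = r ^ 2`. -/
theorem potentialLe_ellipseLaw {t : ℂ} {r r' : ℝ} (hr : 0 < r) (hr' : r < r') (ht : ‖t‖ ≤ r ^ 2)
    (h : ∀ s : ℝ, 0 ≤ s → s < 1 → ∀ z, PotentialLe (ellipseLaw (s * t) r) z (potBound (s * t) r' z))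
    (z : ℂ) : PotentialLe (ellipseLaw t r) z (potBound t r' z) := by
  have hr0 : 0 < r' := hr.trans hr'
  have h0 := norm_nonneg t
  have hpos : 0 < r' ^ 4 - ‖t‖ ^ 2 := by
    have h1 : ‖t‖ < r' ^ 2 := by nlinarith
    nlinarith
  set σ : ℕ → ℝ := fun n => n / (n + 1) with hσ
  have hσ0 : ∀ n, 0 ≤ σ n := fun n => by positivity
  have hσ1 : ∀ n, σ n < 1 := fun n => by
    rw [hσ]; simp only; rw [div_lt_one (by positivity)]; linarith
  have hlim : Tendsto σ atTop (𝓝 1) := tendsto_natCast_div_add_atTop 1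
  have hσa : ∀ n, |σ n| ≤ 1 := fun n => by rw [abs_of_nonneg (hσ0 n)]; exact (hσ1 n).le
  set A := r' ^ 2 / (2 * (r' ^ 4 - ‖t‖ ^ 2)) with hA
  have hA0 : 0 < A := by positivity
  have := ellipseLaw_isProbabilityMeasure t hr
  have hbound : ∀ δ : ℝ, 0 < δ →
      ∫ u, truncLog δ (z - u) ∂(ellipseLaw t r) ≤ potBound t r' z + A * δ ^ 2 := by
    intro δ hδ
    have hcont : Continuous fun s : ℝ => (‖(s : ℂ) * t‖, ((starRingEnd ℂ) (s * t) * z ^ 2).re) := by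
      fun_prop
    have h1 : Tendsto (fun n => potBound (σ n * t) r' z +
        r' ^ 2 / (2 * (r' ^ 4 - ‖(σ n : ℂ) * t‖ ^ 2)) * δ ^ 2) atTop
        (𝓝 (potBound t r' z + A * δ ^ 2)) := by
      have h2 : ContinuousAt (fun s : ℝ => potBound (s * t) r' z +
          r' ^ 2 / (2 * (r' ^ 4 - ‖(s : ℂ) * t‖ ^ 2)) * δ ^ 2) 1 := by
        unfold potBound quadPot
        have hne : 2 * (r' ^ 4 - ‖((1 : ℝ) : ℂ) * t‖ ^ 2) ≠ 0 := by
          rw [Complex.ofReal_one, one_mul]; positivity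
        fun_prop (disch := assumption)
      have h3 := h2.tendsto.comp hlim
      simp only [Complex.ofReal_one, one_mul] at h3
      exact h3
    refine le_of_tendsto_of_tendsto' (tendsto_integral_truncLog_ellipseLaw hr ht hσa hlim z hδ) h1
      fun n => ?_
    have := ellipseLaw_isProbabilityMeasure (σ n * t) hr
    rw [← circleAverage_potBound]
    exact integral_truncLog_le_of_potentialLe (continuous_potBound _ _) (h (σ n) (hσ0 n) (hσ1 n)) z hδ
  have hint : ∀ δ : ℝ, 0 < δ → Integrable (fun u => truncLog δ (z - u)) (ellipseLaw t r) := by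
    have hmom : HasLogMoment (ellipseLaw t r) := by
      have := uniformDisk_isProbabilityMeasure hr
      unfold HasLogMoment ellipseLaw
      rw [integrable_map_measure (truncLog_continuous one_pos).aestronglyMeasurable
        (conjLin 1 (t / r ^ 2)).continuous.aemeasurable]
      refine Integrable.of_bound ((truncLog_continuous one_pos).comp
        (conjLin 1 (t / r ^ 2)).continuous).aestronglyMeasurable (Real.log (max 1 (2 * r))) ?_
      filter_upwards [ae_uniformDisk r] with w hw
      have h1 : 0 ≤ truncLog 1 (conjLin 1 (t / r ^ 2) w) := Real.log_nonneg (le_max_left _ _)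
      rw [Function.comp_apply, Real.norm_of_nonneg h1]
      exact Real.log_le_log (by positivity) (max_le_max_left _
        ((norm_conjLin_div_le hr ht w).trans (by linarith)))
    exact fun δ hδ => hmom.integrable_truncLog hδ z
  intro η hη
  -- This radius makes the smoothing error `A * δ ^ 2` at most `η`.
  refine ⟨√(η / A), Real.sqrt_pos.2 (by positivity), fun δ hδ hδ' K => ?_⟩
  have h1 : δ ^ 2 ≤ η / A := by
    rw [← Real.sq_sqrt (show 0 ≤ η / A by positivity)]
    exact pow_le_pow_left₀ hδ.le hδ' 2
  have h2 : A * δ ^ 2 ≤ η := by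
    rw [le_div_iff₀ hA0] at h1; linarith
  refine le_trans ?_ ((hbound δ hδ).trans (by linarith))
  refine integral_mono ((hint δ hδ).inf (integrable_const K)) (hint δ hδ) fun u => min_le_left _ _

/-! ### Joukowski curves -/

/-- The ellipse `w + t / w`, `|w| = R`. -/
noncomputable def joukowski (t : ℂ) (R : ℝ) (θ : ℝ) : ℂ :=
  circleMap 0 R θ + t / circleMap 0 R θ

theorem continuous_joukowski (t : ℂ) {R : ℝ} (hR : 0 < R) : Continuous (joukowski t R) :=
  (continuous_circleMap 0 R).add
    (continuous_const.div (continuous_circleMap 0 R) fun _ => circleMap_ne_center hR.ne')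

theorem norm_joukowski_le (t : ℂ) {R : ℝ} (hR : 0 < R) (θ : ℝ) :
    ‖joukowski t R θ‖ ≤ R + ‖t‖ / R := by
  refine (norm_add_le _ _).trans_eq ?_
  rw [norm_div, norm_circleMap_zero, abs_of_pos hR]

theorem exists_roots (t u : ℂ) : ∃ v v' : ℂ, v + v' = u ∧ v * v' = t := by
  obtain ⟨d, hd⟩ := IsAlgClosed.exists_pow_nat_eq (u ^ 2 - 4 * t) (n := 2) (by norm_num)
  refine ⟨(u + d) / 2, (u - d) / 2, by ring, ?_⟩
  linear_combination -hd / 4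

/-- If `v + v' = u` and `v v' = t`, then `w + t / w - u = (w - v) (w - v') / w`. The kernel along
the curve thus reduces to kernels along a circle. -/
theorem ae_log_joukowski {t : ℂ} {R : ℝ} (hR : 0 < R) {u v v' : ℂ} (hu : v + v' = u)
    (ht : v * v' = t) : ∀ᵐ θ ∂angleMeasure, joukowski t R θ - u ≠ 0 ∧
      Real.log ‖joukowski t R θ - u‖ = Real.log ‖circleMap 0 R θ - v‖ +
        Real.log ‖circleMap 0 R θ - v'‖ - Real.log R := by
  filter_upwards [ae_circleMap_notMem (x := 0) hR (Set.countable_singleton v),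
    ae_circleMap_notMem (x := 0) hR (Set.countable_singleton v')] with θ h1 h2
  set w := circleMap 0 R θ with hw
  have hw0 : w ≠ 0 := circleMap_ne_center hR.ne'
  have hwn : ‖w‖ = R := by rw [hw, norm_circleMap_zero, abs_of_pos hR]
  have h1' : w - v ≠ 0 := sub_ne_zero.2 h1
  have h2' : w - v' ≠ 0 := sub_ne_zero.2 h2
  have heq : joukowski t R θ - u = (w - v) * (w - v') / w := by
    rw [joukowski, ← hw, ← hu, ← ht]
    field_simp
    ring
  rw [heq]
  refine ⟨div_ne_zero (mul_ne_zero h1' h2') hw0, ?_⟩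
  rw [norm_div, norm_mul, hwn, Real.log_div (by positivity) hR.ne',
    Real.log_mul (norm_ne_zero_iff.2 h1') (norm_ne_zero_iff.2 h2')]

theorem integrable_log_circleMap {R : ℝ} (v : ℂ) :
    Integrable (fun θ => Real.log ‖circleMap 0 R θ - v‖) angleMeasure :=
  (integrable_angleMeasure_iff (f := fun z => Real.log ‖z - v‖)).2
    (circleIntegrable_log_norm_sub_const R)

theorem integral_log_circleMap {R : ℝ} (hR : 0 < R) (v : ℂ) :
    ∫ θ, Real.log ‖circleMap 0 R θ - v‖ ∂angleMeasure = Real.log (max R ‖v‖) := by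
  rw [← circleAverage_eq_integral_angleMeasure (fun z => Real.log ‖z - v‖),
    circleAverage_log_norm_sub hR, truncLog, zero_sub, norm_neg]

theorem integrable_log_joukowski (t : ℂ) {R : ℝ} (hR : 0 < R) (u : ℂ) :
    Integrable (fun θ => Real.log ‖joukowski t R θ - u‖) angleMeasure := by
  obtain ⟨v, v', hu, ht⟩ := exists_roots t u
  refine (((integrable_log_circleMap (R := R) v).add (integrable_log_circleMap (R := R) v')).sub
    (integrable_const (Real.log R))).congr ?_
  filter_upwards [ae_log_joukowski hR hu ht] with θ hθ
  rw [hθ.2]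
  rfl

theorem integral_log_joukowski {t : ℂ} {R : ℝ} (hR : 0 < R) {u v v' : ℂ} (hu : v + v' = u)
    (ht : v * v' = t) : ∫ θ, Real.log ‖joukowski t R θ - u‖ ∂angleMeasure =
      Real.log (max R ‖v‖) + Real.log (max R ‖v'‖) - Real.log R := by
  have h1 : ∫ θ, Real.log ‖joukowski t R θ - u‖ ∂angleMeasure =
      ∫ θ, (Real.log ‖circleMap 0 R θ - v‖ + Real.log ‖circleMap 0 R θ - v'‖ - Real.log R)
        ∂angleMeasure := by
    refine integral_congr_ae ?_
    filter_upwards [ae_log_joukowski hR hu ht] with θ hθ using hθ.2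
  have i1 := integrable_log_circleMap (R := R) v
  have i2 := integrable_log_circleMap (R := R) v'
  have e1 := integral_sub (i1.add i2) (integrable_const (Real.log R))
  have e2 := integral_add i1 i2
  simp only [Pi.add_apply] at e1
  rw [h1, e1, e2, integral_log_circleMap hR, integral_log_circleMap hR, integral_const,
    probReal_univ, one_smul]

theorem log_le_integral_log_joukowski (t : ℂ) {R : ℝ} (hR : 0 < R) (u : ℂ) :
    Real.log R ≤ ∫ θ, Real.log ‖joukowski t R θ - u‖ ∂angleMeasure := by
  obtain ⟨v, v', hu, ht⟩ := exists_roots t u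
  rw [integral_log_joukowski hR hu ht]
  have h1 := Real.log_le_log hR (le_max_left R ‖v‖)
  have h2 := Real.log_le_log hR (le_max_left R ‖v'‖)
  linarith

/-- On `‖w‖ = R` the curve is `w + (t / R²) w̄`, so `quadPot_apply` evaluates the bound. What
remains besides `Real.log R` is harmonic in `w` and has mean zero. -/
theorem potBound_joukowski {t : ℂ} {R : ℝ} (hR : 0 < R) (ht : ‖t‖ < R ^ 2) (θ : ℝ) :
    potBound t R (joukowski t R θ) =
      Real.log R + ((starRingEnd ℂ) t * circleMap 0 R θ ^ 2).re / (2 * R ^ 4) := by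
  set w := circleMap 0 R θ with hw
  have hw0 : w ≠ 0 := circleMap_ne_center hR.ne'
  have hRc : (R : ℂ) ≠ 0 := by exact_mod_cast hR.ne'
  have hwn : w * (starRingEnd ℂ) w = (R : ℂ) ^ 2 := by
    rw [Complex.mul_conj', hw, norm_circleMap_zero, abs_of_pos hR]
  have h1 : joukowski t R θ = t * ((starRingEnd ℂ) w / R ^ 2) +
      R ^ 2 * (starRingEnd ℂ) ((starRingEnd ℂ) w / R ^ 2) := by
    rw [joukowski, ← hw]
    simp
    field_simp
    linear_combination (-t) * hwn
  have h2 : (t * ((starRingEnd ℂ) w / R ^ 2) + R ^ 2 * (starRingEnd ℂ) ((starRingEnd ℂ) w / R ^ 2)) *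
      ((starRingEnd ℂ) w / R ^ 2) = 1 + (((R ^ 4)⁻¹ : ℝ) : ℂ) *
        (starRingEnd ℂ) ((starRingEnd ℂ) t * w ^ 2) := by
    simp
    field_simp
    linear_combination (R : ℂ) ^ 2 * hwn
  rw [potBound, h1, quadPot_apply ht, h2, Complex.add_re, Complex.one_re, Complex.re_ofReal_mul,
    Complex.conj_re]
  field_simp
  ring

theorem integral_potBound_joukowski {t : ℂ} {R : ℝ} (hR : 0 < R) (ht : ‖t‖ < R ^ 2) :
    ∫ θ, potBound t R (joukowski t R θ) ∂angleMeasure = Real.log R := by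
  simp_rw [potBound_joukowski hR ht]
  set f : ℂ → ℂ := fun z => (starRingEnd ℂ) t * z ^ 2 with hf
  have hfd : Differentiable ℂ f := by fun_prop
  have h1 : Real.circleAverage f 0 R = f 0 := hfd.diffContOnCl.circleAverage
  have h2 := Complex.reCLM.circleAverage_comp_comm
    (hfd.continuous.continuousOn.circleIntegrable' (c := 0) (R := R))
  have h3 : Real.circleAverage (fun z => (f z).re) 0 R = 0 := by
    have h4 : Real.circleAverage (fun z => (f z).re) 0 R = (Real.circleAverage f 0 R).re := h2
    rw [h4, h1, hf]; simp
  rw [circleAverage_eq_integral_angleMeasure] at h3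
  have hi : Integrable (fun θ => (f (circleMap 0 R θ)).re) angleMeasure :=
    (integrable_angleMeasure_iff (f := fun z => (f z).re)).2
      (Complex.continuous_re.comp hfd.continuous).continuousOn.circleIntegrable'
  rw [integral_add (integrable_const _) (hi.div_const _), integral_const, probReal_univ, one_smul,
    integral_div, h3, zero_div, add_zero]

theorem integrable_potBound_joukowski (t : ℂ) {R : ℝ} (hR : 0 < R) :
    Integrable (fun θ => potBound t R (joukowski t R θ)) angleMeasure := by
  have hc : Continuous fun θ => potBound t R (joukowski t R θ) :=
    (continuous_potBound t R).comp (continuous_joukowski t hR)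
  unfold angleMeasure
  refine Integrable.smul_measure ?_ (ENNReal.inv_ne_top.2 (by simp [Real.pi_pos]))
  exact hc.integrableOn_Ioc

section

variable {ν : Measure ℂ} [IsProbabilityMeasure ν] {t : ℂ} {R : ℝ}

/-- Equality in the averaged bound over a Joukowski curve. -/
theorem joukowski_equality (hR : 0 < R) (ht : ‖t‖ < R ^ 2)
    (h : ∀ z, PotentialLe ν z (potBound t R z)) :
    (∀ᵐ θ ∂angleMeasure, logPot ν (joukowski t R θ) = potBound t R (joukowski t R θ)) ∧
      ∀ᵐ u ∂ν, ∀ v v' : ℂ, v + v' = u → v * v' = t → ‖v‖ ≤ R := by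
  have hmom := (h 0).hasLogMoment
  have h1 := integral_le_of_potentialLe hmom (continuous_joukowski t hR).measurable
    (norm_joukowski_le t hR) (integrable_log_joukowski t hR) (log_le_integral_log_joukowski t hR)
    (fun u => by
      obtain ⟨v, v', hu, hv⟩ := exists_roots t u
      filter_upwards [ae_log_joukowski hR hu hv] with θ hθ using hθ.1)
    (integrable_potBound_joukowski t hR) (fun θ => h _)
  obtain ⟨hae, hpot, hJ, heq, hle⟩ := h1
  rw [integral_potBound_joukowski hR ht] at hle
  -- For each `u` the mean of the kernel along the curve is at least `Real.log R`, whereas the bound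
  -- has mean exactly `Real.log R`. Equality must therefore hold almost everywhere, in `θ` and in
  -- `u`.
  have hge : Real.log R ≤ ∫ u, (∫ θ, Real.log ‖joukowski t R θ - u‖ ∂angleMeasure) ∂ν := by
    have := integral_mono (integrable_const (Real.log R)) hJ (log_le_integral_log_joukowski t hR)
    simpa using this
  constructor
  · refine (integral_eq_iff_of_ae_le hpot (integrable_potBound_joukowski t hR) hae).1 ?_
    rw [integral_potBound_joukowski hR ht, ← heq]
    exact le_antisymm hle hge
  · have h2 : (fun _ : ℂ => Real.log R) =ᵐ[ν]
        fun u => ∫ θ, Real.log ‖joukowski t R θ - u‖ ∂angleMeasure := by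
      refine (integral_eq_iff_of_ae_le (integrable_const _) hJ
        (ae_of_all _ (log_le_integral_log_joukowski t hR))).1 ?_
      rw [integral_const, probReal_univ, one_smul]
      exact le_antisymm hge hle
    filter_upwards [h2] with u hu v v' hv ht'
    rw [integral_log_joukowski hR hv ht'] at hu
    have h3 := Real.log_le_log hR (le_max_left R ‖v'‖)
    have h4 : Real.log (max R ‖v‖) ≤ Real.log R := by linarith
    rw [Real.log_le_log_iff (lt_max_of_lt_left hR) hR] at h4
    exact (le_max_right _ _).trans h4

end

theorem continuousAt_logPot {ν : Measure ℂ} [IsProbabilityMeasure ν] {L : Set ℂ} (hL : IsCompact L)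
    (hν : ∀ᵐ u ∂ν, u ∈ L) {z : ℂ} (hz : z ∉ L) : ContinuousAt (logPot ν) z := by
  obtain ⟨d, hd, hball⟩ := Metric.isOpen_iff.1 hL.isClosed.isOpen_compl z hz
  obtain ⟨M, hM⟩ := hL.isBounded.exists_norm_le
  refine continuousAt_of_dominated
    (bound := fun _ => |Real.log (d / 2)| + |Real.log (‖z‖ + d / 2 + M)|) ?_ ?_
    (integrable_const _) ?_
  · exact Eventually.of_forall fun x => by
      have : Measurable fun w : ℂ => Real.log ‖x - w‖ := by fun_prop
      exact this.aestronglyMeasurable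
  · filter_upwards [Metric.ball_mem_nhds z (half_pos hd)] with x hx
    filter_upwards [hν] with u hu
    rw [mem_ball_iff_norm] at hx
    have h1 : d / 2 ≤ ‖x - u‖ := by
      have h2 : d ≤ ‖u - z‖ := by
        by_contra! hlt
        exact hball (mem_ball_iff_norm.2 hlt) hu
      have h3 := norm_sub_le_norm_sub_add_norm_sub u x z
      rw [norm_sub_rev u x] at h3
      linarith
    have h2 : ‖x - u‖ ≤ ‖z‖ + d / 2 + M := by
      have h3 := norm_sub_le x u
      have h4 := norm_le_norm_add_norm_sub' x z
      have h5 := hM u hu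
      linarith
    have h3 := Real.log_le_log (by positivity) h1
    have h4 := Real.log_le_log (by linarith) h2
    have h5 := neg_abs_le (Real.log (d / 2))
    have h6 := le_abs_self (Real.log (‖z‖ + d / 2 + M))
    rw [Real.norm_eq_abs, abs_le]
    constructor <;> linarith [abs_nonneg (Real.log (d / 2)),
      abs_nonneg (Real.log (‖z‖ + d / 2 + M))]
  · filter_upwards [hν] with u hu
    have hne : ‖z - u‖ ≠ 0 := norm_ne_zero_iff.2 (sub_ne_zero.2 fun h => hz (h ▸ hu))
    fun_prop (disch := assumption)

theorem eq_of_ae_angleMeasure_eq {f h : ℝ → ℝ} {θ : ℝ} (hθ : θ ∈ Set.Ioc 0 (2 * Real.pi))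
    (hf : ContinuousAt f θ) (hh : ContinuousAt h θ) (heq : f =ᵐ[angleMeasure] h) : f θ = h θ := by
  by_contra hne
  have h1 : ∀ᶠ x in 𝓝 θ, f x - h x ≠ 0 :=
    (hf.sub hh).eventually_ne (sub_ne_zero.2 hne)
  obtain ⟨ε, hε, hball⟩ := Metric.eventually_nhds_iff.1 h1
  have h2 : ∀ᵐ x ∂(volume.restrict (Set.Ioc 0 (2 * Real.pi))), f x = h x := by
    exact (Measure.ae_ennreal_smul_measure_iff (ENNReal.inv_ne_zero.2 ENNReal.ofReal_ne_top)).1 heq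
  rw [ae_restrict_iff' measurableSet_Ioc] at h2
  -- An interval to the left of `θ` stays inside `(0, 2π]` even when `θ = 2π`.
  have h3 : Set.Ioo (max 0 (θ - ε)) θ ⊆ {x | ¬(x ∈ Set.Ioc 0 (2 * Real.pi) → f x = h x)} := by
    intro x hx hcon
    have hx0 := (le_max_left _ _).trans_lt hx.1
    have hx1 := (le_max_right _ _).trans_lt hx.1
    refine hball (y := x) ?_ (sub_eq_zero.2 (hcon ⟨hx0, hx.2.le.trans hθ.2⟩))
    rw [Real.dist_eq, abs_lt]
    constructor <;> linarith [hx.2]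
  have h4 := measure_mono_null h3 h2
  rw [Real.volume_Ioo, ENNReal.ofReal_eq_zero] at h4
  have := max_lt hθ.1 (sub_lt_self θ hε)
  linarith

/-! ### Degenerate ellipses -/

/-- The closed ellipse, a segment if `|t| = r²`. -/
def closedEllipse (t : ℂ) (r : ℝ) : Set ℂ := conjLin 1 (t / r ^ 2) '' Metric.closedBall 0 r

theorem isCompact_closedEllipse (t : ℂ) (r : ℝ) : IsCompact (closedEllipse t r) :=
  (isCompact_closedBall _ _).image (conjLin 1 (t / r ^ 2)).continuous

/-- With `e² = q`, the map is twice the orthogonal projection onto the real line spanned by `e`;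
this is the collapse of the ellipse to a segment. -/
theorem exists_conjLin_eq_mul_re {q : ℂ} (hq : ‖q‖ = 1) :
    ∃ e : ℂ, ‖e‖ = 1 ∧ e ^ 2 = q ∧
      ∀ w, conjLin 1 q w = e * ((2 * ((starRingEnd ℂ) e * w).re : ℝ) : ℂ) := by
  obtain ⟨e, he⟩ := IsAlgClosed.exists_pow_nat_eq q (n := 2) (by norm_num)
  have he1 : ‖e‖ = 1 := by
    have h1 : ‖e‖ ^ 2 = 1 := by rw [← norm_pow, he, hq]
    exact (pow_eq_one_iff_of_nonneg (norm_nonneg e) two_ne_zero).1 h1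
  refine ⟨e, he1, he, fun w => ?_⟩
  have h1 : e * (starRingEnd ℂ) e = 1 := by rw [Complex.mul_conj', he1]; norm_num
  have h2 : ((2 * ((starRingEnd ℂ) e * w).re : ℝ) : ℂ) =
      (starRingEnd ℂ) e * w + e * (starRingEnd ℂ) w := by
    have := Complex.add_conj ((starRingEnd ℂ) e * w)
    rw [← this]; simp
  rw [h2, conjLin_apply, ← he]
  linear_combination (-w) * h1

/-- The coordinate along the line solves a quadratic equation, so there are at most two points. -/
theorem finite_line_inter_sphere {e : ℂ} (he : ‖e‖ = 1) (c : ℂ) (s : ℝ) :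
    ((Set.range fun x : ℝ => e * (x : ℂ)) ∩ Metric.sphere c s).Finite := by
  set β := ((starRingEnd ℂ) e * c).re with hβ
  have hexp : ∀ x : ℝ, e * (x : ℂ) ∈ Metric.sphere c s →
      x ^ 2 - 2 * x * β + ‖c‖ ^ 2 = s ^ 2 := by
    intro x hx
    rw [mem_sphere_iff_norm] at hx
    have h1 := norm_sub_sq_eq_re (e * (x : ℂ)) c
    have h2 : ((starRingEnd ℂ) (e * (x : ℂ)) * c).re = x * β := by
      rw [map_mul, Complex.conj_ofReal, hβ, ← Complex.re_ofReal_mul]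
      congr 1; ring
    rw [hx, h2, norm_mul, he, one_mul, Complex.norm_real, Real.norm_eq_abs, sq_abs] at h1
    linarith
  rcases Set.eq_empty_or_nonempty ((Set.range fun x : ℝ => e * (x : ℂ)) ∩ Metric.sphere c s)
    with h0 | ⟨_, ⟨x₀, rfl⟩, hx₀⟩
  · rw [h0]; exact Set.finite_empty
  · refine Set.Finite.subset (s := {e * (x₀ : ℂ), e * ((2 * β - x₀ : ℝ) : ℂ)}) (by simp) ?_
    rintro _ ⟨⟨x, rfl⟩, hx⟩
    have h1 := hexp x hx
    have h2 := hexp x₀ hx₀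
    have h3 : (x - x₀) * (x + x₀ - 2 * β) = 0 := by linarith
    rcases mul_eq_zero.1 h3 with h | h
    · left
      simp only
      rw [sub_eq_zero.1 h]
    · right
      simp only
      have : x = 2 * β - x₀ := by linarith
      rw [this]
      rfl

section

variable {t : ℂ} {r : ℝ}

theorem conjLin_div_of_norm_eq (hr : 0 < r) {v v' : ℂ} (hv : ‖v‖ = r) (ht : v * v' = t) :
    conjLin 1 (t / r ^ 2) v = v + v' := by
  have hrc : (r : ℂ) ≠ 0 := by exact_mod_cast hr.ne'
  have h1 : v * (starRingEnd ℂ) v = (r : ℂ) ^ 2 := by rw [Complex.mul_conj', hv]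
  rw [conjLin_apply, one_mul, ← ht]
  field_simp
  linear_combination v' * h1

/-- Letting `R` decrease to `r`, both roots `v`, `v'` attached to `u` have modulus at most `r`.
Their product has modulus `r ^ 2`, so both have modulus `r`, and `u = v + t / v = v + (t / r²) v̄`.
-/
theorem ae_mem_closedEllipse {ν : Measure ℂ} [IsProbabilityMeasure ν] (hr : 0 < r)
    (ht : ‖t‖ = r ^ 2) (h : ∀ R : ℝ, r < R → ∀ z, PotentialLe ν z (potBound t R z)) :
    ∀ᵐ u ∂ν, u ∈ closedEllipse t r := by
  have h1 : ∀ n : ℕ, ∀ᵐ u ∂ν, ∀ v v' : ℂ, v + v' = u → v * v' = t →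
      ‖v‖ ≤ r + 1 / ((n : ℝ) + 1) := by
    intro n
    have hn : 0 < 1 / ((n : ℝ) + 1) := by positivity
    refine (joukowski_equality (by positivity) ?_ (h _ (by linarith))).2
    rw [ht]
    nlinarith
  filter_upwards [ae_all_iff.2 h1] with u hu
  obtain ⟨v, v', huv, hvt⟩ := exists_roots t u
  have hle : ∀ v v' : ℂ, v + v' = u → v * v' = t → ‖v‖ ≤ r := by
    intro v v' huv hvt
    have hlim : Tendsto (fun n : ℕ => r + 1 / ((n : ℝ) + 1)) atTop (𝓝 (r + 0)) :=
      tendsto_one_div_add_atTop_nhds_zero_nat.const_add r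
    rw [add_zero] at hlim
    exact ge_of_tendsto' hlim fun n => hu n v v' huv hvt
  have h2 := hle v v' huv hvt
  have h3 := hle v' v (by rw [add_comm, huv]) (by rw [mul_comm, hvt])
  have h4 : ‖v‖ * ‖v'‖ = r ^ 2 := by rw [← norm_mul, hvt, ht]
  have h5 : ‖v‖ = r := by
    refine le_antisymm h2 ?_
    by_contra! hlt
    nlinarith [norm_nonneg v, norm_nonneg v']
  refine ⟨v, mem_closedBall_zero_iff.2 h2, ?_⟩
  rw [conjLin_div_of_norm_eq hr h5 hvt, huv]

/-- A point off the segment lies on the Joukowski curve of some radius `R > r`. The almost sure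
equality along that curve holds at the point itself, since the potential is continuous off the
segment. The radius depends only on `z`, so the value is common to all admissible measures. -/
theorem exists_logPot_eq_potBound (hr : 0 < r) (ht : ‖t‖ = r ^ 2) {z : ℂ}
    (hz : z ∉ closedEllipse t r) : ∃ R : ℝ, ∀ ν : Measure ℂ, IsProbabilityMeasure ν →
      (∀ R : ℝ, r < R → ∀ z, PotentialLe ν z (potBound t R z)) →
        logPot ν z = potBound t R z := by
  have hroot : ∃ w w' : ℂ, w + w' = z ∧ w * w' = t ∧ r < ‖w‖ := by
    obtain ⟨v, v', huv, hvt⟩ := exists_roots t z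
    have h4 : ‖v‖ * ‖v'‖ = r ^ 2 := by rw [← norm_mul, hvt, ht]
    have hne : ‖v‖ ≠ r := fun hv => hz
      ⟨v, mem_closedBall_zero_iff.2 hv.le, by rw [conjLin_div_of_norm_eq hr hv hvt, huv]⟩
    rcases lt_or_gt_of_ne hne with hlt | hgt
    · refine ⟨v', v, by rw [add_comm, huv], by rw [mul_comm, hvt], ?_⟩
      by_contra! hle
      nlinarith [norm_nonneg v, norm_nonneg v']
    · exact ⟨v, v', huv, hvt, hgt⟩
  obtain ⟨w, w', hz', hw, hR⟩ := hroot
  set R := ‖w‖ with hRdef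
  have hR0 : 0 < R := hr.trans hR
  refine ⟨R, fun ν _ h => ?_⟩
  obtain ⟨θ, hθ, hθw⟩ : w ∈ circleMap 0 R '' Set.Ioc 0 (2 * Real.pi) := by
    rw [image_circleMap_Ioc]; simp [hRdef]
  have hjz : joukowski t R θ = z := by
    have hw0 : w ≠ 0 := norm_pos_iff.1 hR0
    rw [joukowski, hθw, ← hz', ← hw, mul_div_cancel_left₀ _ hw0]
  have htR : ‖t‖ < R ^ 2 := by rw [ht]; nlinarith
  have hae := (joukowski_equality hR0 htR (h R hR)).1
  have hc : ContinuousAt (joukowski t R) θ := (continuous_joukowski t hR0).continuousAt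
  have hlog : ContinuousAt (logPot ν) (joukowski t R θ) := by
    rw [hjz]
    exact continuousAt_logPot (isCompact_closedEllipse t r) (ae_mem_closedEllipse hr ht h) hz
  have h1 := eq_of_ae_angleMeasure_eq hθ (hlog.comp hc)
    ((continuous_potBound t R).continuousAt.comp hc) hae
  simpa only [Function.comp_apply, hjz] using h1

theorem measure_eq_of_potentialLe (hr : 0 < r) (ht : ‖t‖ = r ^ 2) {ν ν' : Measure ℂ}
    [IsProbabilityMeasure ν] [IsProbabilityMeasure ν']
    (h : ∀ R : ℝ, r < R → ∀ z, PotentialLe ν z (potBound t R z))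
    (h' : ∀ R : ℝ, r < R → ∀ z, PotentialLe ν' z (potBound t R z)) : ν = ν' := by
  have hq : ‖t / (r : ℂ) ^ 2‖ = 1 := by
    rw [norm_div, norm_pow, Complex.norm_real, Real.norm_of_nonneg hr.le, ht,
      div_self (by positivity)]
  obtain ⟨e, he, -, hT⟩ := exists_conjLin_eq_mul_re hq
  refine measure_eq_of_logPot (h (r + 1) (by linarith) 0).hasLogMoment
    (h' (r + 1) (by linarith) 0).hasLogMoment (S := closedEllipse t r) (c := 0) (fun x s _ => ?_)
    fun z hz => ?_
  · refine (finite_line_inter_sphere he x s).subset (Set.inter_subset_inter_left _ ?_)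
    rintro _ ⟨w, _, rfl⟩
    exact ⟨_, (hT w).symm⟩
  · obtain ⟨R, hR⟩ := exists_logPot_eq_potBound hr ht hz
    rw [hR ν inferInstance h, hR ν' inferInstance h', add_zero]

end

section

variable {Ω : Type*} [MeasurableSpace Ω] {P : Measure Ω} [IsProbabilityMeasure P] {ξ : ℕ → Ω → ℂ}
  {a : ℕ → ℕ → ℂ} {g : ℝ → ℝ} {r : ℝ} {t : ℂ} {ν : ℂ → Measure ℂ}

/-- The evolution of the uniform distribution on a disk. -/
theorem IsDiskProfile.zeroLimit_eq (h : IsDiskProfile g r) (hξ : IsCoefficientNoise P ξ)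
    (ha : IsExponentialProfile a g) (hg : IsRegularProfile g)
    (hνp : ∀ t, IsProbabilityMeasure (ν t)) (hν : ∀ t, IsZeroLimit P ξ a t (ν t))
    (hν0 : ν 0 = uniformDisk r) (hr : 0 < r) (ht : ‖t‖ ≤ r ^ 2) : ν t = ellipseLaw t r := by
  have h0 : IsZeroLimit P ξ a 0 (uniformDisk r) := hν0 ▸ hν 0
  rcases ht.lt_or_eq with hlt | heq
  · exact h.eq_ellipseLaw_of_lt hξ ha hg h0 (hν t) hr hlt
  have := ellipseLaw_isProbabilityMeasure t hr
  -- Both the limit and the segment law satisfy the bounds for all `R > r`, the latter because the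
  -- laws at times `s * t` with `s < 1` are already known to be limits of zeros.
  refine measure_eq_of_potentialLe hr heq (fun R hR z => ?_) fun R hR z => ?_
  · exact h.potentialLe hξ ha hg (hν t) hr hR.le (by rw [heq]; nlinarith) z
  · refine potentialLe_ellipseLaw hr hR ht (fun s hs0 hs1 z => ?_) z
    have hst : ‖(s : ℂ) * t‖ < r ^ 2 := by
      rw [norm_mul, Complex.norm_real, Real.norm_of_nonneg hs0, heq]
      have : 0 < r ^ 2 := by positivity
      nlinarith
    rw [← h.eq_ellipseLaw_of_lt hξ ha hg h0 (hν (s * t)) hr hst]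
    exact h.potentialLe hξ ha hg (hν (s * t)) hr hR.le (hst.trans (by nlinarith)) z

end

/-! ### Transport between uniform distributions on coaxial ellipses -/

/-- Cauchy–Schwarz through the pointwise inequality `(1 - l) X² + (1 - l') Y² ≤ (X - Y)²`, valid for
positive `l`, `l'` with `l * l' = 1`. The best ratio is `l = B / A`; adding `ε` to both allows one
of them to vanish, as happens for a segment. -/
theorem sq_sub_mul_le_integral {α : Type*} [MeasurableSpace α] {q : Measure α} {X Y : α → ℝ}
    (hX : Integrable (fun p => X p ^ 2) q) (hY : Integrable (fun p => Y p ^ 2) q)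
    (hXY : Integrable (fun p => (X p - Y p) ^ 2) q) {A B m : ℝ} (hA : 0 ≤ A) (hB : 0 ≤ B)
    (hm : 0 ≤ m) (hXm : ∫ p, X p ^ 2 ∂q = A ^ 2 * m) (hYm : ∫ p, Y p ^ 2 ∂q = B ^ 2 * m) :
    (A - B) ^ 2 * m ≤ ∫ p, (X p - Y p) ^ 2 ∂q := by
  have key : ∀ ε : ℝ, 0 < ε →
      (A - B) ^ 2 * m - ε * ((A + B) * m) ≤ ∫ p, (X p - Y p) ^ 2 ∂q := by
    intro ε hε
    have hA' : 0 < A + ε := by positivity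
    have hB' : 0 < B + ε := by positivity
    set l := (B + ε) / (A + ε) with hl
    set l' := (A + ε) / (B + ε) with hl'
    have hll : l * l' = 1 := by rw [hl, hl']; field_simp
    have hl0 : 0 < l := by positivity
    have hpt : ∀ p, (1 - l) * X p ^ 2 + (1 - l') * Y p ^ 2 ≤ (X p - Y p) ^ 2 := by
      intro p
      have h1 : 0 ≤ l' * (l * X p - Y p) ^ 2 := by positivity
      have h2 : l' * (l * X p - Y p) ^ 2 = l * X p ^ 2 - 2 * X p * Y p + l' * Y p ^ 2 := by
        linear_combination (l * X p ^ 2 - 2 * X p * Y p) * hll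
      nlinarith
    have h1 := integral_mono ((hX.const_mul (1 - l)).add (hY.const_mul (1 - l'))) hXY hpt
    have e1 := integral_add (hX.const_mul (1 - l)) (hY.const_mul (1 - l'))
    simp only [Pi.add_apply] at h1
    rw [e1, integral_const_mul, integral_const_mul, hXm, hYm] at h1
    refine le_trans ?_ h1
    have h2 : l * A ^ 2 ≤ (B + ε) * A := by
      rw [hl, div_mul_eq_mul_div, div_le_iff₀ hA']
      nlinarith [mul_nonneg hB'.le (mul_nonneg hA hε.le)]
    have h3 : l' * B ^ 2 ≤ (A + ε) * B := by
      rw [hl', div_mul_eq_mul_div, div_le_iff₀ hB']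
      nlinarith [mul_nonneg hA'.le (mul_nonneg hB hε.le)]
    nlinarith [mul_le_mul_of_nonneg_right h2 hm, mul_le_mul_of_nonneg_right h3 hm]
  have hlim : Tendsto (fun ε : ℝ => (A - B) ^ 2 * m - ε * ((A + B) * m)) (𝓝[>] 0)
      (𝓝 ((A - B) ^ 2 * m)) := by
    have hc : Continuous fun ε : ℝ => (A - B) ^ 2 * m - ε * ((A + B) * m) := by fun_prop
    simpa using (hc.tendsto 0).mono_left nhdsWithin_le_nhds
  exact le_of_tendsto hlim (by filter_upwards [self_mem_nhdsWithin] with ε hε using key ε hε)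

/-- The second moment of the uniform distribution on a disk. -/
noncomputable def secondMoment (r : ℝ) : ℝ := ∫ w, ‖w‖ ^ 2 ∂(uniformDisk r)

section

variable {r : ℝ} {κ : ℂ} {s u : ℝ}

theorem integrable_of_continuous_uniformDisk (hr : 0 < r) {f : ℂ → ℝ} (hf : Continuous f) :
    Integrable f (uniformDisk r) := by
  rw [uniformDisk, ProbabilityTheory.cond]
  refine Integrable.smul_measure (hf.continuousOn.integrableOn_compact (isCompact_closedBall _ _))
    (ENNReal.inv_ne_top.2 (Metric.measure_closedBall_pos volume _ hr).ne')

theorem couplings_conjLin {q : Measure (ℂ × ℂ)}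
    (hq : q ∈ couplings ((uniformDisk r).map (conjLin 1 (s * κ)))
      ((uniformDisk r).map (conjLin 1 (u * κ)))) (hr : 0 < r) {f : ℂ → ℝ} (hf : Continuous f) :
    (Integrable (fun p => f p.1) q ∧ ∫ p, f p.1 ∂q = ∫ w, f (conjLin 1 (s * κ) w) ∂(uniformDisk r)) ∧
    (Integrable (fun p => f p.2) q ∧
      ∫ p, f p.2 ∂q = ∫ w, f (conjLin 1 (u * κ) w) ∂(uniformDisk r)) := by
  have key : ∀ (c : ℂ) (π : ℂ × ℂ → ℂ), Measurable π → q.map π = (uniformDisk r).map (conjLin 1 c) →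
      Integrable (fun p => f (π p)) q ∧
        ∫ p, f (π p) ∂q = ∫ w, f (conjLin 1 c w) ∂(uniformDisk r) := by
    intro c π hπ hmap
    have hc := (conjLin 1 c).continuous
    have h1 : Integrable f (q.map π) := by
      rw [hmap, integrable_map_measure hf.aestronglyMeasurable hc.aemeasurable]
      exact integrable_of_continuous_uniformDisk hr (hf.comp hc)
    refine ⟨(integrable_map_measure hf.aestronglyMeasurable hπ.aemeasurable).1 h1, ?_⟩
    rw [← integral_map hπ.aemeasurable hf.aestronglyMeasurable, hmap,
      integral_map hc.aemeasurable hf.aestronglyMeasurable]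
  exact ⟨key _ _ measurable_fst hq.1, key _ _ measurable_snd hq.2⟩

/-- In the frame rotated by `e`, where `κ = ‖κ‖ e²`, the two maps scale the coordinates by `1 ± s
‖κ‖` and `1 ± u ‖κ‖`. These factors are nonnegative, so the second moments of the marginals bound
the cost below in each coordinate. -/
theorem transportCost_ge (hr : 0 < r) (hκ : ‖κ‖ ≤ 1) (hs : s ∈ Set.Icc (0 : ℝ) 1)
    (hu : u ∈ Set.Icc (0 : ℝ) 1) {q : Measure (ℂ × ℂ)}
    (hq : q ∈ couplings ((uniformDisk r).map (conjLin 1 (s * κ)))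
      ((uniformDisk r).map (conjLin 1 (u * κ)))) :
    ENNReal.ofReal ((u - s) ^ 2 * ‖κ‖ ^ 2 * secondMoment r) ≤ transportCost q := by
  obtain ⟨e, he, heκ⟩ : ∃ e : ℂ, ‖e‖ = 1 ∧ κ = ‖κ‖ * e ^ 2 := by
    rcases eq_or_ne κ 0 with rfl | h0
    · exact ⟨1, norm_one, by simp⟩
    · have hn : ‖κ‖ ≠ 0 := norm_ne_zero_iff.2 h0
      have hnc : (‖κ‖ : ℂ) ≠ 0 := by exact_mod_cast hn
      obtain ⟨e, he, he2, -⟩ := exists_conjLin_eq_mul_re (q := κ / ‖κ‖) (by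
        rw [norm_div, Complex.norm_real, norm_norm, div_self hn])
      exact ⟨e, he, by rw [he2]; field_simp⟩
  set k := ‖κ‖ with hk
  have hk0 : 0 ≤ k := norm_nonneg κ
  have hee : (starRingEnd ℂ) e * e = 1 := by rw [Complex.conj_mul', he]; norm_num
  set c₁ : ℂ → ℝ := fun z => ((starRingEnd ℂ) e * z).re with hc₁
  set c₂ : ℂ → ℝ := fun z => ((starRingEnd ℂ) e * z).im with hc₂
  have hc₁c : Continuous c₁ := by fun_prop
  have hc₂c : Continuous c₂ := by fun_prop
  have hT : ∀ (x : ℝ) (w : ℂ), (starRingEnd ℂ) e * conjLin 1 (x * κ) w =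
      (starRingEnd ℂ) e * w + (x * k : ℝ) * (starRingEnd ℂ) ((starRingEnd ℂ) e * w) := by
    intro x w
    rw [conjLin_apply, heκ]
    push_cast
    rw [map_mul, Complex.conj_conj]
    linear_combination (x * k * e * (starRingEnd ℂ) w) * hee
  have hT₁ : ∀ (x : ℝ) (w : ℂ), c₁ (conjLin 1 (x * κ) w) = (1 + x * k) * c₁ w := by
    intro x w
    simp only [hc₁]
    rw [hT, Complex.add_re, Complex.re_ofReal_mul, Complex.conj_re]
    ring
  have hT₂ : ∀ (x : ℝ) (w : ℂ), c₂ (conjLin 1 (x * κ) w) = (1 - x * k) * c₂ w := by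
    intro x w
    simp only [hc₂]
    rw [hT, Complex.add_im, Complex.im_ofReal_mul, Complex.conj_im]
    ring
  have hnorm : ∀ z, ‖z‖ ^ 2 = c₁ z ^ 2 + c₂ z ^ 2 := by
    intro z
    have : ‖(starRingEnd ℂ) e * z‖ ^ 2 = c₁ z ^ 2 + c₂ z ^ 2 := by
      rw [← Complex.normSq_eq_norm_sq, Complex.normSq_apply]; ring
    rw [← this, norm_mul, RCLike.norm_conj, he, one_mul]
  have hsub₁ : ∀ z w, c₁ (z - w) = c₁ z - c₁ w := fun z w => by simp [hc₁, mul_sub]; ring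
  have hsub₂ : ∀ z w, c₂ (z - w) = c₂ z - c₂ w := fun z w => by simp [hc₂, mul_sub]; ring
  have hsk : ∀ x ∈ Set.Icc (0 : ℝ) 1, 0 ≤ x * k ∧ x * k ≤ 1 := fun x hx =>
    ⟨mul_nonneg hx.1 hk0, mul_le_one₀ hx.2 hk0 hκ⟩
  have hmain : ∀ (c : ℂ → ℝ), Continuous c → (∀ z w, c (z - w) = c z - c w) →
      ∀ A B : ℝ, 0 ≤ A → 0 ≤ B → (∀ w, c (conjLin 1 (s * κ) w) = A * c w) →
      (∀ w, c (conjLin 1 (u * κ) w) = B * c w) →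
      Integrable (fun p : ℂ × ℂ => c (p.1 - p.2) ^ 2) q ∧
      (A - B) ^ 2 * ∫ w, c w ^ 2 ∂(uniformDisk r) ≤ ∫ p, c (p.1 - p.2) ^ 2 ∂q := by
    intro c hc hcsub A B hA hB hcA hcB
    obtain ⟨⟨i1, e1⟩, i2, e2⟩ := couplings_conjLin hq hr (f := fun z => c z ^ 2) (hc.pow 2)
    have i3 : Integrable (fun p : ℂ × ℂ => (c p.1 - c p.2) ^ 2) q := by
      refine ((i1.add i2).const_mul 2).mono' ?_ (ae_of_all _ fun p => ?_)
      · have : Continuous fun p : ℂ × ℂ => (c p.1 - c p.2) ^ 2 := by fun_prop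
        exact this.measurable.aestronglyMeasurable
      · rw [Real.norm_of_nonneg (sq_nonneg _)]
        simp only [Pi.add_apply]
        nlinarith [sq_nonneg (c p.1 + c p.2)]
    simp_rw [hcA, mul_pow, integral_const_mul] at e1
    simp_rw [hcB, mul_pow, integral_const_mul] at e2
    simp_rw [hcsub]
    exact ⟨i3, sq_sub_mul_le_integral i1 i2 i3 hA hB
      (integral_nonneg fun w => sq_nonneg _) e1 e2⟩
  obtain ⟨j1, m1⟩ := hmain c₁ hc₁c hsub₁ (1 + s * k) (1 + u * k) (by linarith [(hsk s hs).1])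
    (by linarith [(hsk u hu).1]) (hT₁ s) (hT₁ u)
  obtain ⟨j2, m2⟩ := hmain c₂ hc₂c hsub₂ (1 - s * k) (1 - u * k) (by linarith [(hsk s hs).2])
    (by linarith [(hsk u hu).2]) (hT₂ s) (hT₂ u)
  have hmom : secondMoment r = ∫ w, c₁ w ^ 2 ∂(uniformDisk r) + ∫ w, c₂ w ^ 2 ∂(uniformDisk r) := by
    have i1 : Integrable (fun w => c₁ w ^ 2) (uniformDisk r) :=
      integrable_of_continuous_uniformDisk hr (hc₁c.pow 2)
    have i2 : Integrable (fun w => c₂ w ^ 2) (uniformDisk r) :=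
      integrable_of_continuous_uniformDisk hr (hc₂c.pow 2)
    rw [secondMoment, ← integral_add i1 i2]
    exact integral_congr_ae (ae_of_all _ hnorm)
  have hcost : transportCost q = ENNReal.ofReal (∫ p, (c₁ (p.1 - p.2) ^ 2 + c₂ (p.1 - p.2) ^ 2) ∂q) := by
    have j3 : Integrable (fun p : ℂ × ℂ => c₁ (p.1 - p.2) ^ 2 + c₂ (p.1 - p.2) ^ 2) q := j1.add j2
    rw [transportCost, ofReal_integral_eq_lintegral_ofReal j3
      (ae_of_all _ fun p => add_nonneg (sq_nonneg _) (sq_nonneg _))]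
    refine lintegral_congr fun p => ?_
    rw [← hnorm, ENNReal.ofReal_pow (norm_nonneg _), ofReal_norm]
  rw [hcost, integral_add j1 j2]
  refine ENNReal.ofReal_le_ofReal (le_trans (le_of_eq ?_) (add_le_add m1 m2))
  rw [hmom]
  ring

theorem map_prod_mem_couplings {μ : Measure ℂ} {F G : ℂ → ℂ} (hF : Measurable F)
    (hG : Measurable G) : μ.map (fun w => (F w, G w)) ∈ couplings (μ.map F) (μ.map G) := by
  constructor
  · rw [Measure.map_map measurable_fst (hF.prodMk hG)]; rfl
  · rw [Measure.map_map measurable_snd (hF.prodMk hG)]; rfl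

theorem transportCost_map_conjLin (hr : 0 < r) :
    transportCost ((uniformDisk r).map fun w => (conjLin 1 (s * κ) w, conjLin 1 (u * κ) w)) =
      ENNReal.ofReal ((u - s) ^ 2 * ‖κ‖ ^ 2 * secondMoment r) := by
  have hm : Measurable fun p : ℂ × ℂ => ‖p.1 - p.2‖ₑ ^ 2 := by fun_prop
  have hmeas : Measurable fun w => (conjLin 1 (s * κ) w, conjLin 1 (u * κ) w) :=
    (conjLin 1 (s * κ)).continuous.measurable.prodMk (conjLin 1 (u * κ)).continuous.measurable
  rw [transportCost, lintegral_map hm hmeas, secondMoment, ← integral_const_mul,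
    ofReal_integral_eq_lintegral_ofReal
      ((integrable_of_continuous_uniformDisk hr (by fun_prop)).const_mul _)
      (ae_of_all _ fun w => by positivity)]
  refine lintegral_congr fun w => ?_
  have h1 : conjLin 1 (s * κ) w - conjLin 1 (u * κ) w = ((s - u : ℝ) : ℂ) * κ * (starRingEnd ℂ) w := by
    simp only [conjLin_apply]
    push_cast
    ring
  simp only
  rw [h1, ← ofReal_norm, ← ENNReal.ofReal_pow (norm_nonneg _), norm_mul, norm_mul,
    Complex.norm_real, RCLike.norm_conj, Real.norm_eq_abs, mul_pow, mul_pow, sq_abs]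
  congr 1
  ring

theorem wasserstein_conjLin (hr : 0 < r) (hκ : ‖κ‖ ≤ 1) (hs : s ∈ Set.Icc (0 : ℝ) 1)
    (hu : u ∈ Set.Icc (0 : ℝ) 1) :
    wasserstein ((uniformDisk r).map (conjLin 1 (s * κ))) ((uniformDisk r).map (conjLin 1 (u * κ))) =
      ENNReal.ofReal |u - s| * ENNReal.ofReal (‖κ‖ * √(secondMoment r)) := by
  have hM : 0 ≤ secondMoment r := integral_nonneg fun w => by positivity
  have h1 : ⨅ q ∈ couplings ((uniformDisk r).map (conjLin 1 (s * κ)))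
      ((uniformDisk r).map (conjLin 1 (u * κ))), transportCost q =
      ENNReal.ofReal ((u - s) ^ 2 * ‖κ‖ ^ 2 * secondMoment r) := by
    refine le_antisymm ?_ (le_iInf₂ fun q hq => transportCost_ge hr hκ hs hu hq)
    rw [← transportCost_map_conjLin hr]
    exact iInf₂_le _ (map_prod_mem_couplings (conjLin 1 (s * κ)).continuous.measurable
      (conjLin 1 (u * κ)).continuous.measurable)
  rw [wasserstein, h1, ← ENNReal.ofReal_mul (abs_nonneg _),
    ENNReal.ofReal_rpow_of_nonneg (by positivity) (by norm_num), ← Real.sqrt_eq_rpow]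
  congr 1
  rw [Real.sqrt_mul (by positivity), Real.sqrt_mul (by positivity), Real.sqrt_sq_eq_abs,
    Real.sqrt_sq (norm_nonneg _), mul_assoc]

theorem conjLin_zero : (conjLin 1 0 : ℂ → ℂ) = id := by ext u; simp

theorem isOptimalMap_of_ae_eq (hr : 0 < r) (hκ : ‖κ‖ ≤ 1) {T : ℂ → ℂ}
    (hT : T =ᵐ[uniformDisk r] conjLin 1 κ) :
    IsOptimalMap T (uniformDisk r) ((uniformDisk r).map (conjLin 1 κ)) := by
  have hm := (conjLin 1 κ).continuous.measurable
  have h1 : (uniformDisk r).map (fun z => (z, T z)) =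
      (uniformDisk r).map fun z => (z, conjLin 1 κ z) := by
    refine Measure.map_congr ?_
    filter_upwards [hT] with z hz
    rw [hz]
  have h0 : (uniformDisk r).map (conjLin 1 (((0 : ℝ) : ℂ) * κ)) = uniformDisk r := by
    rw [Complex.ofReal_zero, zero_mul, conjLin_zero, Measure.map_id]
  have h2 := transportCost_map_conjLin (s := 0) (u := 1) (κ := κ) hr
  simp only [Complex.ofReal_zero, zero_mul, conjLin_zero, id_eq, Complex.ofReal_one, one_mul] at h2
  refine ⟨hm.aemeasurable.congr hT.symm, ?_, fun q hq => ?_⟩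
  · rw [h1]
    have := map_prod_mem_couplings (μ := uniformDisk r) measurable_id hm
    rwa [Measure.map_id] at this
  · rw [h1, h2]
    refine transportCost_ge (s := 0) (u := 1) hr hκ ⟨le_rfl, zero_le_one⟩ ⟨zero_le_one, le_rfl⟩ ?_
    rwa [h0, Complex.ofReal_one, one_mul]

theorem isWassersteinGeodesic_conjLin (hr : 0 < r) (hκ : ‖κ‖ ≤ 1) {μ : ℝ → Measure ℂ}
    (hμ : ∀ s ∈ Set.Icc (0 : ℝ) 1, μ s = (uniformDisk r).map (conjLin 1 (s * κ))) :
    IsWassersteinGeodesic μ := by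
  have hW : ∀ s ∈ Set.Icc (0 : ℝ) 1, ∀ u ∈ Set.Icc (0 : ℝ) 1, wasserstein (μ s) (μ u) =
      ENNReal.ofReal |u - s| * ENNReal.ofReal (‖κ‖ * √(secondMoment r)) := fun s hs u hu => by
    rw [hμ s hs, hμ u hu, wasserstein_conjLin hr hκ hs hu]
  have h01 := hW 0 ⟨le_rfl, zero_le_one⟩ 1 ⟨zero_le_one, le_rfl⟩
  rw [sub_zero, abs_one, ENNReal.ofReal_one, one_mul] at h01
  refine ⟨by rw [h01]; exact ENNReal.ofReal_ne_top, fun s hs u hu => ?_⟩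
  rw [hW s hs u hu, h01]

end

/-- Inside the disk `α₀(w) = ‖w‖² / r²`, and `‖w‖² / w = w̄`. The origin and the boundary circle are
null sets. -/
theorem IsDiskProfile.transportMap_ae_eq {a : ℕ → ℕ → ℂ} {g : ℝ → ℝ} {r : ℝ}
    (h : IsDiskProfile g r) (ha : IsExponentialProfile a g) (hg : IsRegularProfile g) (hr : 0 < r)
    (t : ℂ) : transportMap g t =ᵐ[uniformDisk r] conjLin 1 (t / r ^ 2) := by
  have hac : uniformDisk r ≪ volume := ProbabilityTheory.cond_absolutelyContinuous
  have h1 : ∀ᵐ w ∂(uniformDisk r), w ∉ Metric.sphere (0 : ℂ) r :=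
    hac.ae_le (measure_eq_zero_iff_ae_notMem.1 (Measure.addHaar_sphere volume (0 : ℂ) r))
  have h2 : ∀ᵐ w ∂(uniformDisk r), w ∉ ({0} : Set ℂ) :=
    hac.ae_le (measure_eq_zero_iff_ae_notMem.1 (measure_singleton (0 : ℂ)))
  filter_upwards [ae_uniformDisk r, h1, h2] with w hw hw1 hw0
  have hwr : ‖w‖ < r := lt_of_le_of_ne hw fun h => hw1 (mem_sphere_zero_iff_norm.2 h)
  have hw0' : w ≠ 0 := hw0
  have hwpos : 0 < ‖w‖ := norm_pos_iff.2 hw0'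
  have hq : ‖w‖ / r < 1 := (div_lt_one hr).2 hwr
  have hq0 : 0 < ‖w‖ / r := by positivity
  have hα : (‖w‖ / r) ^ 2 ∈ Set.Ioo (0 : ℝ) 1 := ⟨by positivity, by nlinarith⟩
  have hαw := alphaZero_eq ha hg (z := w) hα (by
    rw [h _ hα, Real.log_pow, Real.log_div hwpos.ne' hr.ne']
    push_cast
    ring)
  have hrc : (r : ℂ) ≠ 0 := by exact_mod_cast hr.ne'
  have hwc : w * (starRingEnd ℂ) w = (‖w‖ : ℂ) ^ 2 := Complex.mul_conj' w
  rw [transportMap, hαw, conjLin_apply]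
  push_cast
  field_simp
  linear_combination (-t) * hwc

end HeatFlowZeros

theorem theorem5p5 {Ω : Type*} [MeasurableSpace Ω] (P : Measure Ω) [IsProbabilityMeasure P]
    (ξ : ℕ → Ω → ℂ) (a : ℕ → ℕ → ℂ) (g : ℝ → ℝ)
    (hξ : HeatFlowZeros.IsCoefficientNoise P ξ)
    (ha : HeatFlowZeros.IsExponentialProfile a g)
    (hg : HeatFlowZeros.IsRegularProfile g)
    (ν : ℂ → Measure ℂ) (hνp : ∀ t : ℂ, IsProbabilityMeasure (ν t))
    (hν : ∀ t : ℂ, HeatFlowZeros.IsZeroLimit P ξ a t (ν t)) :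
    (∀ t : ℂ, t ≠ 0 → ‖t‖ₑ < HeatFlowZeros.tSing g →
      (HeatFlowZeros.IsOptimalMap (HeatFlowZeros.transportMap g t) (ν 0) (ν t) ↔
        ∃ r : ℝ, 0 < r ∧ ν 0 = HeatFlowZeros.uniformDisk r)) ∧
    (∀ r : ℝ, 0 < r → ν 0 = HeatFlowZeros.uniformDisk r →
      ∀ τ : ℂ, ‖τ‖ ≤ r ^ 2 →
        HeatFlowZeros.IsWassersteinGeodesic (fun s : ℝ => ν ((s : ℂ) * τ))) := by
  have h0 : ν 0 = HeatFlowZeros.profileMeasure g :=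
    HeatFlowZeros.zeroLimit_zero_eq hξ ha hg (hν 0)
  have hdisk : ∀ r : ℝ, 0 < r → ν 0 = HeatFlowZeros.uniformDisk r →
      HeatFlowZeros.IsDiskProfile g r := fun r hr h =>
    HeatFlowZeros.isDiskProfile_of_eq hg hr (h0 ▸ h)
  have hq : ∀ (r : ℝ) (t : ℂ), 0 < r → ‖t‖ ≤ r ^ 2 → ‖t / (r : ℂ) ^ 2‖ ≤ 1 := by
    intro r t hr ht
    rw [norm_div, norm_pow, Complex.norm_real, Real.norm_of_nonneg hr.le]
    exact (div_le_one (by positivity)).2 ht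
  refine ⟨fun t ht htsing => ⟨fun hopt => ?_, ?_⟩, fun r hr hνr τ hτ => ?_⟩
  · rw [h0] at hopt
    obtain ⟨r, hr, hD⟩ := HeatFlowZeros.exists_isDiskProfile hg fun α hα =>
      HeatFlowZeros.deriv2_of_isOptimalMap ha hg ht hopt hα
    exact ⟨r, hr, by rw [h0, hD.profileMeasure_eq hg hr]⟩
  · rintro ⟨r, hr, hνr⟩
    have hD := hdisk r hr hνr
    have htr : ‖t‖ ≤ r ^ 2 := by
      have h1 := htsing.trans_le (hD.tSing_le hr)
      rw [← ofReal_norm, ENNReal.ofReal_lt_ofReal_iff (by positivity)] at h1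
      exact h1.le
    rw [hD.zeroLimit_eq hξ ha hg hνp hν hνr hr htr, hνr]
    exact HeatFlowZeros.isOptimalMap_of_ae_eq hr (hq r t hr htr)
      (hD.transportMap_ae_eq ha hg hr t)
  -- The slope is `κ = τ / r ^ 2`; the hypothesis on `τ` is precisely `‖κ‖ ≤ 1`, and it covers all
  -- intermediate times `s * τ`.
  · refine HeatFlowZeros.isWassersteinGeodesic_conjLin hr (hq r τ hr hτ) fun s hs => ?_
    have hs' : ‖(s : ℂ) * τ‖ ≤ r ^ 2 := by
      rw [norm_mul, Complex.norm_real, Real.norm_of_nonneg hs.1]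
      exact (mul_le_of_le_one_left (norm_nonneg _) hs.2).trans hτ
    rw [(hdisk r hr hνr).zeroLimit_eq hξ ha hg hνp hν hνr hr hs', HeatFlowZeros.ellipseLaw,
      mul_div_assoc]
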